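/- **Setting.** Let $\Gamma$ be a group with a finite symmetric generating set $S$ whose Cayley graph $\mathrm{Cay}(\Gamma,S)$ (a metric graph with edges of length $1$, vertex set $\Gamma$) is Gromov hyperbolic, with Gromov boundary $\partial\Gamma$. Write $|\gamma|$ for the word length, $\partial^{(2)}\Gamma=\{(x,y)\in\partial\Gamma\times\partial\Gamma : x\neq y\}$, and let $P$ be a closed, $\Gamma$-invariant subset of $\partial^{(2)}\Gamma$, with projections $\Pi_1(P)=\{x:\exists y,\ (x,y)\in P\}$ and $\Pi_2(P)=\{y:\exists x,\ (x,y)\in P\}$. For $\lambda\ge 1$ and $\epsilon,b\ge 0$ let $Q_{P,(\lambda,\epsilon,b)}$ be the set of $(\lambda,\epsilon)$-quasi-geodesics $l:\mathbb R\to\mathrm{Cay}(\Gamma,S)$ (not necessarily continuous) with $d(l(0),\mathrm{id})\le b$ and $(l(+\infty),l(-\infty))\in P$, and put $$\Gamma^+_{P,(\lambda,\epsilon,b)}=\{l(t)\in\Gamma : l\in Q_{P,(\lambda,\epsilon,b)},\ t\ge 0\},\qquad Q^{+\infty}_{P,(\lambda,\epsilon,b)}=\{l(+\infty): l\in Q_{P,(\lambda,\epsilon,b)}\}\subset\Pi_1(P),\qquad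 \Gamma_P^+=\Gamma^+_{P,(1,0,0)}.$$ For $A\in\mathrm{GL}(d,\mathbb R)$ let $\sigma_1(A)\ge\dots\ge\sigma_d(A)$ be its singular values, and if $\sigma_k(A)>\sigma_{k+1}(A)$ let $U_k(A)$ be the sum of the eigenspaces of $(AA^*)^{1/2}$ that belong to the $k$ largest eigenvalues. The Grassmannian $\mathrm{Gr}_k(\mathbb R^d)$ carries the metric $$d(V,W)=\max\Big\{\max_{0\ne v\in V}\min_{0\ne w\in W}\sin\angle(v,w),\ \max_{0\ne w\in W}\min_{0\ne v\in V}\sin\angle(v,w)\Big\}.$$ Let $1\le k<d$. A representation $\rho:\Gamma\to\mathrm{GL}(d,\mathbb R)$ is *$k$-dominated on $\Gamma_P^+$* if there are $C,c>0$ with $\sigma_{k+1}(\rho(\gamma))/\sigma_k(\rho(\gamma))\le Ce^{-c|\gamma|}$ for all $\gamma\in\Gamma_P^+$. A *pair of limit maps* of $\rho$ is a pair of $\rho$-equivariant maps $\xi^k:\Pi_1(P)\to\mathrm{Gr}_k(\mathbb R^d)$, $\xi_{d-k}:\Pi_2(P)\to\mathrm{Gr}_{d-k}(\mathbb R^d)$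 such that $(x,y)\mapsto(\xi^k(x),\xi_{d-k}(y))$ is continuous on $P$, $\xi^k(x)$ and $\xi_{d-k}(y)$ are transverse for all $(x,y)\in P$, and the pair is strongly dynamics preserving: whenever $\lambda\ge1$, $\epsilon,b\ge0$, $\gamma_n\in\Gamma^+_{P,(\lambda,\epsilon,b)}$ for all $n$, $\gamma_n\to x\in\Pi_1(P)$ and $\gamma_n^{-1}\to y\in\Pi_2(P)$, one has $\rho(\gamma_n)V\to\xi^k(x)$ for every $V\in\mathrm{Gr}_k(\mathbb R^d)$ transverse to $\xi_{d-k}(y)$. A *visual metric* with parameter $\kappa>0$ is a metric $d_v$ on $\partial\Gamma$ for which there are $c_1,c_2>0$ with $c_1e^{-\kappa(x\cdot y)_{\mathrm{id}}}\le d_v(x,y)\le c_2e^{-\kappa(x\cdot y)_{\mathrm{id}}}$ for all $x,y$, where $(x\cdot y)_{\mathrm{id}}$ is the Gromov product. **Theorem.** Let $\rho:\Gamma\to\mathrm{GL}(d,\mathbb R)$ be $k$-dominated on $\Gamma_P^+$. Then $\rho$ has exactly one pair of limit maps $(\xi^k,\xi_{d-k})$, and it has the following properties. 1. (Weak $P_k$-Cartan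 property) Let $\gamma_n\in\Gamma$ with $\gamma_n\to x\in\Pi_1(P)$, and suppose that there are $\lambda\ge1$ and $\epsilon,b\ge0$ with $\gamma_n\in\Gamma^+_{P,(\lambda,\epsilon,b)}$ for all $n$. Then $\sigma_k(\rho(\gamma_n))>\sigma_{k+1}(\rho(\gamma_n))$ for all large $n$, and $\lim_{n\to\infty}U_k(\rho(\gamma_n))=\xi^k(x)$. 2. (Hölder continuity) For all sufficiently small $\kappa>0$ the function $$d_\kappa(x,y)=\inf\Big\{\sum_{i=1}^n e^{-\kappa(x_{i-1}\cdot x_i)_{\mathrm{id}}} : n\in\mathbb N,\ x_0=x,\ x_n=y,\ x_i\in\partial\Gamma\Big\}$$ is a visual metric with parameter $\kappa$. With respect to every visual metric on $\partial\Gamma$: for all $\lambda\ge1$ and $\epsilon,b\ge0$ the map $\xi^k$ is Hölder continuous on $Q^{+\infty}_{P,(\lambda,\epsilon,b)}$, and $(\xi^k,\xi_{d-k})$ is Hölder continuous on every compact subset of $P$. -/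

import Mathlib

open Filter Topology Set
open scoped NNReal ENNReal

noncomputable section

/-! ### Metric graphs -/

namespace MetricGraph

variable {V : Type*}

/-- The point at parameter `t ∈ [0,1]` of the edge from `g` to `h`, in barycentric coordinates. -/
def edgePt (g h : V) (t : ℝ) : V →₀ ℝ := Finsupp.single g (1 - t) + Finsupp.single h t

end MetricGraph

open MetricGraph in
/-- The geometric realization of a simple graph: the vertices together with all the points of
the edges, in barycentric coordinates. -/
def GraphRealization {V : Type*} (G : SimpleGraph V) : Type _ :=
  {x : V →₀ ℝ // ∃ g h : V, ∃ t : ℝ, (g = h ∨ G.Adj g h) ∧ 0 ≤ t ∧ t ≤ 1 ∧ x = edgePt g h t}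

namespace MetricGraph

variable {V : Type*} {G : SimpleGraph V}

/-- A vertex of the graph, as a point of the realization. -/
def vert (G : SimpleGraph V) (g : V) : GraphRealization G :=
  ⟨Finsupp.single g 1, g, g, 0, Or.inl rfl, le_rfl, zero_le_one, by simp [edgePt]⟩

/-- `HasChain x y r`: there is a piecewise linear path of length `r` from `x` to `y`, each piece
of which runs inside one edge. All edges have length one. -/
inductive HasChain : GraphRealization G → GraphRealization G → ℝ → Prop
  | nil (x : GraphRealization G) : HasChain x x 0
  | cons {x y z : GraphRealization G} {r : ℝ} (g h : V) (s t : ℝ) (adj : G.Adj g h)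
      (hs0 : 0 ≤ s) (hs1 : s ≤ 1) (ht0 : 0 ≤ t) (ht1 : t ≤ 1)
      (hx : x.1 = edgePt g h s) (hy : y.1 = edgePt g h t) (c : HasChain y z r) :
      HasChain x z (|s - t| + r)

/-- The path metric of the realization. -/
def pathDist (x y : GraphRealization G) : ℝ := sInf {r | HasChain x y r}

theorem HasChain.nonneg {x y : GraphRealization G} {r : ℝ} (c : HasChain x y r) : 0 ≤ r := by
  induction c with
  | nil => exact le_rfl
  | cons => positivity

theorem HasChain.trans {x y z : GraphRealization G} {r r' : ℝ} (c : HasChain x y r)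
    (c' : HasChain y z r') : HasChain x z (r + r') := by
  induction c with
  | nil => simpa using c'
  | cons g h s t adj a1 a2 a3 a4 hx hy _ ih =>
    rw [add_assoc]
    exact HasChain.cons g h s t adj a1 a2 a3 a4 hx hy (ih c')

theorem HasChain.symm {x y : GraphRealization G} {r : ℝ} (c : HasChain x y r) :
    HasChain y x r := by
  induction c with
  | nil x => exact HasChain.nil x
  | cons g h s t adj a1 a2 a3 a4 hx hy _ ih =>
    have := ih.trans (HasChain.cons g h t s adj a3 a4 a1 a2 hy hx (HasChain.nil _))
    rw [abs_sub_comm, add_comm]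
    simpa using this

theorem HasChain.coord_le {x y : GraphRealization G} {r : ℝ} (c : HasChain x y r) (a : V) :
    |x.1 a - y.1 a| ≤ r := by
  classical
  induction c with
  | nil => simp
  | @cons x y z r g h s t adj a1 a2 a3 a4 hx hy _ ih =>
    have hne : g ≠ h := adj.ne
    have key : |x.1 a - y.1 a| ≤ |s - t| := by
      rw [hx, hy]
      simp only [edgePt, Finsupp.add_apply, Finsupp.single_apply]
      by_cases h1 : g = a
      · have h2 : h ≠ a := fun h2 => hne (h1.trans h2.symm)
        simp only [h1, h2, if_true, if_false]
        rw [abs_sub_comm s t]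
        apply le_of_eq
        congr 1
        ring
      · by_cases h2 : h = a
        · simp [h1, h2]
        · simp [h1, h2]
    calc |x.1 a - z.1 a| ≤ |x.1 a - y.1 a| + |y.1 a - z.1 a| := abs_sub_le _ _ _
      _ ≤ |s - t| + r := add_le_add key ih

theorem exists_hasChain_vert (x : GraphRealization G) : ∃ g r, HasChain x (vert G g) r := by
  obtain ⟨x, g, h, t, hgh, h0, h1, rfl⟩ := x
  rcases hgh with rfl | hadj
  · refine ⟨g, 0, ?_⟩
    have : (⟨edgePt g g t, g, g, t, Or.inl rfl, h0, h1, rfl⟩ : GraphRealization G) = vert G g := by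
      apply Subtype.ext
      simp [edgePt, vert]
    rw [this]
    exact HasChain.nil _
  · exact ⟨g, _, HasChain.cons g h t 0 hadj h0 h1 le_rfl zero_le_one rfl
      (by simp [vert, edgePt]) (HasChain.nil _)⟩

theorem exists_hasChain (hG : G.Preconnected) (x y : GraphRealization G) :
    ∃ r, HasChain x y r := by
  have hv : ∀ g h : V, ∃ r, HasChain (vert G g) (vert G h) r := by
    intro g h
    obtain ⟨w⟩ := hG g h
    induction w with
    | nil => exact ⟨0, HasChain.nil _⟩
    | @cons u v w adj _ ih =>
      obtain ⟨r, hr⟩ := ih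
      exact ⟨_, HasChain.cons u v 0 1 adj le_rfl zero_le_one zero_le_one le_rfl
        (by simp [vert, edgePt]) (by simp [vert, edgePt]) hr⟩
  obtain ⟨g, r1, h1⟩ := exists_hasChain_vert x
  obtain ⟨h, r2, h2⟩ := exists_hasChain_vert y
  obtain ⟨r, hr⟩ := hv g h
  exact ⟨_, (h1.trans hr).trans h2.symm⟩

theorem bddBelow_chain (x y : GraphRealization G) : BddBelow {r | HasChain x y r} :=
  ⟨0, fun _ h => HasChain.nonneg h⟩

/-- The realization of a connected graph, as a metric space. -/
@[reducible] def metricSpace (hG : G.Preconnected) : MetricSpace (GraphRealization G) where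
  dist := pathDist
  dist_self x := le_antisymm (csInf_le (bddBelow_chain x x) (HasChain.nil x))
    (le_csInf ⟨0, HasChain.nil x⟩ fun _ h => HasChain.nonneg h)
  dist_comm x y := by
    unfold pathDist
    congr 1
    ext r
    exact ⟨HasChain.symm, HasChain.symm⟩
  dist_triangle x y z := by
    refine le_of_forall_pos_le_add fun ε hε => ?_
    obtain ⟨r, hr, hr'⟩ := exists_lt_of_csInf_lt (exists_hasChain hG x y)
      (show pathDist x y < pathDist x y + ε / 2 by linarith)
    obtain ⟨q, hq, hq'⟩ := exists_lt_of_csInf_lt (exists_hasChain hG y z)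
      (show pathDist y z < pathDist y z + ε / 2 by linarith)
    have : pathDist x z ≤ r + q := csInf_le (bddBelow_chain x z) (HasChain.trans hr hq)
    linarith
  eq_of_dist_eq_zero := by
    intro x y h
    apply Subtype.ext
    ext a
    have h1 : |x.1 a - y.1 a| ≤ pathDist x y :=
      le_csInf (exists_hasChain hG x y) fun _ hr => HasChain.coord_le hr a
    have h2 : pathDist x y = 0 := h
    rw [h2] at h1
    exact sub_eq_zero.mp (abs_nonpos_iff.mp h1)

end MetricGraph

/-! ### Cayley graphs -/

/-- A finite symmetric generating set of a group. -/
structure FinSymmGenSet (Γ : Type*) [Group Γ] where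
  carrier : Finset Γ
  inv_mem : ∀ s ∈ carrier, s⁻¹ ∈ carrier
  generates : Subgroup.closure (carrier : Set Γ) = ⊤

/-- The Cayley graph of `Γ` with respect to `S`, as a metric graph with edges of length one. -/
def Cay {Γ : Type*} [Group Γ] (S : FinSymmGenSet Γ) : Type _ :=
  GraphRealization (SimpleGraph.mulCayley (S.carrier : Set Γ))

namespace Cay

open MetricGraph

variable {Γ : Type*} [Group Γ] {S : FinSymmGenSet Γ}

theorem adj_mul_left (γ : Γ) {g h : Γ}
    (hgh : (SimpleGraph.mulCayley (S.carrier : Set Γ)).Adj g h) :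
    (SimpleGraph.mulCayley (S.carrier : Set Γ)).Adj (γ * g) (γ * h) := by
  rw [SimpleGraph.mulCayley_adj'] at hgh ⊢
  obtain ⟨hne, s, hs, h1⟩ := hgh
  refine ⟨fun h => hne (mul_left_cancel h), s, hs, ?_⟩
  rcases h1 with h1 | h1
  · left; rw [mul_assoc, h1]
  · right; rw [h1, mul_assoc]

theorem preconnected (S : FinSymmGenSet Γ) :
    (SimpleGraph.mulCayley (S.carrier : Set Γ)).Preconnected := by
  have key : ∀ γ ∈ Subgroup.closure (S.carrier : Set Γ), ∀ g : Γ,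
      (SimpleGraph.mulCayley (S.carrier : Set Γ)).Reachable g (g * γ) := by
    intro γ hγ
    induction hγ using Subgroup.closure_induction with
    | mem s hs =>
      intro g
      by_cases h : g = g * s
      · rw [← h]
      · exact SimpleGraph.Adj.reachable
          ((SimpleGraph.mulCayley_adj' _ _ _).2 ⟨h, s, hs, Or.inl rfl⟩)
    | one => intro g; simp
    | mul a b _ _ ha hb =>
      intro g
      rw [← mul_assoc]
      exact (ha g).trans (hb _)
    | inv a _ ha =>
      intro g
      have := ha (g * a⁻¹)
      rw [inv_mul_cancel_right] at this
      exact this.symm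
  intro g h
  have := key (g⁻¹ * h) (by rw [S.generates]; trivial) g
  rwa [mul_inv_cancel_left] at this

instance : MetricSpace (Cay S) := MetricGraph.metricSpace (preconnected S)

/-- The vertex of the Cayley graph that corresponds to a group element. -/
def vertex (S : FinSymmGenSet Γ) (γ : Γ) : Cay S := MetricGraph.vert _ γ

theorem mapDomain_edgePt (γ g h : Γ) (t : ℝ) :
    Finsupp.mapDomain (γ * ·) (edgePt g h t) = edgePt (γ * g) (γ * h) t := by
  simp only [edgePt, Finsupp.mapDomain_add, Finsupp.mapDomain_single]

/-- The action of `Γ` on its Cayley graph by left multiplication. -/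
instance : MulAction Γ (Cay S) where
  smul γ x := ⟨Finsupp.mapDomain (γ * ·) x.1, by
    obtain ⟨x, g, h, t, hgh, h0, h1, rfl⟩ := x
    refine ⟨γ * g, γ * h, t, ?_, h0, h1, mapDomain_edgePt γ g h t⟩
    exact hgh.imp (fun e => by rw [e]) (adj_mul_left γ)⟩
  one_smul x := by
    apply Subtype.ext
    change Finsupp.mapDomain ((1 : Γ) * ·) x.1 = x.1
    rw [show ((1 : Γ) * ·) = (id : Γ → Γ) from funext one_mul]
    exact Finsupp.mapDomain_id
  mul_smul a b x := by
    apply Subtype.ext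
    change Finsupp.mapDomain ((a * b) * ·) x.1
      = Finsupp.mapDomain (a * ·) (Finsupp.mapDomain (b * ·) x.1)
    rw [← Finsupp.mapDomain_comp]
    congr 1
    ext c
    simp [mul_assoc]

theorem smul_val (γ : Γ) (x : Cay S) : (γ • x).1 = Finsupp.mapDomain (γ * ·) x.1 := rfl

theorem smul_vertex (γ g : Γ) : γ • vertex S g = vertex S (γ * g) := by
  apply Subtype.ext
  rw [smul_val]
  exact Finsupp.mapDomain_single

theorem hasChain_smul (γ : Γ) {x y : Cay S} {r : ℝ} (c : HasChain x y r) :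
    HasChain (γ • x : Cay S) (γ • y : Cay S) r := by
  induction c with
  | nil => exact HasChain.nil _
  | cons g h s t adj a1 a2 a3 a4 hx hy _ ih =>
    refine HasChain.cons (γ * g) (γ * h) s t (adj_mul_left γ adj) a1 a2 a3 a4 ?_ ?_ ih
    · rw [← mapDomain_edgePt, ← hx]; rfl
    · rw [← mapDomain_edgePt, ← hy]; rfl

instance : IsIsometricSMul Γ (Cay S) where
  isometry_smul γ := by
    refine Isometry.of_dist_eq fun x y => ?_
    change sInf {r | HasChain (γ • x : Cay S) (γ • y : Cay S) r} = sInf {r | HasChain x y r}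
    congr 1
    ext r
    refine ⟨fun h => ?_, hasChain_smul γ⟩
    have := hasChain_smul γ⁻¹ h
    rwa [inv_smul_smul, inv_smul_smul] at this

end Cay

/-! ### Hyperbolic spaces and their boundaries -/

section Hyperbolic

variable {X : Type*} [MetricSpace X]

/-- `c`, restricted to `[0, dist x y]`, is a geodesic segment from `x` to `y`. -/
def IsGeodesicSegment (c : ℝ → X) (x y : X) : Prop :=
  c 0 = x ∧ c (dist x y) = y ∧
    ∀ s ∈ Icc 0 (dist x y), ∀ t ∈ Icc 0 (dist x y), dist (c s) (c t) = |s - t|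

/-- A `δ`-hyperbolic space: a proper geodesic space all of whose geodesic triangles are
`δ`-slim. -/
def IsDeltaHyperbolic (X : Type*) [MetricSpace X] (δ : ℝ) : Prop :=
  ProperSpace X ∧ (∀ x y : X, ∃ c, IsGeodesicSegment c x y) ∧
    ∀ (x y z : X) (a b c : ℝ → X), IsGeodesicSegment a x y → IsGeodesicSegment b y z →
      IsGeodesicSegment c z x → ∀ p ∈ a '' Icc 0 (dist x y),
        ∃ q ∈ b '' Icc 0 (dist y z) ∪ c '' Icc 0 (dist z x), dist p q ≤ δ

/-- A hyperbolic space. -/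
def IsHyperbolicSpace (X : Type*) [MetricSpace X] : Prop :=
  ∃ δ : ℝ, 0 ≤ δ ∧ IsDeltaHyperbolic X δ

/-- Geodesic rays. -/
def GeodesicRay (X : Type*) [MetricSpace X] : Type _ := {c : ℝ≥0 → X // Isometry c}

/-- Two geodesic rays are asymptotic if they stay at bounded distance. -/
def asymptoticSetoid (X : Type*) [MetricSpace X] : Setoid (GeodesicRay X) where
  r c c' := ∃ C : ℝ, ∀ t, dist (c.1 t) (c'.1 t) ≤ C
  iseqv :=
    { refl := fun c => ⟨0, fun t => by simp⟩
      symm := fun ⟨C, h⟩ => ⟨C, fun t => by rw [dist_comm]; exact h t⟩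
      trans := fun ⟨C, h⟩ ⟨C', h'⟩ =>
        ⟨C + C', fun t => (dist_triangle _ _ _).trans (add_le_add (h t) (h' t))⟩ }

/-- The Gromov boundary: geodesic rays up to the asymptotic relation. -/
def GromovBoundary (X : Type*) [MetricSpace X] : Type _ := Quotient (asymptoticSetoid X)

/-- The endpoint of a geodesic ray. -/
def GeodesicRay.endpoint (c : GeodesicRay X) : GromovBoundary X :=
  Quotient.mk (asymptoticSetoid X) c

/-- Isometric actions on a space extend to its boundary. -/
instance {Γ : Type*} [Group Γ] [MulAction Γ X] [IsIsometricSMul Γ X] :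
    MulAction Γ (GromovBoundary X) where
  smul γ := Quotient.map (sa := asymptoticSetoid X) (sb := asymptoticSetoid X)
    (fun c => ⟨fun t => γ • c.1 t, (isometry_smul X γ).comp c.2⟩)
    (fun _ _ ⟨C, h⟩ => ⟨C, fun t => by simpa using h t⟩)
  one_smul x := by
    refine Quotient.inductionOn (s := asymptoticSetoid X) x fun c => ?_
    exact congrArg (Quotient.mk (asymptoticSetoid X))
      (Subtype.ext (funext fun t => one_smul Γ (c.1 t)))
  mul_smul a b x := by
    refine Quotient.inductionOn (s := asymptoticSetoid X) x fun c => ?_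
    exact congrArg (Quotient.mk (asymptoticSetoid X))
      (Subtype.ext (funext fun t => mul_smul a b (c.1 t)))

/-- `IsRayTo p c z`: `c` is a generalized geodesic ray that starts at `p` and ends at `z`. If `z`
is a boundary point, `c` is a geodesic ray; if `z` is a point of the space, `c` is a geodesic
segment on some `[0, R]` and constant from `R` on. -/
def IsRayTo (p : X) (c : ℝ≥0 → X) : X ⊕ GromovBoundary X → Prop
  | Sum.inl x => c 0 = p ∧ ∃ R : ℝ≥0, (∀ s ≤ R, ∀ t ≤ R, dist (c s) (c t) = dist s t) ∧
      ∀ t, R ≤ t → c t = x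
  | Sum.inr ξ => c 0 = p ∧ ∃ h : Isometry c, GeodesicRay.endpoint ⟨c, h⟩ = ξ

/-- Convergence of sequences in the union of a space and its boundary, with base point `p`. -/
def ConvergesTo (p : X) (u : ℕ → X ⊕ GromovBoundary X) (z : X ⊕ GromovBoundary X) : Prop :=
  ∃ c : ℕ → ℝ≥0 → X, (∀ n, IsRayTo p (c n) (u n)) ∧
    ∀ φ : ℕ → ℕ, StrictMono φ → ∃ ψ : ℕ → ℕ, StrictMono ψ ∧ ∃ c' : ℝ≥0 → X, IsRayTo p c' z ∧
      ∀ K : Set ℝ≥0, IsCompact K → TendstoUniformlyOn (fun n => c (φ (ψ n))) c' atTop K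

theorem ConvergesTo.subseq {p : X} {u : ℕ → X ⊕ GromovBoundary X} {z : X ⊕ GromovBoundary X}
    (h : ConvergesTo p u z) {φ : ℕ → ℕ} (hφ : StrictMono φ) : ConvergesTo p (u ∘ φ) z := by
  obtain ⟨c, hc, hsub⟩ := h
  exact ⟨c ∘ φ, fun n => hc (φ n), fun φ' hφ' => hsub (φ ∘ φ') (hφ.comp hφ')⟩

/-- The topology of the boundary: a set is closed if it contains the limits of its convergent
sequences. -/
@[reducible] def boundaryTopology (p : X) : TopologicalSpace (GromovBoundary X) :=
  TopologicalSpace.ofClosed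
    {A | ∀ (u : ℕ → GromovBoundary X) (x : GromovBoundary X), (∀ n, u n ∈ A) →
      ConvergesTo p (fun n => Sum.inr (u n)) (Sum.inr x) → x ∈ A}
    (fun _ _ h _ => (h 0).elim)
    (fun _ hA u x hu hx B hB => hA hB u x (fun n => hu n B hB) hx)
    (by
      intro A hA B hB u x hu hx
      by_cases h : ∃ᶠ n in atTop, u n ∈ A
      · obtain ⟨φ, hφ, hφA⟩ := extraction_of_frequently_atTop h
        exact Or.inl (hA (u ∘ φ) x hφA (hx.subseq hφ))
      · rw [not_frequently] at h
        have h' : ∃ᶠ n in atTop, u n ∈ B :=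
          (h.mono fun n hn => (hu n).resolve_left hn).frequently
        obtain ⟨φ, hφ, hφB⟩ := extraction_of_frequently_atTop h'
        exact Or.inr (hB (u ∘ φ) x hφB (hx.subseq hφ)))

/-- A `(lam, ε)`-quasi-geodesic (not necessarily continuous). -/
def IsQuasiGeodesic (lam ε : ℝ) (l : ℝ → X) : Prop :=
  ∀ s t : ℝ, lam⁻¹ * |s - t| - ε ≤ dist (l s) (l t) ∧ dist (l s) (l t) ≤ lam * |s - t| + ε

/-- `l(+∞) = x`: the forward half of the quasi-geodesic `l` is at finite Hausdorff distance from
a geodesic ray that ends at `x`. -/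
def ForwardEnd (l : ℝ → X) (x : GromovBoundary X) : Prop :=
  ∃ c : GeodesicRay X, c.endpoint = x ∧ Metric.hausdorffEDist (l '' Ici 0) (range c.1) ≠ ⊤

/-- `l(-∞) = y`. -/
def BackwardEnd (l : ℝ → X) (y : GromovBoundary X) : Prop :=
  ∃ c : GeodesicRay X, c.endpoint = y ∧ Metric.hausdorffEDist (l '' Iic 0) (range c.1) ≠ ⊤

/-- The Gromov product of two points of a metric space. -/
def gromovProduct (p x y : X) : ℝ := (dist x p + dist y p - dist x y) / 2

/-- The Gromov product of two boundary points, with value `∞` allowed. -/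
def boundaryGromovProduct (p : X) (x y : GromovBoundary X) : ℝ≥0∞ :=
  ⨆ (u : ℕ → X) (v : ℕ → X) (_ : ConvergesTo p (fun n => Sum.inl (u n)) (Sum.inr x))
    (_ : ConvergesTo p (fun n => Sum.inl (v n)) (Sum.inr y)),
    liminf (fun mn : ℕ × ℕ => ENNReal.ofReal (gromovProduct p (u mn.1) (v mn.2))) atTop

/-- `exp (-κ (x·y)_p)`, which is zero where the Gromov product is infinite. -/
def expGromov (p : X) (κ : ℝ) (x y : GromovBoundary X) : ℝ :=
  if boundaryGromovProduct p x y = ⊤ then 0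
  else Real.exp (-κ * (boundaryGromovProduct p x y).toReal)

/-- The largest pseudo-metric below `exp (-κ (x·y)_p)`: the infimum over all finite chains. -/
def chainDist (p : X) (κ : ℝ) (x y : GromovBoundary X) : ℝ :=
  sInf {r | ∃ (n : ℕ) (c : ℕ → GromovBoundary X), c 0 = x ∧ c n = y ∧
    r = ∑ i ∈ Finset.range n, expGromov p κ (c i) (c (i + 1))}

/-- `dv` is a visual metric on the boundary with parameter `κ`. -/
structure IsVisualMetric (p : X) (κ : ℝ) (dv : GromovBoundary X → GromovBoundary X → ℝ) :
    Prop where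
  pos : 0 < κ
  eq_zero_iff : ∀ x y, dv x y = 0 ↔ x = y
  symm : ∀ x y, dv x y = dv y x
  triangle : ∀ x y z, dv x z ≤ dv x y + dv y z
  comparable : ∃ c₁ c₂ : ℝ, 0 < c₁ ∧ 0 < c₂ ∧
    ∀ x y, c₁ * expGromov p κ x y ≤ dv x y ∧ dv x y ≤ c₂ * expGromov p κ x y

end Hyperbolic

/-! ### Singular values and Grassmannians -/

section LinearAlgebra

/-- An invertible matrix as a linear map of Euclidean space. -/
def euclideanMap {d : ℕ} (A : GL (Fin d) ℝ) :
    EuclideanSpace ℝ (Fin d) →ₗ[ℝ] EuclideanSpace ℝ (Fin d) :=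
  Matrix.toEuclideanLin (A : Matrix (Fin d) (Fin d) ℝ)

/-- The `k`-th singular value, counted from `k = 1`, in decreasing order. -/
def sigma {d : ℕ} (k : ℕ) (A : GL (Fin d) ℝ) : ℝ := (euclideanMap A).singularValues (k - 1)

/-- `U_k(A)`: the sum of the eigenspaces of `(A A*)^(1/2)` with eigenvalue at least `σ_k(A)`, that
is, of those of `A A*` with eigenvalue at least `σ_k(A)²`. If `A` has a gap of index `k`, this is
the `k`-dimensional space that belongs to the `k` largest eigenvalues. -/
def topSpace {d : ℕ} (k : ℕ) (A : GL (Fin d) ℝ) : Submodule ℝ (EuclideanSpace ℝ (Fin d)) :=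
  ⨆ (μ : ℝ) (_ : sigma k A ^ 2 ≤ μ),
    Module.End.eigenspace (euclideanMap A ∘ₗ LinearMap.adjoint (euclideanMap A)) μ

/-- The Grassmannian of `k`-planes in `ℝ^d`. -/
def Gr (d k : ℕ) : Type :=
  {V : Submodule ℝ (EuclideanSpace ℝ (Fin d)) // Module.finrank ℝ V = k}

/-- `max_{v ∈ V} min_{w ∈ W} sin ∠(v, w)`, over nonzero vectors. -/
def maxMinSin {d : ℕ} (V W : Submodule ℝ (EuclideanSpace ℝ (Fin d))) : ℝ :=
  ⨆ v : {v : EuclideanSpace ℝ (Fin d) // v ∈ V ∧ v ≠ 0},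
    ⨅ w : {w : EuclideanSpace ℝ (Fin d) // w ∈ W ∧ w ≠ 0},
      Real.sin (InnerProductGeometry.angle v.1 w.1)

/-- The distance of two subspaces. -/
def grDist {d : ℕ} (V W : Submodule ℝ (EuclideanSpace ℝ (Fin d))) : ℝ :=
  max (maxMinSin V W) (maxMinSin W V)

end LinearAlgebra

/-! ### Representations that are dominated over a subflow -/

section Subflow

variable {Γ : Type*} [Group Γ] {S : FinSymmGenSet Γ}

/-- The Gromov boundary of the group, seen in its Cayley graph. -/
abbrev GroupBoundary (S : FinSymmGenSet Γ) : Type _ := GromovBoundary (Cay S)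

instance : TopologicalSpace (GroupBoundary S) := boundaryTopology (Cay.vertex S 1)

/-- `P` is a closed, `Γ`-invariant subset of the space of pairs of distinct boundary points. -/
structure IsClosedInvariant (P : Set (GroupBoundary S × GroupBoundary S)) : Prop where
  ne : ∀ q ∈ P, q.1 ≠ q.2
  closed : IsClosed {q : {q : GroupBoundary S × GroupBoundary S // q.1 ≠ q.2} | q.1 ∈ P}
  invariant : ∀ (γ : Γ) (x y : GroupBoundary S), (x, y) ∈ P → (γ • x, γ • y) ∈ P

/-- The first projection of `P`. -/
def Pi₁ (P : Set (GroupBoundary S × GroupBoundary S)) : Set (GroupBoundary S) :=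
  {x | ∃ y, (x, y) ∈ P}

/-- The second projection of `P`. -/
def Pi₂ (P : Set (GroupBoundary S × GroupBoundary S)) : Set (GroupBoundary S) :=
  {y | ∃ x, (x, y) ∈ P}

/-- `Q_{P,(lam,ε,b)}`: the quasi-geodesics that pass near the identity at time `0` and whose pair
of endpoints is in `P`. -/
def quasiGeodesics (P : Set (GroupBoundary S × GroupBoundary S)) (lam ε b : ℝ) :
    Set (ℝ → Cay S) :=
  {l | IsQuasiGeodesic lam ε l ∧ dist (l 0) (Cay.vertex S 1) ≤ b ∧
    ∃ x y, ForwardEnd l x ∧ BackwardEnd l y ∧ (x, y) ∈ P}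

/-- `Γ⁺_{P,(lam,ε,b)}`: the group elements on the forward halves of these quasi-geodesics. -/
def gammaPlus (P : Set (GroupBoundary S × GroupBoundary S)) (lam ε b : ℝ) : Set Γ :=
  {γ | ∃ l ∈ quasiGeodesics P lam ε b, ∃ t : ℝ, 0 ≤ t ∧ l t = Cay.vertex S γ}

/-- `Q^{+∞}_{P,(lam,ε,b)}`: the forward endpoints of these quasi-geodesics. -/
def forwardEnds (P : Set (GroupBoundary S × GroupBoundary S)) (lam ε b : ℝ) :
    Set (GroupBoundary S) :=
  {x | ∃ l ∈ quasiGeodesics P lam ε b, ForwardEnd l x}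

/-- The word length: the distance to the identity in the Cayley graph. -/
def wordLength (S : FinSymmGenSet Γ) (γ : Γ) : ℝ := dist (Cay.vertex S γ) (Cay.vertex S 1)

/-- `γ_n → x`, for group elements `γ_n` and a boundary point `x`. -/
def GroupTendsto (γ : ℕ → Γ) (x : GroupBoundary S) : Prop :=
  ConvergesTo (Cay.vertex S 1) (fun n => Sum.inl (Cay.vertex S (γ n))) (Sum.inr x)

variable {d k : ℕ}

/-- `ρ` is `k`-dominated on the subset `M` of the group. -/
def IsDominatedOn (S : FinSymmGenSet Γ) (k : ℕ) (ρ : Γ →* GL (Fin d) ℝ) (M : Set Γ) : Prop :=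
  ∃ C lam : ℝ, 0 < C ∧ 0 < lam ∧ ∀ γ ∈ M,
    sigma (k + 1) (ρ γ) / sigma k (ρ γ) ≤ C * Real.exp (-lam * wordLength S γ)

/-- The pair `(ξ, η)` consists of `ρ`-equivariant maps and is continuous, transverse and strongly
dynamics preserving of index `k` on `P`. -/
structure IsLimitPair (ρ : Γ →* GL (Fin d) ℝ) (P : Set (GroupBoundary S × GroupBoundary S))
    (ξ : Pi₁ P → Gr d k) (η : Pi₂ P → Gr d (d - k)) : Prop where
  equivariant_fst : ∀ (γ : Γ) (x x' : Pi₁ P), (x' : GroupBoundary S) = γ • (x : GroupBoundary S) →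
    (ξ x').1 = (ξ x).1.map (euclideanMap (ρ γ))
  equivariant_snd : ∀ (γ : Γ) (y y' : Pi₂ P), (y' : GroupBoundary S) = γ • (y : GroupBoundary S) →
    (η y').1 = (η y).1.map (euclideanMap (ρ γ))
  continuous : ∀ q : P, Tendsto
    (fun q' : P => max
      (grDist (ξ ⟨q'.1.1, q'.1.2, q'.2⟩).1 (ξ ⟨q.1.1, q.1.2, q.2⟩).1)
      (grDist (η ⟨q'.1.2, q'.1.1, q'.2⟩).1 (η ⟨q.1.2, q.1.1, q.2⟩).1)) (𝓝 q) (𝓝 0)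
  transverse : ∀ (x : Pi₁ P) (y : Pi₂ P), ((x : GroupBoundary S), (y : GroupBoundary S)) ∈ P →
    IsCompl (ξ x).1 (η y).1
  dynamics : ∀ lam ε b : ℝ, 1 ≤ lam → 0 ≤ ε → 0 ≤ b →
    ∀ (γ : ℕ → Γ) (x : Pi₁ P) (y : Pi₂ P), (∀ n, γ n ∈ gammaPlus P lam ε b) →
      GroupTendsto γ (x : GroupBoundary S) →
      GroupTendsto (fun n => (γ n)⁻¹) (y : GroupBoundary S) →
      ∀ V : Gr d k, IsCompl V.1 (η y).1 →
        Tendsto (fun n => grDist (V.1.map (euclideanMap (ρ (γ n)))) (ξ x).1) atTop (𝓝 0)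

end Subflow

end

noncomputable section

open Filter Topology Set
open scoped NNReal ENNReal
noncomputable section

/-! ### Metric graphs: points at integer distance from a vertex -/

namespace MetricGraph

variable {V : Type*} {G : SimpleGraph V}

/-! The starting point is that a geodesic line whose pair of ends is in `P` may be translated by the
inverse of any of its vertices without leaving `P`. So every increment `(g i)⁻¹ * g j` with `i ≤ j`
along such a line is in `Γ_P⁺` and is dominated (`IsVertexLine.inv_mul_mem`). Right multiplication
of `A` by an element of bounded size moves the plane `U_k(A)` by at most a constant times
`σ_{k+1}(A)/σ_k(A)`. Along the vertices of the forward half of a line, the attracting planes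
therefore move by a geometric series and converge. The limit depends only on the end, because
asymptotic rays stay at bounded distance; this defines `ξ` (`Dominates.exists_isRayLimit`).
Inversion turns a gap of index `k` into one of index `d - k`, so the same construction along
backward halves gives `η`. Equivariance follows because left multiplication commutes with taking top
planes up to the gap.

All estimates are uniform over rays that start in a fixed ball around the identity, and hyperbolic
geometry brings each case to this situation. Quasi-geodesics near the identity are uniformly close
to lines near the identity (`exists_quasiGeodesic_near_line`), and pairs of ends at visual distance
bounded below are joined by lines near the identity (`exists_isVertexLine_of_le`). Two rays
fellow-travel up to the Gromov product of their ends, so their limit planes differ by an exponential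
in that product, which is a power of the visual distance (`IsRayLimit.exists_holder`). The Cartan
property (`IsRayLimit.tendsto`) has the same source.

Transversality is the delicate point. A common nonzero vector of `ξ x` and `η y` is transported to
every vertex of the line, where it is exponentially close to the attracting plane of the next
segment and to the repelling plane of the previous one. A volume estimate
(`exists_sigmaProd_mul_le`) then shows that the product of the top `k` singular values loses a
factor of order `exp (-c n)` whenever two segments of length `n` are joined. Repeated doubling makes
this product decay faster than every exponential in the length (`false_of_doubling`), while singular
values along a word decay at most exponentially.

Given transversality, the dynamics follow from the singular value decomposition: what is away from
the repelling plane is drawn to the attracting plane. For uniqueness of `ξ`, one plane transverse to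
two candidate repelling planes has both candidate limits. For uniqueness of `η`, a vector of `η' y`
outside `η y` would be attracted to `ξ` and would by equivariance and continuity also stay close to
`η'`, against transversality. -/

theorem edgePt_apply [DecidableEq V] (g h : V) (t : ℝ) (a : V) :
    edgePt g h t a = (if g = a then 1 - t else 0) + (if h = a then t else 0) := by
  simp only [edgePt, Finsupp.add_apply, Finsupp.single_apply]

theorem edgePt_swap (g h : V) (t : ℝ) : edgePt g h t = edgePt h g (1 - t) := by
  simp [edgePt, add_comm]

/-- Barycentric coordinates determine the edge up to orientation, unless the point is a vertex. The
last two alternatives list the representations of a vertex, degenerate edges included. -/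
theorem edgePt_eq_cases {g h v w : V} {t τ : ℝ} (hgh : g ≠ h)
    (e : edgePt g h t = edgePt v w τ) :
    (v = g ∧ w = h ∧ τ = t) ∨ (v = h ∧ w = g ∧ τ = 1 - t) ∨
      (t = 0 ∧ ((v = g ∧ τ = 0) ∨ (w = g ∧ τ = 1) ∨ (v = g ∧ w = g))) ∨
      (t = 1 ∧ ((v = h ∧ τ = 0) ∨ (w = h ∧ τ = 1) ∨ (v = h ∧ w = h))) := by
  classical
  have e' := fun a => DFunLike.congr_fun e a
  simp only [edgePt_apply] at e'
  have h1 := e' g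
  have h2 := e' h
  by_cases hvg : v = g
  · subst hvg
    by_cases hwv : w = v
    · subst hwv
      have : t = 0 := by simpa [hgh, hgh.symm] using h2
      simp [this]
    · by_cases hwh : w = h
      · subst hwh
        have : t = τ := by simpa [hgh] using h2
        simp [this]
      · have ht : t = 0 := by simpa [hgh, hwh] using h2
        have hτ : 1 - t = 1 - τ := by simpa [hgh.symm, hwv] using h1
        exact Or.inr (Or.inr (Or.inl ⟨ht, Or.inl ⟨rfl, by linarith⟩⟩))
  · by_cases hvh : v = h
    · subst hvh
      by_cases hwg : w = g
      · subst hwg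
        have : 1 - t = τ := by simpa [hgh, hgh.symm] using h1
        simp [this]
      · have ht : 1 - t = 0 := by simpa [hgh.symm, hwg] using h1
        by_cases hwv : w = v
        · subst hwv
          exact Or.inr (Or.inr (Or.inr ⟨by linarith, Or.inr (Or.inr ⟨rfl, rfl⟩)⟩))
        · have hτ : t = 1 - τ := by simpa [hgh, hwv] using h2
          exact Or.inr (Or.inr (Or.inr ⟨by linarith, Or.inl ⟨rfl, by linarith⟩⟩))
    · by_cases hwg : w = g
      · subst hwg
        have ht : t = 0 := by simpa [hgh, hvh] using h2
        have hτ : 1 - t = τ := by simpa [hgh.symm, hvg] using h1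
        exact Or.inr (Or.inr (Or.inl ⟨ht, Or.inr (Or.inl ⟨rfl, by linarith⟩)⟩))
      · have ht : 1 - t = 0 := by simpa [hgh.symm, hwg, hvg] using h1
        by_cases hwh : w = h
        · subst hwh
          have hτ : t = τ := by simpa [hgh, hvh] using h2
          exact Or.inr (Or.inr (Or.inr ⟨by linarith, Or.inr (Or.inl ⟨rfl, by linarith⟩)⟩))
        · have : t = 0 := by simpa [hgh, hvh, hwh] using h2
          linarith

/-- Induction on the chain: a path changes edges only at a vertex, and there the bound for the old
edge passes to the new one. This bounds path lengths from below by graph distances. -/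
theorem HasChain.exists_rep {x z : GraphRealization G} {r : ℝ} (c : HasChain x z r) (g : V)
    (hz : z = vert G g) (hG : G.Preconnected) :
    ∃ v w τ, (v = w ∨ G.Adj v w) ∧ 0 ≤ τ ∧ τ ≤ 1 ∧ x.1 = edgePt v w τ ∧
      (G.dist v g : ℝ) + τ ≤ r := by
  induction c with
  | nil x =>
    exact ⟨g, g, 0, Or.inl rfl, le_rfl, zero_le_one, by rw [hz]; simp [vert, edgePt], by simp⟩
  | @cons x y z r a b s t adj hs0 hs1 ht0 ht1 hx hy _ ih =>
    obtain ⟨v, w, τ, hvw, h0, h1, e, hle⟩ := ih hz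
    have hd : ∀ u, (v = u ∨ w = u ∧ τ = 1 ∨ v = u) → (G.dist u g : ℝ) ≤ r := by
      rintro u (rfl | ⟨rfl, rfl⟩ | rfl)
      · linarith
      · rcases hvw with rfl | hvw
        · linarith
        · have h5 : G.dist w g ≤ G.dist w v + G.dist v g :=
            (hG w v).dist_triangle_left g
          have h6 : G.dist w v = 1 := SimpleGraph.dist_eq_one_iff_adj.2 hvw.symm
          rw [h6] at h5
          have : (G.dist w g : ℝ) ≤ 1 + G.dist v g := by exact_mod_cast h5
          linarith
      · linarith
    rcases edgePt_eq_cases adj.ne (hy.symm.trans e) with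
      ⟨rfl, rfl, rfl⟩ | ⟨rfl, rfl, rfl⟩ | ⟨rfl, h⟩ | ⟨rfl, h⟩
    · exact ⟨v, w, s, Or.inr adj, hs0, hs1, hx, by linarith [le_abs_self (s - τ)]⟩
    · exact ⟨v, w, 1 - s, Or.inr adj.symm, by linarith, by linarith,
        by rw [hx, edgePt_swap], by linarith [neg_abs_le (s - t)]⟩
    · exact ⟨a, b, s, Or.inr adj, hs0, hs1, hx,
        by linarith [le_abs_self (s - 0), hd a (by tauto)]⟩
    · exact ⟨b, a, 1 - s, Or.inr adj.symm, by linarith, by linarith,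
        by rw [hx, edgePt_swap], by linarith [neg_abs_le (s - 1), hd b (by tauto)]⟩

theorem exists_hasChain_dist (hG : G.Preconnected) (g h : V) :
    HasChain (vert G g) (vert G h) (G.dist g h) := by
  obtain ⟨p, hp⟩ := (hG g h).exists_walk_length_eq_dist
  rw [← hp]
  clear hp
  induction p with
  | nil => simpa using HasChain.nil _
  | @cons u v w adj p ih =>
    have := HasChain.cons u v 0 1 adj le_rfl zero_le_one zero_le_one le_rfl
        (show (vert G u).1 = _ by simp [vert, edgePt]) (by simp [vert, edgePt]) ih
    simpa [add_comm] using this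

/-- A point at integer distance from a vertex is a vertex. -/
theorem exists_eq_vert_of_pathDist (hG : G.Preconnected) (g : V) (x : GraphRealization G) (m : ℤ)
    (hx : pathDist x (vert G g) = m) : ∃ v, x = vert G v := by
  by_contra hne
  push Not at hne
  obtain ⟨a, b, s, hab, hs0, hs1, hxe⟩ := x.2
  have hv : ∀ u, x.1 ≠ Finsupp.single u 1 := fun u h => hne u (Subtype.ext h)
  have hadj : G.Adj a b := by
    rcases hab with rfl | h
    · exact absurd (by rw [hxe]; simp [edgePt]) (hv a)
    · exact h
  have hs0' : 0 < s := lt_of_le_of_ne hs0 fun h => hv a (by rw [hxe, ← h]; simp [edgePt])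
  have hs1' : s < 1 := lt_of_le_of_ne hs1 fun h => hv b (by rw [hxe, h]; simp [edgePt])
  -- The slack `min s (1 - s)` is at most the offset `τ` found below, so `G.dist v g < m`. The path
  -- through `v` gives `m ≤ τ + G.dist v g < G.dist v g + 1`, which is impossible for integers.
  obtain ⟨r, hr, hlt⟩ := exists_lt_of_csInf_lt (exists_hasChain hG x (vert G g))
    (show pathDist x (vert G g) < m + min s (1 - s) by
      rw [hx]; linarith [lt_min hs0' (sub_pos.2 hs1')])
  obtain ⟨v, w, τ, hvw, h0, h1, e, hle⟩ := hr.exists_rep g rfl hG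
  have key : ((v = a ∧ w = b ∧ τ = s) ∨ (v = b ∧ w = a ∧ τ = 1 - s)) := by
    rcases edgePt_eq_cases hadj.ne (hxe.symm.trans e) with h | h | h | h
    · exact Or.inl h
    · exact Or.inr h
    · linarith [h.1]
    · linarith [h.1]
  have hvw' : G.Adj v w := by
    rcases key with ⟨rfl, rfl, _⟩ | ⟨rfl, rfl, _⟩
    · exact hadj
    · exact hadj.symm
  have hup : pathDist x (vert G g) ≤ τ + G.dist v g := by
    apply csInf_le (bddBelow_chain _ _)
    have := HasChain.cons v w τ 0 hvw' h0 h1 le_rfl zero_le_one e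
      (by simp [vert, edgePt]) (exists_hasChain_dist hG v g)
    simpa [abs_of_nonneg h0] using this
  rw [hx] at hup
  have hτ : τ = s ∨ τ = 1 - s := by tauto
  have hmin1 := min_le_left s (1 - s)
  have hmin2 := min_le_right s (1 - s)
  have hτ0 : 0 < τ ∧ τ < 1 := by rcases hτ with h | h <;> constructor <;> linarith
  have i1 : (m : ℝ) < (G.dist v g : ℤ) + 1 := by push_cast; linarith
  have i2 : ((G.dist v g : ℤ) : ℝ) < m := by
    push_cast
    rcases hτ with h | h <;> linarith
  have i1' : m < (G.dist v g : ℤ) + 1 := by exact_mod_cast i1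
  have i2' : (G.dist v g : ℤ) < m := by exact_mod_cast i2
  omega

end MetricGraph

/-! ### Cayley graphs: vertices and word length -/

namespace Cay

open MetricGraph

variable {Γ : Type*} [Group Γ] {S : FinSymmGenSet Γ}

theorem one_le_dist_vertex {g h : Γ} (hne : g ≠ h) : 1 ≤ dist (vertex S g) (vertex S h) := by
  classical
  refine le_csInf (exists_hasChain (preconnected S) _ _) fun r hr => ?_
  have := hr.coord_le g
  simpa [vertex, vert, Finsupp.single_apply, hne.symm] using this

theorem exists_dist_vertex_le (x : Cay S) : ∃ g, dist x (vertex S g) ≤ 1 := by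
  obtain ⟨a, b, s, hab, hs0, hs1, hxe⟩ := x.2
  rcases hab with rfl | hadj
  · refine ⟨a, ?_⟩
    have : x = vertex S a := Subtype.ext (by rw [hxe]; simp [vertex, vert, edgePt])
    rw [this, dist_self]; exact zero_le_one
  · refine ⟨a, ?_⟩
    have h : HasChain x (vertex S a) (|s - 0| + 0) :=
      HasChain.cons a b s 0 hadj hs0 hs1 le_rfl zero_le_one hxe
        (by simp [vertex, vert, edgePt]) (HasChain.nil _)
    have h2 : dist x (vertex S a) ≤ |s - 0| + 0 := csInf_le (bddBelow_chain _ _) h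
    rw [sub_zero, add_zero, abs_of_nonneg hs0] at h2
    exact h2.trans hs1

/-- A point at integer distance from a vertex is a vertex. -/
theorem exists_eq_vertex {g : Γ} {x : Cay S} {m : ℤ} (h : dist x (vertex S g) = m) :
    ∃ v, x = vertex S v :=
  exists_eq_vert_of_pathDist (preconnected S) g x m h

theorem dist_smul_smul (γ : Γ) (x y : Cay S) : dist (γ • x) (γ • y) = dist x y :=
  (isometry_smul (Cay S) γ).dist_eq x y

theorem dist_vertex (g h : Γ) : dist (vertex S g) (vertex S h) = wordLength S (g⁻¹ * h) := by
  rw [wordLength, dist_comm, ← dist_smul_smul g⁻¹ (vertex S h), smul_vertex, smul_vertex,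
    inv_mul_cancel]

theorem wordLength_inv (g : Γ) : wordLength S g⁻¹ = wordLength S g := by
  have := dist_vertex (S := S) g 1
  rw [mul_one] at this
  rw [← this]; rfl

theorem wordLength_nonneg (g : Γ) : 0 ≤ wordLength S g := dist_nonneg

theorem wordLength_one : wordLength S (1 : Γ) = 0 := dist_self _

/-- Distinct vertices have distance at least one, so each ball of radius `1 / 2` in a finite cover
holds at most one of them. Through this finiteness, bounded displacements in the group give bounded
condition numbers under `ρ`. -/
theorem finite_wordLength_le [ProperSpace (Cay S)] (b : ℝ) : {g : Γ | wordLength S g ≤ b}.Finite := by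
  obtain ⟨t, ht, hcov⟩ := Metric.totallyBounded_iff.1
    (isCompact_closedBall (vertex S 1) b).totallyBounded (1 / 2) (by norm_num)
  have hg : ∀ g : {g : Γ | wordLength S g ≤ b}, ∃ y ∈ t, dist (vertex S g.1) y < 1 / 2 := by
    intro g
    have := hcov (show vertex S g.1 ∈ Metric.closedBall (vertex S 1) b from g.2)
    simpa using this
  choose f hf hd using hg
  have hinj : Function.Injective fun g => (⟨f g, hf g⟩ : t) := by
    intro g h e
    have e' : f g = f h := congrArg Subtype.val e
    by_contra hne
    have h1 := one_le_dist_vertex (S := S) (fun h' => hne (Subtype.ext h'))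
    have h2 := dist_triangle_right (vertex S g.1) (vertex S h.1) (f g)
    have := hd g
    have h3 := hd h
    rw [← e'] at h3
    linarith
  have := ht.to_subtype
  exact Set.finite_coe_iff.1 (Finite.of_injective _ hinj)

end Cay

open Filter Topology Set
open scoped NNReal ENNReal
noncomputable section

section HyperbolicGeometry

variable {X : Type*} [MetricSpace X]

/-! ### Geodesic segments and the four point inequality -/

namespace IsGeodesicSegment

variable {c : ℝ → X} {x y : X}

theorem dist_left (h : IsGeodesicSegment c x y) {t : ℝ} (ht : t ∈ Icc 0 (dist x y)) :
    dist x (c t) = t := by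
  have := h.2.2 0 ⟨le_rfl, dist_nonneg⟩ t ht
  rwa [h.1, zero_sub, abs_neg, abs_of_nonneg ht.1] at this

theorem dist_right (h : IsGeodesicSegment c x y) {t : ℝ} (ht : t ∈ Icc 0 (dist x y)) :
    dist (c t) y = dist x y - t := by
  have := h.2.2 t ht (dist x y) ⟨dist_nonneg, le_rfl⟩
  rwa [h.2.1, abs_sub_comm, abs_of_nonneg (by linarith [ht.2])] at this

theorem reverse (h : IsGeodesicSegment c x y) :
    IsGeodesicSegment (fun t => c (dist x y - t)) y x := by
  refine ⟨by simpa using h.2.1, by simpa [dist_comm y x] using h.1, ?_⟩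
  rw [dist_comm y x]
  intro s hs t ht
  rw [h.2.2 _ ⟨by linarith [hs.2], by linarith [hs.1]⟩ _ ⟨by linarith [ht.2], by linarith [ht.1]⟩,
    abs_sub_comm]
  congr 1; ring

theorem sub (h : IsGeodesicSegment c x y) {a b : ℝ} (ha : 0 ≤ a) (hab : a ≤ b)
    (hb : b ≤ dist x y) :
    IsGeodesicSegment (fun t => c (a + t)) (c a) (c b) := by
  have hd : dist (c a) (c b) = b - a := by
    rw [h.2.2 a ⟨ha, by linarith⟩ b ⟨by linarith, hb⟩, abs_sub_comm, abs_of_nonneg (by linarith)]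
  refine ⟨by simp, by simp [hd], ?_⟩
  rw [hd]
  intro s hs t ht
  rw [h.2.2 _ ⟨by linarith [hs.1], by linarith [hs.2]⟩ _ ⟨by linarith [ht.1], by linarith [ht.2]⟩]
  congr 1; ring

theorem continuousOn (h : IsGeodesicSegment c x y) : ContinuousOn c (Icc 0 (dist x y)) := by
  have : LipschitzOnWith 1 c (Icc 0 (dist x y)) :=
    LipschitzOnWith.of_dist_le_mul fun s hs t ht => by
      rw [h.2.2 s hs t ht, NNReal.coe_one, one_mul, Real.dist_eq]
  exact this.continuousOn

end IsGeodesicSegment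

theorem Isometry.isGeodesicSegment {l : ℝ → X} (hl : Isometry l) {a b : ℝ} (hab : a ≤ b) :
    IsGeodesicSegment (fun t => l (a + t)) (l a) (l b) := by
  have hd : dist (l a) (l b) = b - a := by
    rw [hl.dist_eq, Real.dist_eq, abs_sub_comm, abs_of_nonneg (by linarith)]
  refine ⟨by simp, by simp [hd], fun s _ t _ => ?_⟩
  rw [hl.dist_eq, Real.dist_eq]
  congr 1; ring

/-- A path on an interval, each point of which is `D`-close to one of two sets, with the start
close to the first and the end close to the second, has a point close to both. -/
theorem exists_infDist_le_both {c : ℝ → X} {L D : ℝ} (hL : 0 ≤ L) (hc : ContinuousOn c (Icc 0 L))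
    {A B : Set X} (h : ∀ t ∈ Icc 0 L, Metric.infDist (c t) A ≤ D ∨ Metric.infDist (c t) B ≤ D)
    (h0 : Metric.infDist (c 0) A ≤ D) (h1 : Metric.infDist (c L) B ≤ D) :
    ∃ t ∈ Icc 0 L, Metric.infDist (c t) A ≤ D ∧ Metric.infDist (c t) B ≤ D := by
  have hcl : ∀ E : Set X, IsClosed (Icc 0 L ∩ (fun t => Metric.infDist (c t) E) ⁻¹' Iic D) :=
    fun E => ((Metric.continuous_infDist_pt E).comp_continuousOn hc).preimage_isClosed_of_isClosed
      isClosed_Icc isClosed_Iic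
  obtain ⟨t, ht, hA, hB⟩ := isPreconnected_closed_iff.1 isPreconnected_Icc _ _ (hcl A) (hcl B)
    (fun t ht => (h t ht).imp (fun h => ⟨ht, h⟩) (fun h => ⟨ht, h⟩))
    ⟨0, ⟨le_rfl, hL⟩, ⟨le_rfl, hL⟩, h0⟩ ⟨L, ⟨hL, le_rfl⟩, ⟨hL, le_rfl⟩, h1⟩
  exact ⟨t, ht, hA.2, hB.2⟩

variable {δ : ℝ}

theorem IsDeltaHyperbolic.slim (h : IsDeltaHyperbolic X δ) {x y z : X} {a b c : ℝ → X}
    (ha : IsGeodesicSegment a x y) (hb : IsGeodesicSegment b y z) (hc : IsGeodesicSegment c z x)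
    {t : ℝ} (ht : t ∈ Icc 0 (dist x y)) :
    (∃ s ∈ Icc 0 (dist y z), dist (a t) (b s) ≤ δ) ∨
      ∃ s ∈ Icc 0 (dist z x), dist (a t) (c s) ≤ δ := by
  obtain ⟨q, hq, hd⟩ := h.2.2 x y z a b c ha hb hc (a t) ⟨t, ht, rfl⟩
  rcases hq with ⟨s, hs, rfl⟩ | ⟨s, hs, rfl⟩
  · exact Or.inl ⟨s, hs, hd⟩
  · exact Or.inr ⟨s, hs, hd⟩

theorem gromovProduct_comm (p x y : X) : gromovProduct p x y = gromovProduct p y x := by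
  unfold gromovProduct; rw [dist_comm x y]; ring

theorem gromovProduct_nonneg (p x y : X) : 0 ≤ gromovProduct p x y := by
  unfold gromovProduct; linarith [dist_triangle_right x y p]

theorem IsGeodesicSegment.gromovProduct_le {c : ℝ → X} {x y : X} (h : IsGeodesicSegment c x y)
    (p : X) {t : ℝ} (ht : t ∈ Icc 0 (dist x y)) : gromovProduct p x y ≤ dist p (c t) := by
  unfold gromovProduct
  have h1 := h.dist_left ht
  have h2 := h.dist_right ht
  have h3 := dist_triangle x (c t) p
  have h4 := dist_triangle_left y p (c t)
  rw [dist_comm (c t) p] at *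
  linarith

/-- By connectedness the side from `x` to `y` has a point close to both other sides of the triangle
with apex `p`. Adding the triangle inequalities through the two nearby points gives the bound. -/
theorem IsDeltaHyperbolic.exists_dist_le (h : IsDeltaHyperbolic X δ) (hδ : 0 ≤ δ) {x y : X}
    {c : ℝ → X} (hc : IsGeodesicSegment c x y) (p : X) :
    ∃ t ∈ Icc 0 (dist x y), dist p (c t) ≤ gromovProduct p x y + 2 * δ + 2 := by
  obtain ⟨a, ha⟩ := h.2.1 p x
  obtain ⟨b, hb⟩ := h.2.1 y p
  obtain ⟨t, ht, hA, hB⟩ := exists_infDist_le_both (D := δ) (A := a '' Icc 0 (dist p x))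
    (B := b '' Icc 0 (dist y p)) dist_nonneg hc.continuousOn
    (fun t ht => by
      rcases h.slim hc hb ha ht with ⟨s, hs, hd⟩ | ⟨s, hs, hd⟩
      · exact Or.inr ((Metric.infDist_le_dist_of_mem (mem_image_of_mem _ hs)).trans hd)
      · exact Or.inl ((Metric.infDist_le_dist_of_mem (mem_image_of_mem _ hs)).trans hd))
    (by
      have hx : x ∈ a '' Icc 0 (dist p x) := ⟨dist p x, ⟨dist_nonneg, le_rfl⟩, ha.2.1⟩
      rwa [hc.1, Metric.infDist_zero_of_mem hx])
    (by
      have hy : y ∈ b '' Icc 0 (dist y p) := ⟨0, ⟨le_rfl, dist_nonneg⟩, hb.1⟩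
      rwa [hc.2.1, Metric.infDist_zero_of_mem hy])
  obtain ⟨_, ⟨s, hs, rfl⟩, hs'⟩ := (Metric.infDist_lt_iff
    ((nonempty_Icc.2 dist_nonneg).image a)).1
    (lt_of_le_of_lt hA (lt_add_one δ))
  obtain ⟨_, ⟨s', hs1, rfl⟩, hs1'⟩ := (Metric.infDist_lt_iff
    ((nonempty_Icc.2 dist_nonneg).image b)).1 (lt_of_le_of_lt hB (lt_add_one δ))
  refine ⟨t, ht, ?_⟩
  unfold gromovProduct
  have e1 := ha.dist_left hs
  have e2 := ha.dist_right hs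
  have e3 := hb.dist_left hs1
  have e4 := hb.dist_right hs1
  have e5 := hc.dist_left ht
  have e6 := hc.dist_right ht
  have t1 := dist_triangle p (a s) (c t)
  have t2 := dist_triangle x (a s) (c t)
  have t3 := dist_triangle (c t) (b s') p
  have t4 := dist_triangle (c t) (b s') y
  linarith [dist_comm p x, dist_comm (c t) (a s), dist_comm x (a s), dist_comm x (c t),
    dist_comm p (c t), dist_comm y (b s')]

/-- The four point inequality for the Gromov product. -/
def FourPoint (X : Type*) [MetricSpace X] (δ : ℝ) : Prop :=
  ∀ p x y z : X, min (gromovProduct p x y) (gromovProduct p y z) - δ ≤ gromovProduct p x z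

/-- A point of the side `x z` that nearly realizes the Gromov product is `δ`-close to one of the
other sides, and the distance from `p` to a side is at least the Gromov product of its ends. -/
theorem IsDeltaHyperbolic.fourPoint (h : IsDeltaHyperbolic X δ) (hδ : 0 ≤ δ) :
    FourPoint X (3 * δ + 2) := by
  intro p x y z
  obtain ⟨c, hc⟩ := h.2.1 x z
  obtain ⟨a, ha⟩ := h.2.1 z y
  obtain ⟨b, hb⟩ := h.2.1 y x
  obtain ⟨t, ht, hd⟩ := h.exists_dist_le hδ hc p
  rcases h.slim hc ha hb ht with ⟨s, hs, hs'⟩ | ⟨s, hs, hs'⟩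
  · have := ha.gromovProduct_le p hs
    rw [gromovProduct_comm] at this
    linarith [dist_triangle p (c t) (a s),
      min_le_right (gromovProduct p x y) (gromovProduct p y z)]
  · have := hb.gromovProduct_le p hs
    rw [gromovProduct_comm] at this
    linarith [dist_triangle p (c t) (b s),
      min_le_left (gromovProduct p x y) (gromovProduct p y z)]

/-! ### Limits of one-Lipschitz maps -/

/-- Sequences of one-Lipschitz maps into a proper space subconverge. -/
theorem exists_subseq_tendsto_of_dist_le [ProperSpace X] {α : Type*} [MetricSpace α]
    [TopologicalSpace.SeparableSpace α] [Nonempty α] (f : ℕ → α → X)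
    (hf : ∀ n a b, dist (f n a) (f n b) ≤ dist a b) (a₀ : α) (p : X) (R : ℝ)
    (hR : ∀ n, dist (f n a₀) p ≤ R) :
    ∃ (φ : ℕ → ℕ) (g : α → X), StrictMono φ ∧
      (∀ a, Tendsto (fun n => f (φ n) a) atTop (𝓝 (g a))) ∧
      ∀ K : Set α, IsCompact K → TendstoUniformlyOn (fun n => f (φ n)) g atTop K := by
  -- Compactness of a product of balls gives convergence on a countable dense set. The common
  -- Lipschitz bound extends it to all points, uniformly on compact sets.
  let q := TopologicalSpace.denseSeq α
  have hK : IsCompact (Set.pi univ fun i : ℕ => Metric.closedBall p (R + dist (q i) a₀)) :=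
    isCompact_univ_pi fun i => isCompact_closedBall _ _
  obtain ⟨G, -, φ, hφ, hG⟩ := hK.tendsto_subseq (x := fun n i => f n (q i)) (fun n i _ => by
    rw [Metric.mem_closedBall]
    linarith [dist_triangle (f n (q i)) (f n a₀) p, hf n (q i) a₀, hR n])
  rw [tendsto_pi_nhds] at hG
  have hlim : ∀ a, ∃ y, Tendsto (fun n => f (φ n) a) atTop (𝓝 y) := by
    intro a
    apply cauchySeq_tendsto_of_complete
    rw [Metric.cauchySeq_iff]
    intro ε hε
    obtain ⟨i, hi⟩ := (TopologicalSpace.denseRange_denseSeq α).exists_dist_lt a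
      (show (0 : ℝ) < ε / 3 by positivity)
    obtain ⟨N, hN⟩ := Metric.cauchySeq_iff.1 (hG i).cauchySeq (ε / 3) (by positivity)
    refine ⟨N, fun m hm n hn => ?_⟩
    have h1 := hN m hm n hn
    have h2 := hf (φ m) a (q i)
    have h3 := hf (φ n) (q i) a
    rw [dist_comm] at h3
    have h4 := dist_triangle4 (f (φ m) a) (f (φ m) (q i)) (f (φ n) (q i)) (f (φ n) a)
    simp only [Function.comp_apply] at h1
    rw [dist_comm (f (φ n) a)] at h3
    rw [dist_comm (q i) a] at h3
    linarith
  choose g hg using hlim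
  refine ⟨φ, g, hφ, hg, fun K hKc => ?_⟩
  have hgl : ∀ a b, dist (g a) (g b) ≤ dist a b := fun a b =>
    le_of_tendsto ((hg a).dist (hg b)) (Eventually.of_forall fun n => hf _ _ _)
  rw [Metric.tendstoUniformlyOn_iff]
  intro ε hε
  obtain ⟨t, ht, hcov⟩ := Metric.totallyBounded_iff.1 hKc.totallyBounded (ε / 3) (by positivity)
  have hev : ∀ᶠ n in atTop, ∀ y ∈ t, dist (f (φ n) y) (g y) < ε / 3 :=
    (ht.eventually_all).2 fun y _ => (Metric.tendsto_nhds.1 (hg y)) _ (by positivity)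
  filter_upwards [hev] with n hn x hx
  obtain ⟨y, hy, hxy⟩ := mem_iUnion₂.1 (hcov hx)
  rw [Metric.mem_ball] at hxy
  have h1 := hn y hy
  have h2 := hgl x y
  have h3 := hf (φ n) y x
  rw [dist_comm] at h1
  have h4 := dist_triangle4 (g x) (g y) (f (φ n) y) (f (φ n) x)
  rw [dist_comm y x] at h3
  linarith

/-! ### Rays -/

theorem gromovProduct_ray {c : ℝ≥0 → X} (hc : Isometry c) {p : X} {b : ℝ}
    (hb : dist (c 0) p ≤ b) {s t : ℝ≥0} (hst : s ≤ t) :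
    (s : ℝ) - b ≤ gromovProduct p (c s) (c t) := by
  have h1 : dist (c s) (c t) = t - s := by
    rw [hc.dist_eq, NNReal.dist_eq, abs_sub_comm, abs_of_nonneg (sub_nonneg.2 (by exact_mod_cast hst))]
  have h2 : dist (c 0) (c s) = s := by rw [hc.dist_eq, NNReal.dist_eq]; simp
  have h3 : dist (c 0) (c t) = t := by rw [hc.dist_eq, NNReal.dist_eq]; simp
  have h4 := dist_triangle_left (c s) (c 0) p
  unfold gromovProduct
  linarith [dist_triangle (c 0) p (c s), dist_triangle (c 0) p (c t), dist_comm p (c s),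
    dist_comm p (c t)]

theorem dist_ray_le {c : ℝ≥0 → X} (hc : Isometry c) {p : X} {b : ℝ}
    (hb : dist (c 0) p ≤ b) (t : ℝ≥0) : dist (c t) p ≤ t + b := by
  have h3 : dist (c t) (c 0) = t := by rw [hc.dist_eq, NNReal.dist_eq]; simp
  linarith [dist_triangle (c t) (c 0) p]

theorem le_dist_ray {c : ℝ≥0 → X} (hc : Isometry c) {p : X} {b : ℝ}
    (hb : dist (c 0) p ≤ b) (t : ℝ≥0) : (t : ℝ) - b ≤ dist (c t) p := by
  have h3 : dist (c t) (c 0) = t := by rw [hc.dist_eq, NNReal.dist_eq]; simp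
  linarith [dist_triangle_right (c t) (c 0) p]

theorem dist_eq_gromovProduct (p x y : X) :
    dist x y = dist x p + dist y p - 2 * gromovProduct p x y := by
  unfold gromovProduct; ring

/-- Two points at distance about `t` from `p` with Gromov product about `t` are close. -/
theorem dist_le_of_gromovProduct {p x y : X} {t a b e : ℝ} (hx : dist x p ≤ t + a)
    (hy : dist y p ≤ t + b) (h : t - e ≤ gromovProduct p x y) : dist x y ≤ a + b + 2 * e := by
  rw [dist_eq_gromovProduct p]; linarith

variable {δ' : ℝ}

theorem FourPoint.three (h : FourPoint X δ') {p w x y z : X} {t : ℝ}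
    (h1 : t ≤ gromovProduct p w x) (h2 : t ≤ gromovProduct p x y) (h3 : t ≤ gromovProduct p y z)
    (hδ : 0 ≤ δ') : t - 2 * δ' ≤ gromovProduct p w z := by
  have := h p w x y
  have := h p w y z
  have := le_min h1 h2
  have : t - δ' ≤ min (gromovProduct p w y) (gromovProduct p y z) :=
    le_min (by linarith) (by linarith)
  linarith

theorem FourPoint.two (h : FourPoint X δ') {p x y z : X} {t : ℝ}
    (h1 : t ≤ gromovProduct p x y) (h2 : t ≤ gromovProduct p y z) :
    t - δ' ≤ gromovProduct p x z := by
  have := h p x y z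
  have := le_min h1 h2
  linarith

/-- Asymptotic rays that start near `p` are uniformly close. -/
theorem FourPoint.asymptotic_close (h : FourPoint X δ') (hδ : 0 ≤ δ') {c c' : ℝ≥0 → X}
    (hc : Isometry c) (hc' : Isometry c') {C : ℝ} (hC : ∀ t, dist (c t) (c' t) ≤ C) {p : X} {b : ℝ}
    (hb : dist (c 0) p ≤ b) (hb' : dist (c' 0) p ≤ b) (t : ℝ≥0) :
    dist (c t) (c' t) ≤ 4 * b + 4 * δ' := by
  have hb0 : 0 ≤ b := dist_nonneg.trans hb
  have hC0 : 0 ≤ C := dist_nonneg.trans (hC 0)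
  -- Waiting until time `t + C` absorbs the unknown bound `C`: there the Gromov product of the two
  -- rays is already at least `t - b`.
  let s : ℝ≥0 := t + ⟨C, hC0⟩
  have hs : (s : ℝ) = t + C := rfl
  have hts : t ≤ s := le_self_add
  have h1 := gromovProduct_ray hc hb hts
  have h2 := gromovProduct_ray hc' hb' hts
  rw [gromovProduct_comm] at h2
  have h3 : (t : ℝ) - b ≤ gromovProduct p (c s) (c' s) := by
    unfold gromovProduct
    linarith [le_dist_ray hc hb s, le_dist_ray hc' hb' s, hC s, t.2]
  have := h.three h1 h3 h2 hδ
  have := dist_le_of_gromovProduct (dist_ray_le hc hb t) (dist_ray_le hc' hb' t)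
    (show (t : ℝ) - (b + 2 * δ') ≤ _ by linarith)
  linarith

theorem GeodesicRay.endpoint_eq_iff {c c' : GeodesicRay X} :
    c.endpoint = c'.endpoint ↔ ∃ C : ℝ, ∀ t, dist (c.1 t) (c'.1 t) ≤ C :=
  ⟨fun h => Quotient.exact (s := asymptoticSetoid X) h,
    fun h => Quotient.sound (s := asymptoticSetoid X) h⟩

theorem GromovBoundary.exists_endpoint_eq (x : GromovBoundary X) :
    ∃ c : GeodesicRay X, c.endpoint = x := Quotient.exists_rep (s := asymptoticSetoid X) x

/-- The constant extension of a geodesic segment is one-Lipschitz. -/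
theorem IsGeodesicSegment.dist_clamp_le {c : ℝ → X} {x y : X} (h : IsGeodesicSegment c x y)
    (s t : ℝ) : dist (c (max 0 (min s (dist x y)))) (c (max 0 (min t (dist x y)))) ≤ |s - t| := by
  have hm : ∀ s, max 0 (min s (dist x y)) ∈ Icc 0 (dist x y) := fun s =>
    ⟨le_max_left _ _, max_le dist_nonneg (min_le_right _ _)⟩
  rw [h.2.2 _ (hm s) _ (hm t)]
  refine (abs_max_sub_max_le_max _ _ _ _).trans ?_
  rw [sub_self, abs_zero]
  refine max_le (abs_nonneg _) ((abs_min_sub_min_le_max _ _ _ _).trans ?_)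
  rw [sub_self, abs_zero]
  exact max_le le_rfl (abs_nonneg _)

/-- Every boundary point is the endpoint of a ray that starts at `p`. -/
theorem IsDeltaHyperbolic.exists_ray (h : IsDeltaHyperbolic X δ) (hδ : 0 ≤ δ) (p : X)
    (x : GromovBoundary X) : ∃ c : GeodesicRay X, c.1 0 = p ∧ c.endpoint = x := by
  have := h.1
  have h4 := h.fourPoint hδ
  obtain ⟨c, rfl⟩ := x.exists_endpoint_eq
  -- The new ray is a subsequential limit of segments from `p` to the integer points of an arbitrary
  -- representative.
  choose σ hσ using fun n : ℕ => h.2.1 p (c.1 n)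
  set b := dist (c.1 0) p
  have hL : ∀ n : ℕ, (n : ℝ) - b ≤ dist p (c.1 n) := fun n => by
    rw [dist_comm]; simpa using le_dist_ray c.2 (le_refl b) n
  let f : ℕ → ℝ≥0 → X := fun n t => σ n (max 0 (min t (dist p (c.1 n))))
  obtain ⟨φ, g, hφ, hg, -⟩ := exists_subseq_tendsto_of_dist_le f
    (fun n a b => (hσ n).dist_clamp_le a b) 0 p 0 (fun n => by
      simp [f, (hσ n).1])
  have hf : ∀ (n : ℕ) (t : ℝ≥0), (t : ℝ) + b ≤ n → f n t = σ n t ∧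
      (t : ℝ) ∈ Icc 0 (dist p (c.1 n)) := fun n t ht => by
    have h1 : (t : ℝ) ≤ dist p (c.1 n) := by linarith [hL n]
    refine ⟨?_, t.2, h1⟩
    simp only [f]
    rw [min_eq_left h1, max_eq_right (NNReal.coe_nonneg t)]
  have hev : ∀ t : ℝ≥0, ∀ᶠ n in atTop, (t : ℝ) + b ≤ (φ n : ℕ) := fun t =>
    (tendsto_natCast_atTop_atTop.comp hφ.tendsto_atTop).eventually_ge_atTop _
  have hiso : Isometry g := by
    refine Isometry.of_dist_eq fun s t => ?_
    refine tendsto_nhds_unique ((hg s).dist (hg t)) (tendsto_const_nhds.congr' ?_)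
    filter_upwards [hev s, hev t] with n hs ht
    rw [(hf _ _ hs).1, (hf _ _ ht).1, (hσ _).2.2 _ (hf _ _ hs).2 _ (hf _ _ ht).2]
    rfl
  refine ⟨⟨g, hiso⟩, ?_, GeodesicRay.endpoint_eq_iff.2 ⟨3 * b + 2 * (3 * δ + 2), fun t => ?_⟩⟩
  · refine tendsto_nhds_unique (hg 0) (tendsto_const_nhds.congr fun n => ?_)
    simp [f, (hσ _).1]
  · refine le_of_tendsto ((hg t).dist tendsto_const_nhds) ?_
    filter_upwards [hev t] with n ht
    obtain ⟨e, hm⟩ := hf _ _ ht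
    rw [e]
    have hb0 : 0 ≤ b := dist_nonneg
    have k1 : (t : ℝ) - b ≤ gromovProduct p (σ (φ n) t) (c.1 (φ n : ℕ)) := by
      unfold gromovProduct
      rw [dist_comm _ p, (hσ _).dist_left hm, (hσ _).dist_right hm, dist_comm _ p]
      linarith
    have k2 := gromovProduct_ray c.2 (le_refl b) (s := t) (t := (φ n : ℕ)) (by
      have : (t : ℝ) ≤ (φ n : ℕ) := by linarith
      exact_mod_cast this)
    rw [gromovProduct_comm] at k2
    have k3 := h4.two k1 k2
    have := dist_le_of_gromovProduct (t := t) (a := 0) (by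
      rw [dist_comm, (hσ _).dist_left hm, add_zero]) (dist_ray_le c.2 (le_refl b) t)
      (show (t : ℝ) - (b + (3 * δ + 2)) ≤ _ by linarith)
    exact this.trans (by linarith)

end HyperbolicGeometry

open Filter Topology Set
open scoped NNReal ENNReal
noncomputable section

section HyperbolicGeometry

variable {X : Type*} [MetricSpace X] {δ : ℝ}

/-! ### Stability of quasi-geodesics -/

/-- A geodesic between two points of a sequence is logarithmically close to the sequence. -/
theorem IsDeltaHyperbolic.exists_dist_le_log (h : IsDeltaHyperbolic X δ) {p : ℕ → X} {L : ℝ}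
    (hstep : ∀ i, dist (p i) (p (i + 1)) ≤ L) (n : ℕ) :
    ∀ i N : ℕ, N ≤ 2 ^ n → ∀ c, IsGeodesicSegment c (p i) (p (i + N)) →
      ∀ t ∈ Icc 0 (dist (p i) (p (i + N))),
        ∃ j, i ≤ j ∧ j ≤ i + N ∧ dist (c t) (p j) ≤ n * δ + L := by
  have hL : 0 ≤ L := dist_nonneg.trans (hstep 0)
  induction n with
  | zero =>
    intro i N hN c hc t ht
    refine ⟨i, le_rfl, by omega, ?_⟩
    rw [dist_comm, hc.dist_left ht]
    have hN' : N = 0 ∨ N = 1 := by simp at hN; omega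
    rcases hN' with rfl | rfl
    · have := ht.2
      simp only [add_zero, dist_self] at this
      simp; linarith
    · simpa using ht.2.trans (hstep i)
  | succ n ih =>
    intro i N hN c hc t ht
    -- The sequence is bisected; the triangle over its midpoint costs one `δ` for each halving.
    have h1 : N / 2 ≤ 2 ^ n := by rw [pow_succ] at hN; omega
    have h2 : N - N / 2 ≤ 2 ^ n := by rw [pow_succ] at hN; omega
    have e : i + N / 2 + (N - N / 2) = i + N := by omega
    obtain ⟨a, ha⟩ := h.2.1 (p i) (p (i + N / 2))
    obtain ⟨b, hb⟩ := h.2.1 (p (i + N / 2)) (p (i + N))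
    have ih1 := ih i (N / 2) h1 a ha
    have ih2 := ih (i + N / 2) (N - N / 2) h2 b (by rwa [e])
    rw [e] at ih2
    push_cast
    rcases h.slim hc hb.reverse ha.reverse ht with ⟨s, hs, hd⟩ | ⟨s, hs, hd⟩
    · rw [dist_comm (p (i + N))] at hs
      obtain ⟨j, hj1, hj2, hj3⟩ := ih2 _ ⟨sub_nonneg.2 hs.2, sub_le_self _ hs.1⟩
      exact ⟨j, by omega, by omega, (dist_triangle _ _ _).trans
        ((add_le_add hd hj3).trans (le_of_eq (by ring)))⟩
    · rw [dist_comm (p (i + N / 2))] at hs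
      obtain ⟨j, hj1, hj2, hj3⟩ := ih1 _ ⟨sub_nonneg.2 hs.2, sub_le_self _ hs.1⟩
      exact ⟨j, by omega, by omega, (dist_triangle _ _ _).trans
        ((add_le_add hd hj3).trans (le_of_eq (by ring)))⟩

/-- Used in `exists_geodesic_near`, where a detour whose length is at least exponential in `n` would
have to be shorter than a linear function of `n`. -/
theorem exists_forall_lt_two_pow (A B : ℝ) : ∃ n₀ : ℕ, ∀ n : ℕ, n₀ ≤ n → A + B * n < 2 ^ n := by
  have h1 := (tendsto_pow_const_div_const_pow_of_one_lt 1 (show (1 : ℝ) < 2 by norm_num)).const_mul B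
  have h0 := (tendsto_pow_const_div_const_pow_of_one_lt 0 (show (1 : ℝ) < 2 by norm_num)).const_mul A
  have h := (h0.add h1).eventually_lt_const (show A * 0 + B * 0 < 1 by norm_num)
  obtain ⟨n₀, hn₀⟩ := eventually_atTop.1 h
  refine ⟨n₀, fun n hn => ?_⟩
  have := hn₀ n hn
  have h2 : (0 : ℝ) < 2 ^ n := by positivity
  rw [pow_zero, pow_one, mul_one_div, mul_div_assoc', ← add_div, div_lt_one h2] at this
  exact this

/-- A sequence of points that is a quasi-geodesic. -/
def IsQuasiGeodesicSeq (lam ε : ℝ) (p : ℕ → X) : Prop :=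
  ∀ i j : ℕ, lam⁻¹ * |(i : ℝ) - j| - ε ≤ dist (p i) (p j) ∧
    dist (p i) (p j) ≤ lam * |(i : ℝ) - j| + ε

theorem IsQuasiGeodesicSeq.abs_le {lam ε : ℝ} {p : ℕ → X} (hp : IsQuasiGeodesicSeq lam ε p)
    (hlam : 1 ≤ lam) (i j : ℕ) : |(i : ℝ) - j| ≤ lam * (dist (p i) (p j) + ε) := by
  have h1 := (hp i j).1
  have h0 : 0 < lam := by linarith
  have h2 : lam⁻¹ * |(i : ℝ) - j| ≤ dist (p i) (p j) + ε := by linarith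
  rwa [inv_mul_le_iff₀ h0] at h2

/-- Geodesics are uniformly close to quasi-geodesics with the same endpoints. -/
theorem IsDeltaHyperbolic.exists_geodesic_near (h : IsDeltaHyperbolic X δ) (hδ : 0 ≤ δ)
    {lam ε : ℝ} (hlam : 1 ≤ lam) (hε : 0 ≤ ε) :
    ∃ D, 0 ≤ D ∧ ∀ p : ℕ → X, IsQuasiGeodesicSeq lam ε p → ∀ (N : ℕ) (c : ℝ → X),
      IsGeodesicSegment c (p 0) (p N) → ∀ t ∈ Icc 0 (dist (p 0) (p N)),
        ∃ j ≤ N, dist (c t) (p j) ≤ D := by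
  -- The coefficients come from the final estimate `|i - j| ≤ lam * (6 * M + ε)`, with the
  -- logarithmic bound for `M` inserted and the logarithm written as `n + 1`.
  obtain ⟨n₀, hn₀⟩ := exists_forall_lt_two_pow (lam * (6 * (2 * δ + δ + (lam + ε)) + ε))
    (lam * (6 * δ))
  refine ⟨2 * δ + (n₀ + 1) * δ + (lam + ε), by positivity, fun p hp N c hc => ?_⟩
  have hstep : ∀ i, dist (p i) (p (i + 1)) ≤ lam + ε := fun i => by
    have := (hp i (i + 1)).2
    push_cast at this
    rwa [show (i : ℝ) - (i + 1) = -1 by ring, abs_neg, abs_one, mul_one] at this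
  have hlog : ∀ n i j : ℕ, i ≤ N → j ≤ N → (i ≤ j + 2 ^ n) → (j ≤ i + 2 ^ n) → ∀ c',
      IsGeodesicSegment c' (p i) (p j) → ∀ t ∈ Icc 0 (dist (p i) (p j)),
        ∃ m ≤ N, dist (c' t) (p m) ≤ n * δ + (lam + ε) := by
    intro n i j hi hj h1 h2 c' hc' t ht
    rcases le_total i j with hij | hij
    · obtain ⟨m, -, hm, hd⟩ := h.exists_dist_le_log hstep n i (j - i) (by omega) c'
        (by rwa [Nat.add_sub_cancel' hij]) t (by rwa [Nat.add_sub_cancel' hij])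
      exact ⟨m, by omega, hd⟩
    · obtain ⟨m, -, hm, hd⟩ := h.exists_dist_le_log hstep n j (i - j) (by omega) _
        (by rw [Nat.add_sub_cancel' hij]; exact hc'.reverse) (dist (p i) (p j) - t) (by
          rw [Nat.add_sub_cancel' hij, dist_comm (p j)]
          exact ⟨sub_nonneg.2 ht.2, sub_le_self _ ht.1⟩)
      exact ⟨m, by omega, by simpa using hd⟩
  have hcpt : IsCompact (p '' Iic N) := ((finite_Iic N).image p).isCompact
  have hne : (p '' Iic N).Nonempty := ⟨p 0, 0, Nat.zero_le N, rfl⟩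
  -- At `t₀` the geodesic is farthest from the sequence, at distance `M`. It is cut at `2 * M` on
  -- both sides of `t₀`, or at its ends, and the cut points are dropped to nearby points `p i` and
  -- `p j` of the sequence.
  obtain ⟨t₀, ht₀, hmax⟩ := isCompact_Icc.exists_isMaxOn (nonempty_Icc.2 dist_nonneg)
    ((Metric.continuous_infDist_pt (p '' Iic N)).comp_continuousOn hc.continuousOn)
  set M := Metric.infDist (c t₀) (p '' Iic N) with hM
  have hM0 : 0 ≤ M := Metric.infDist_nonneg
  have hnear : ∀ t ∈ Icc 0 (dist (p 0) (p N)), ∃ j ≤ N, dist (c t) (p j) ≤ M := by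
    intro t ht
    obtain ⟨_, ⟨j, hj, rfl⟩, hj'⟩ := hcpt.exists_infDist_eq_dist hne (c t)
    exact ⟨j, hj, hj'.symm.trans_le (hmax ht)⟩
  have hfar : ∀ j ≤ N, M ≤ dist (c t₀) (p j) := fun j hj =>
    Metric.infDist_le_dist_of_mem (mem_image_of_mem p (mem_Iic.2 hj))
  suffices hMle : M ≤ 2 * δ + (n₀ + 1) * δ + (lam + ε) by
    intro t ht
    obtain ⟨j, hj, hd⟩ := hnear t ht
    exact ⟨j, hj, hd.trans hMle⟩
  -- The drop segments stay at distance `M` from `c t₀`: either they start `2 * M` away and have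
  -- length at most `M`, or they are constant at a point of the sequence.
  have key : ∀ t ∈ Icc 0 (dist (p 0) (p N)), (|t₀ - t| = 2 * M ∨ ∃ j ≤ N, c t = p j) →
      ∃ i ≤ N, dist (c t) (p i) ≤ M ∧
        ∀ w, dist (c t) w + dist w (p i) = dist (c t) (p i) → M ≤ dist (c t₀) w := by
    intro t ht htt
    rcases htt with htt | ⟨j, hj, hjt⟩
    · obtain ⟨i, hi, hd⟩ := hnear t ht
      refine ⟨i, hi, hd, fun w hw => ?_⟩
      have := hc.2.2 t₀ ht₀ t ht
      linarith [dist_triangle_right (c t₀) (c t) w, dist_nonneg (x := w) (y := p i)]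
    · refine ⟨j, hj, by rw [hjt, dist_self]; exact hM0, fun w hw => ?_⟩
      rw [hjt, dist_self] at hw
      have : w = p j := dist_le_zero.1 (by linarith [dist_nonneg (x := p j) (y := w)])
      rw [this]; exact hfar j hj
  obtain ⟨t₁, ht₁, hle₁, hb₁, hc₁⟩ : ∃ t₁ ∈ Icc 0 (dist (p 0) (p N)), t₁ ≤ t₀ ∧ t₀ - t₁ ≤ 2 * M ∧
      (|t₀ - t₁| = 2 * M ∨ ∃ j ≤ N, c t₁ = p j) := by
    rcases le_total 0 (t₀ - 2 * M) with h0 | h0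
    · refine ⟨t₀ - 2 * M, ⟨h0, by linarith [ht₀.2]⟩, by linarith, by linarith, Or.inl ?_⟩
      rw [sub_sub_cancel, abs_of_nonneg (by linarith)]
    · exact ⟨0, ⟨le_rfl, dist_nonneg⟩, ht₀.1, by linarith, Or.inr ⟨0, Nat.zero_le N, hc.1⟩⟩
  obtain ⟨t₂, ht₂, hle₂, hb₂, hc₂⟩ : ∃ t₂ ∈ Icc 0 (dist (p 0) (p N)), t₀ ≤ t₂ ∧ t₂ - t₀ ≤ 2 * M ∧
      (|t₀ - t₂| = 2 * M ∨ ∃ j ≤ N, c t₂ = p j) := by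
    rcases le_total (t₀ + 2 * M) (dist (p 0) (p N)) with h0 | h0
    · refine ⟨t₀ + 2 * M, ⟨by linarith [ht₀.1], h0⟩, by linarith, by linarith, Or.inl ?_⟩
      rw [sub_add_cancel_left, abs_neg, abs_of_nonneg (by linarith)]
    · exact ⟨_, ⟨dist_nonneg, le_rfl⟩, ht₀.2, by linarith, Or.inr ⟨N, le_rfl, hc.2.1⟩⟩
  obtain ⟨i, hi, hyi, hwi⟩ := key t₁ ht₁ hc₁
  obtain ⟨j, hj, hzj, hwj⟩ := key t₂ ht₂ hc₂
  have hyz : dist (c t₁) (c t₂) = t₂ - t₁ := by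
    rw [hc.2.2 t₁ ht₁ t₂ ht₂, abs_sub_comm, abs_of_nonneg (by linarith)]
  have hsub := hc.sub ht₁.1 (hle₁.trans hle₂) ht₂.2
  have hx : t₀ - t₁ ∈ Icc 0 (dist (c t₁) (c t₂)) := by
    rw [hyz]; exact ⟨by linarith, by linarith⟩
  obtain ⟨a, ha⟩ := h.2.1 (c t₂) (p j)
  obtain ⟨b, hb⟩ := h.2.1 (p j) (c t₁)
  obtain ⟨e, he⟩ := h.2.1 (c t₁) (p i)
  obtain ⟨f, hf⟩ := h.2.1 (p i) (p j)
  have hsum : ∀ {c' : ℝ → X} {x y : X} {s : ℝ}, IsGeodesicSegment c' x y → s ∈ Icc 0 (dist x y) →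
      dist x (c' s) + dist (c' s) y = dist x y := fun hc' hs => by
    rw [hc'.dist_left hs, hc'.dist_right hs]; ring
  -- In the quadrilateral, `c t₀` is `2 * δ`-close to one of the three other sides. A drop segment
  -- forces `M ≤ 2 * δ`; the side from `p i` to `p j` is logarithmically close to the sequence.
  rcases h.slim hsub ha hb hx with ⟨s, hs, hd⟩ | ⟨s, hs, hd⟩
  · rw [add_sub_cancel] at hd
    have := hwj _ (hsum ha hs)
    nlinarith [Nat.cast_nonneg (α := ℝ) n₀]
  rw [add_sub_cancel] at hd
  rcases h.slim hb he hf hs with ⟨s', hs', hd'⟩ | ⟨s', hs', hd'⟩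
  · have := hwi _ (hsum he hs')
    have := dist_triangle (c t₀) (b s) (e s')
    nlinarith [Nat.cast_nonneg (α := ℝ) n₀]
  set a₀ := max (i - j) (j - i) with ha₀
  obtain ⟨m, hm, hdm⟩ := hlog (Nat.clog 2 a₀) i j hi hj
    (by have := Nat.le_pow_clog one_lt_two a₀; omega)
    (by have := Nat.le_pow_clog one_lt_two a₀; omega) f hf s' hs'
  have hM1 : M ≤ 2 * δ + (Nat.clog 2 a₀) * δ + (lam + ε) := by
    linarith [hfar m hm, dist_triangle4 (c t₀) (b s) (f s') (p m)]
  -- A large logarithm contradicts the choice of `n₀`: the sequence is quasi-geodesic and `dist (p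
  -- i) (p j) ≤ M + 4 * M + M`, so the index gap `a₀` is linear in its own logarithm.
  by_cases hn : Nat.clog 2 a₀ ≤ n₀ + 1
  · have : (Nat.clog 2 a₀ : ℝ) ≤ n₀ + 1 := by exact_mod_cast hn
    nlinarith
  exfalso
  have ha1 : 1 < a₀ := by
    by_contra hcon
    have : Nat.clog 2 a₀ = 0 := Nat.clog_of_right_le_one (not_lt.1 hcon) 2
    omega
  have hpow := Nat.pow_pred_clog_lt_self one_lt_two ha1
  rw [Nat.pred_eq_sub_one] at hpow
  have hlt := hn₀ (Nat.clog 2 a₀ - 1) (by omega)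
  have hpow' : (2 : ℝ) ^ (Nat.clog 2 a₀ - 1) < a₀ := by exact_mod_cast hpow
  have habs : (a₀ : ℝ) = |(i : ℝ) - j| := by
    rcases le_total i j with hij | hij
    · have e1 : a₀ = j - i := by omega
      rw [e1, Nat.cast_sub hij, abs_sub_comm, abs_of_nonneg]
      exact sub_nonneg.2 (by exact_mod_cast hij)
    · have e1 : a₀ = i - j := by omega
      rw [e1, Nat.cast_sub hij, abs_of_nonneg]
      exact sub_nonneg.2 (by exact_mod_cast hij)
  have hij := hp.abs_le hlam i j
  have hd6 : dist (p i) (p j) ≤ 6 * M := by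
    have := dist_triangle4 (p i) (c t₁) (c t₂) (p j)
    rw [dist_comm (p i) (c t₁)] at this
    linarith
  rw [Nat.cast_sub (by omega), Nat.cast_one] at hlt
  have hfin : lam * (dist (p i) (p j) + ε) ≤
      lam * (6 * (2 * δ + (Nat.clog 2 a₀) * δ + (lam + ε)) + ε) :=
    mul_le_mul_of_nonneg_left (by linarith) (by linarith)
  nlinarith

/-- Quasi-geodesics are uniformly close to geodesics with the same endpoints. -/
theorem IsDeltaHyperbolic.exists_quasiGeodesic_near (h : IsDeltaHyperbolic X δ) (hδ : 0 ≤ δ)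
    {lam ε : ℝ} (hlam : 1 ≤ lam) (hε : 0 ≤ ε) :
    ∃ D, 0 ≤ D ∧ ∀ p : ℕ → X, IsQuasiGeodesicSeq lam ε p → ∀ (N : ℕ) (c : ℝ → X),
      IsGeodesicSegment c (p 0) (p N) → ∀ m ≤ N,
        ∃ t ∈ Icc 0 (dist (p 0) (p N)), dist (p m) (c t) ≤ D := by
  obtain ⟨D, hD, hnear⟩ := h.exists_geodesic_near hδ hlam hε
  refine ⟨D + 1 + (lam * (lam * (2 * (D + 1) + ε)) + ε), by positivity, fun p hp N c hc m hm => ?_⟩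
  -- Some point of the geodesic is close both to a `p i` with `i ≤ m` and to a `p j` with `m ≤ j`.
  -- These two points are close to each other, so `j - i` is bounded and `p m` is close as well.
  obtain ⟨t, ht, hA, hB⟩ := exists_infDist_le_both (D := D) dist_nonneg hc.continuousOn
    (A := p '' Iic m) (B := p '' Icc m N)
    (fun t ht => by
      obtain ⟨j, hj, hd⟩ := hnear p hp N c hc t ht
      rcases le_total j m with hjm | hjm
      · exact Or.inl ((Metric.infDist_le_dist_of_mem (mem_image_of_mem p (mem_Iic.2 hjm))).trans hd)
      · exact Or.inr ((Metric.infDist_le_dist_of_mem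
          (mem_image_of_mem p (mem_Icc.2 ⟨hjm, hj⟩))).trans hd))
    (by rw [hc.1, Metric.infDist_zero_of_mem (mem_image_of_mem p (mem_Iic.2 (Nat.zero_le m)))]
        exact hD)
    (by rw [hc.2.1, Metric.infDist_zero_of_mem (mem_image_of_mem p (mem_Icc.2 ⟨hm, le_rfl⟩))]
        exact hD)
  obtain ⟨_, ⟨i, hi, rfl⟩, hi'⟩ := (Metric.infDist_lt_iff ((nonempty_Iic (a := m)).image p)).1
    (lt_of_le_of_lt hA (lt_add_one D))
  obtain ⟨_, ⟨j, hj, rfl⟩, hj'⟩ := (Metric.infDist_lt_iff ((nonempty_Icc.2 hm).image p)).1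
    (lt_of_le_of_lt hB (lt_add_one D))
  refine ⟨t, ht, ?_⟩
  have h1 := hp.abs_le hlam i j
  have h2 := (hp m i).2
  have h3 := dist_triangle_left (p i) (p j) (c t)
  have hi1 : (i : ℝ) ≤ m := by exact_mod_cast hi
  have hj1 : (m : ℝ) ≤ j := by exact_mod_cast hj.1
  rw [abs_of_nonneg (by linarith)] at h2
  rw [abs_sub_comm, abs_of_nonneg (by linarith)] at h1
  have h4 : (m : ℝ) - i ≤ lam * (2 * (D + 1) + ε) :=
    (by linarith : (m : ℝ) - i ≤ lam * (dist (p i) (p j) + ε)).trans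
      (mul_le_mul_of_nonneg_left (by linarith) (by linarith))
  have h5 := mul_le_mul_of_nonneg_left h4 (by linarith : (0 : ℝ) ≤ lam)
  linarith [dist_triangle_right (p m) (c t) (p i)]

end HyperbolicGeometry

open Filter Topology Set
open scoped NNReal ENNReal
noncomputable section

section HyperbolicGeometry

variable {X : Type*} [MetricSpace X] {δ δ' : ℝ}

/-! ### Lines and their ends -/

/-- The forward half of a line. -/
def fwdRay (l : ℝ → X) (hl : Isometry l) : GeodesicRay X :=
  ⟨fun t => l t, hl.comp isometry_subtype_coe⟩

/-- The backward half of a line. -/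
def bwdRay (l : ℝ → X) (hl : Isometry l) : GeodesicRay X :=
  ⟨fun t => l (-t), Isometry.of_dist_eq fun s t => by
    rw [hl.dist_eq, dist_neg_neg]; rfl⟩

/-- `l` is a bi-infinite geodesic with forward end `x` and backward end `y`. -/
def IsLine (l : ℝ → X) (x y : GromovBoundary X) : Prop :=
  ∃ hl : Isometry l, (fwdRay l hl).endpoint = x ∧ (bwdRay l hl).endpoint = y

theorem IsLine.reverse {l : ℝ → X} {x y : GromovBoundary X} (h : IsLine l x y) :
    IsLine (fun t => l (-t)) y x := by
  obtain ⟨hl, hx, hy⟩ := h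
  have hl' : Isometry fun t => l (-t) := Isometry.of_dist_eq fun s t => by
    rw [hl.dist_eq, dist_neg_neg]
  refine ⟨hl', ?_, ?_⟩
  · rw [← hy]; rfl
  · rw [← hx]
    refine congrArg GeodesicRay.endpoint (Subtype.ext (funext fun t => ?_))
    simp [bwdRay, fwdRay]

theorem IsLine.shift {l : ℝ → X} {x y : GromovBoundary X} (h : IsLine l x y) (a : ℝ) :
    IsLine (fun t => l (t + a)) x y := by
  obtain ⟨hl, hx, hy⟩ := h
  have hl' : Isometry fun t => l (t + a) := Isometry.of_dist_eq fun s t => by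
    rw [hl.dist_eq, dist_add_right]
  refine ⟨hl', ?_, ?_⟩
  · rw [← hx]
    refine GeodesicRay.endpoint_eq_iff.2 ⟨|a|, fun t => ?_⟩
    change dist (l (t + a)) (l t) ≤ _
    rw [hl.dist_eq, Real.dist_eq, add_sub_cancel_left]
  · rw [← hy]
    refine GeodesicRay.endpoint_eq_iff.2 ⟨|a|, fun t => ?_⟩
    change dist (l (-t + a)) (l (-t)) ≤ _
    rw [hl.dist_eq, Real.dist_eq, add_sub_cancel_left]

theorem IsLine.ne {l : ℝ → X} {x y : GromovBoundary X} (h : IsLine l x y) : x ≠ y := by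
  rintro rfl
  obtain ⟨hl, hx, hy⟩ := h
  obtain ⟨C, hC⟩ := GeodesicRay.endpoint_eq_iff.1 (hx.trans hy.symm)
  have h1 := hC ⟨|C| + 1, by positivity⟩
  have h2 : dist (l (|C| + 1)) (l (-(|C| + 1))) ≤ C := h1
  rw [hl.dist_eq, Real.dist_eq, sub_neg_eq_add, abs_of_nonneg (by positivity)] at h2
  linarith [le_abs_self C, abs_nonneg C]

/-- Both `u` and `w` lie almost on the way from `p` to the far point `v`, at about height `t`, and
the four point inequality brings them together. In `exists_line` the point `v` runs along a ray and
`u` is on an approximating segment. -/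
theorem FourPoint.dist_le_of_far (h4 : FourPoint X δ') {p u v w : X} {t R n : ℝ}
    (h1 : dist u p ≤ t + R) (h2 : t - R ≤ dist u p) (h3 : dist v p = n)
    (h5 : dist u v ≤ n + R - t) (h6 : t ≤ gromovProduct p v w) (h7 : dist w p ≤ t) :
    dist u w ≤ 3 * R + 2 * δ' := by
  have k1 : t - R ≤ gromovProduct p u v := by unfold gromovProduct; linarith
  have k2 := h4.two k1 (by linarith : t - R ≤ gromovProduct p v w)
  have := dist_le_of_gromovProduct h1 (by linarith : dist w p ≤ t + 0)
    (show t - (R + δ') ≤ _ by linarith)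
  linarith

/-- Rays from `p` with bounded Gromov products are joined by a line that passes near `p`. -/
theorem IsDeltaHyperbolic.exists_line (h : IsDeltaHyperbolic X δ) (hδ : 0 ≤ δ) {p : X}
    {c c' : GeodesicRay X} (hc : c.1 0 = p) (hc' : c'.1 0 = p) {T : ℝ}
    (hT : ∀ s t, gromovProduct p (c.1 s) (c'.1 t) ≤ T) :
    ∃ l, IsLine l c.endpoint c'.endpoint ∧ dist (l 0) p ≤ T + 2 * δ + 2 := by
  have := h.1
  have h4 := h.fourPoint hδ
  have hT0 : 0 ≤ T := (gromovProduct_nonneg _ _ _).trans (hT 0 0)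
  choose σ hσ using fun n : ℕ => h.2.1 (c'.1 n) (c.1 n)
  choose s hs hsd using fun n : ℕ => h.exists_dist_le hδ (hσ n) p
  set R := T + 2 * δ + 2 with hRdef
  have hR : ∀ n, dist p (σ n (s n)) ≤ R := fun n => by
    have := hT n n
    rw [gromovProduct_comm] at this
    linarith [hsd n]
  have hcn : ∀ t : ℝ≥0, dist (c.1 t) p = t := fun t => by
    rw [← hc, c.2.dist_eq, NNReal.dist_eq]; simp
  have hcn' : ∀ t : ℝ≥0, dist (c'.1 t) p = t := fun t => by
    rw [← hc', c'.2.dist_eq, NNReal.dist_eq]; simp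
  have hr := fun n => (hσ n).dist_left (hs n)
  have hr' := fun n => (hσ n).dist_right (hs n)
  have b1 : ∀ n : ℕ, (n : ℝ) - R ≤ s n ∧ s n ≤ n + R := fun n => by
    have h1 := hcn' n
    have := dist_triangle_right (c'.1 n) p (σ n (s n))
    have := dist_triangle (c'.1 n) p (σ n (s n))
    simp only [NNReal.coe_natCast] at h1
    constructor <;> linarith [hr n, hR n]
  have b2 : ∀ n : ℕ, (n : ℝ) - R ≤ dist (c'.1 n) (c.1 n) - s n ∧
      dist (c'.1 n) (c.1 n) - s n ≤ n + R := fun n => by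
    have h1 := hcn n
    have := dist_triangle_right (c.1 n) p (σ n (s n))
    have := dist_triangle (c.1 n) p (σ n (s n))
    simp only [NNReal.coe_natCast] at h1
    rw [dist_comm (c.1 n) (σ n (s n))] at *
    constructor <;> linarith [hr' n, hR n]
  -- The segments between the `n`-th points of the rays are parametrized from their passage `s n`
  -- near `p`, so that they stay bounded at time zero and subconverge to a line.
  let f : ℕ → ℝ → X := fun n t => σ n (max 0 (min (s n + t) (dist (c'.1 n) (c.1 n))))
  have hf : ∀ (n : ℕ) (t : ℝ), |t| + R ≤ n → f n t = σ n (s n + t) ∧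
      s n + t ∈ Icc 0 (dist (c'.1 n) (c.1 n)) := fun n t ht => by
    have h1 : s n + t ≤ dist (c'.1 n) (c.1 n) := by linarith [(b2 n).1, le_abs_self t]
    have h2 : 0 ≤ s n + t := by linarith [(b1 n).1, neg_abs_le t]
    refine ⟨?_, h2, h1⟩
    simp only [f]
    rw [min_eq_left h1, max_eq_right h2]
  obtain ⟨φ, g, hφ, hg, -⟩ := exists_subseq_tendsto_of_dist_le f
    (fun n a b => ((hσ n).dist_clamp_le _ _).trans (by rw [Real.dist_eq, add_sub_add_left_eq_sub]))
    0 p R (fun n => by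
      simp only [f, add_zero]
      rw [min_eq_left (hs n).2, max_eq_right (hs n).1, dist_comm]
      exact hR n)
  have hev : ∀ t : ℝ, ∀ᶠ n in atTop, |t| + R ≤ (φ n : ℕ) := fun t =>
    (tendsto_natCast_atTop_atTop.comp hφ.tendsto_atTop).eventually_ge_atTop _
  have hiso : Isometry g := by
    refine Isometry.of_dist_eq fun a b => ?_
    refine tendsto_nhds_unique ((hg a).dist (hg b)) (tendsto_const_nhds.congr' ?_)
    filter_upwards [hev a, hev b] with n ha hb
    rw [(hf _ _ ha).1, (hf _ _ hb).1, (hσ _).2.2 _ (hf _ _ ha).2 _ (hf _ _ hb).2,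
      add_sub_add_left_eq_sub, Real.dist_eq]
  have hR0 : 0 ≤ R := by positivity
  have hmid : ∀ n t, |t| + R ≤ (n : ℕ) → dist (f n t) (σ n (s n)) = |t| := fun n t ht => by
    rw [(hf n t ht).1, (hσ n).2.2 _ (hf n t ht).2 _ (hs n), add_sub_cancel_left]
  have hprod : ∀ (c : GeodesicRay X), c.1 0 = p → ∀ t m : ℝ≥0, t ≤ m →
      (t : ℝ) ≤ gromovProduct p (c.1 m) (c.1 t) := fun c hc t m htm => by
    have := gromovProduct_ray (b := 0) c.2 (by rw [hc, dist_self]) htm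
    rwa [sub_zero, gromovProduct_comm] at this
  refine ⟨g, ⟨hiso, GeodesicRay.endpoint_eq_iff.2 ⟨3 * R + 2 * (3 * δ + 2), fun t => ?_⟩,
    GeodesicRay.endpoint_eq_iff.2 ⟨3 * R + 2 * (3 * δ + 2), fun t => ?_⟩⟩, ?_⟩
  · refine le_of_tendsto ((hg t).dist tendsto_const_nhds) ?_
    filter_upwards [hev t] with n hn
    have hm := hmid _ _ hn
    rw [NNReal.abs_eq] at hm hn
    refine h4.dist_le_of_far (t := t) (n := ((φ n : ℕ) : ℝ≥0)) (v := c.1 (φ n : ℕ)) ?_ ?_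
      (hcn _) ?_ (hprod c hc _ _ ?_) (hcn t).le
    · linarith [dist_triangle_right (f (φ n) t) p (σ (φ n) (s (φ n))), hR (φ n)]
    · linarith [dist_triangle_left (f (φ n) t) (σ (φ n) (s (φ n))) p, hR (φ n),
        dist_triangle (f (φ n) t) p (σ (φ n) (s (φ n)))]
    · have hh := hf (φ n) t (by rwa [NNReal.abs_eq])
      rw [hh.1, (hσ _).dist_right hh.2]
      simp only [NNReal.coe_natCast]
      linarith [(b2 (φ n)).2]
    · have : (t : ℝ) ≤ (φ n : ℕ) := by linarith
      exact_mod_cast this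
  · refine le_of_tendsto ((hg (-t)).dist tendsto_const_nhds) ?_
    filter_upwards [hev (-t)] with n hn
    have hm := hmid _ _ hn
    rw [abs_neg, NNReal.abs_eq] at hm hn
    refine h4.dist_le_of_far (t := t) (n := ((φ n : ℕ) : ℝ≥0)) (v := c'.1 (φ n : ℕ)) ?_ ?_
      (hcn' _) ?_ (hprod c' hc' _ _ ?_) (hcn' t).le
    · linarith [dist_triangle_right (f (φ n) (-t)) p (σ (φ n) (s (φ n))), hR (φ n)]
    · linarith [dist_triangle_left (f (φ n) (-t)) (σ (φ n) (s (φ n))) p, hR (φ n),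
        dist_triangle (f (φ n) (-t)) p (σ (φ n) (s (φ n)))]
    · have hh := hf (φ n) (-t) (by rwa [abs_neg, NNReal.abs_eq])
      rw [hh.1, dist_comm, (hσ _).dist_left hh.2]
      simp only [NNReal.coe_natCast]
      linarith [(b1 (φ n)).2]
    · have : (t : ℝ) ≤ (φ n : ℕ) := by linarith
      exact_mod_cast this
  · refine le_of_tendsto ((hg 0).dist tendsto_const_nhds) (Eventually.of_forall fun n => ?_)
    simp only [f, add_zero]
    rw [min_eq_left (hs _).2, max_eq_right (hs _).1, dist_comm]
    exact hR _

theorem gromovProduct_le_left (p x y : X) : gromovProduct p x y ≤ dist x p := by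
  unfold gromovProduct; linarith [dist_triangle_left y p x]

theorem gromovProduct_le_right (p x y : X) : gromovProduct p x y ≤ dist y p := by
  rw [gromovProduct_comm]; exact gromovProduct_le_left p y x

theorem GeodesicRay.dist_zero (c : GeodesicRay X) {p : X} (hc : c.1 0 = p) (t : ℝ≥0) :
    dist (c.1 t) p = t := by
  rw [← hc, c.2.dist_eq, NNReal.dist_eq]; simp

theorem GeodesicRay.gromovProduct_eq (c : GeodesicRay X) {p : X} (hc : c.1 0 = p) {s t : ℝ≥0}
    (hst : s ≤ t) : gromovProduct p (c.1 s) (c.1 t) = s := by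
  unfold gromovProduct
  rw [c.dist_zero hc, c.dist_zero hc, c.2.dist_eq, NNReal.dist_eq, abs_sub_comm,
    abs_of_nonneg (sub_nonneg.2 (by exact_mod_cast hst))]
  ring

/-- Rays from `p` stay close up to the time given by the Gromov product of two of their points. -/
theorem FourPoint.dist_ray_le (h4 : FourPoint X δ') (hδ : 0 ≤ δ') {p : X} {c c' : GeodesicRay X}
    (hc : c.1 0 = p) (hc' : c'.1 0 = p) {s t τ : ℝ≥0}
    (h : (τ : ℝ) ≤ gromovProduct p (c.1 s) (c'.1 t)) : dist (c.1 τ) (c'.1 τ) ≤ 4 * δ' := by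
  have h1 : τ ≤ s := by
    have := h.trans (gromovProduct_le_left _ _ _)
    rw [c.dist_zero hc] at this; exact_mod_cast this
  have h2 : τ ≤ t := by
    have := h.trans (gromovProduct_le_right _ _ _)
    rw [c'.dist_zero hc'] at this; exact_mod_cast this
  have k2 := (c'.gromovProduct_eq hc' h2).ge
  rw [gromovProduct_comm] at k2
  have := h4.three (c.gromovProduct_eq hc h1).ge h k2 hδ
  have := dist_le_of_gromovProduct (t := τ) (a := 0) (b := 0) (by rw [c.dist_zero hc, add_zero])
    (by rw [c'.dist_zero hc', add_zero]) (show (τ : ℝ) - 2 * δ' ≤ _ from this)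
  linarith

/-- Unbounded products would keep the rays `4 * δ'`-close at all times by `dist_ray_le`. -/
theorem FourPoint.exists_gromovProduct_le (h4 : FourPoint X δ') (hδ : 0 ≤ δ') {p : X}
    {c c' : GeodesicRay X} (hc : c.1 0 = p) (hc' : c'.1 0 = p) (hne : c.endpoint ≠ c'.endpoint) :
    ∃ T, ∀ s t, gromovProduct p (c.1 s) (c'.1 t) ≤ T := by
  by_contra hcon
  push Not at hcon
  refine hne (GeodesicRay.endpoint_eq_iff.2 ⟨4 * δ', fun τ => ?_⟩)
  obtain ⟨s, t, hst⟩ := hcon τ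
  exact h4.dist_ray_le hδ hc hc' hst.le

/-! ### Ends of quasi-geodesics -/

theorem exists_dist_le_of_hausdorffEDist {A B : Set X} (h : Metric.hausdorffEDist A B ≠ ⊤) :
    ∃ r : ℝ, ∀ a ∈ A, ∃ b ∈ B, dist a b ≤ r := by
  refine ⟨(Metric.hausdorffEDist A B).toReal + 1, fun a ha => ?_⟩
  obtain ⟨b, hb, hlt⟩ := Metric.exists_edist_lt_of_hausdorffEDist_lt (r := Metric.hausdorffEDist A B + 1) ha
    (ENNReal.lt_add_right h one_ne_zero)
  refine ⟨b, hb, ?_⟩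
  rw [dist_edist, ← ENNReal.toReal_one, ← ENNReal.toReal_add h ENNReal.one_ne_top]
  exact ENNReal.toReal_mono (ENNReal.add_ne_top.2 ⟨h, ENNReal.one_ne_top⟩) hlt.le

theorem hausdorffEDist_ne_top_trans {A B C : Set X} (h1 : Metric.hausdorffEDist A B ≠ ⊤)
    (h2 : Metric.hausdorffEDist B C ≠ ⊤) : Metric.hausdorffEDist A C ≠ ⊤ :=
  ne_top_of_le_ne_top (ENNReal.add_ne_top.2 ⟨h1, h2⟩) Metric.hausdorffEDist_triangle

/-- The parameter on a ray is the distance from its origin, so a nearby point of the other ray has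
nearly the same parameter. This links ends of quasi-geodesics, defined by Hausdorff distance, with
endpoints of rays. -/
theorem GeodesicRay.endpoint_eq_iff_hausdorffEDist {c c' : GeodesicRay X} :
    c.endpoint = c'.endpoint ↔ Metric.hausdorffEDist (range c.1) (range c'.1) ≠ ⊤ := by
  rw [GeodesicRay.endpoint_eq_iff]
  constructor
  · rintro ⟨C, hC⟩
    refine ne_top_of_le_ne_top (b := ENNReal.ofReal C) ENNReal.ofReal_ne_top
      (Metric.hausdorffEDist_le_of_mem_edist ?_ ?_)
    · rintro _ ⟨t, rfl⟩
      exact ⟨_, ⟨t, rfl⟩, by rw [edist_dist]; exact ENNReal.ofReal_le_ofReal (hC t)⟩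
    · rintro _ ⟨t, rfl⟩
      exact ⟨_, ⟨t, rfl⟩, by rw [edist_dist, dist_comm]; exact ENNReal.ofReal_le_ofReal (hC t)⟩
  · intro h
    obtain ⟨r, hr⟩ := exists_dist_le_of_hausdorffEDist h
    refine ⟨2 * r + dist (c.1 0) (c'.1 0), fun t => ?_⟩
    obtain ⟨_, ⟨s, rfl⟩, hs⟩ := hr _ ⟨t, rfl⟩
    have h1 := c.dist_zero rfl t
    have h2 := c'.dist_zero rfl s
    have h3 : dist (c'.1 s) (c'.1 t) = |(s : ℝ) - t| := by rw [c'.2.dist_eq, NNReal.dist_eq]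
    have h4 : |(s : ℝ) - t| ≤ r + dist (c.1 0) (c'.1 0) := by
      have k1 := dist_triangle4 (c.1 t) (c'.1 s) (c'.1 0) (c.1 0)
      have k2 := dist_triangle4 (c'.1 s) (c.1 t) (c.1 0) (c'.1 0)
      rw [dist_comm (c'.1 0)] at k1
      rw [dist_comm (c'.1 s) (c.1 t)] at k2
      rw [abs_le]; constructor <;> linarith
    linarith [dist_triangle (c.1 t) (c'.1 s) (c'.1 t)]

theorem ForwardEnd.unique {l : ℝ → X} {x x' : GromovBoundary X} (h : ForwardEnd l x)
    (h' : ForwardEnd l x') : x = x' := by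
  obtain ⟨c, rfl, hc⟩ := h
  obtain ⟨c', rfl, hc'⟩ := h'
  rw [Metric.hausdorffEDist_comm] at hc
  exact GeodesicRay.endpoint_eq_iff_hausdorffEDist.2 (hausdorffEDist_ne_top_trans hc hc')

theorem backwardEnd_iff {l : ℝ → X} {y : GromovBoundary X} :
    BackwardEnd l y ↔ ForwardEnd (fun t => l (-t)) y := by
  unfold BackwardEnd ForwardEnd
  have : l '' Iic 0 = (fun t => l (-t)) '' Ici 0 := by
    rw [show (fun t => l (-t)) = l ∘ Neg.neg from rfl, image_comp]
    simp
  rw [this]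

theorem image_Ici_eq_range_fwdRay {l : ℝ → X} (hl : Isometry l) :
    l '' Ici 0 = range (fwdRay l hl).1 := by
  ext z
  constructor
  · rintro ⟨t, ht, rfl⟩; exact ⟨⟨t, ht⟩, rfl⟩
  · rintro ⟨t, rfl⟩; exact ⟨t, t.2, rfl⟩

theorem IsLine.forwardEnd {l : ℝ → X} {x y : GromovBoundary X} (h : IsLine l x y) :
    ForwardEnd l x := by
  obtain ⟨hl, hx, -⟩ := h
  exact ⟨_, hx, by rw [image_Ici_eq_range_fwdRay hl, Metric.hausdorffEDist_self]; simp⟩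

theorem IsLine.backwardEnd {l : ℝ → X} {x y : GromovBoundary X} (h : IsLine l x y) :
    BackwardEnd l y := backwardEnd_iff.2 h.reverse.forwardEnd

theorem IsLine.smul {Γ : Type*} [Group Γ] [MulAction Γ X] [IsIsometricSMul Γ X] {l : ℝ → X}
    {x y : GromovBoundary X} (h : IsLine l x y) (γ : Γ) :
    IsLine (fun t => γ • l t) (γ • x) (γ • y) := by
  obtain ⟨hl, rfl, rfl⟩ := h
  exact ⟨(isometry_smul X γ).comp hl, rfl, rfl⟩

theorem ForwardEnd.exists_dist_le {l l' : ℝ → X} {x : GromovBoundary X} (h : ForwardEnd l x)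
    (h' : ForwardEnd l' x) : ∃ r, ∀ t, 0 ≤ t → ∃ s, 0 ≤ s ∧ dist (l t) (l' s) ≤ r := by
  obtain ⟨c, hcx, hc⟩ := h
  obtain ⟨c', hcx', hc'⟩ := h'
  rw [Metric.hausdorffEDist_comm] at hc'
  have := hausdorffEDist_ne_top_trans (hausdorffEDist_ne_top_trans hc
    (GeodesicRay.endpoint_eq_iff_hausdorffEDist.1 (hcx.trans hcx'.symm))) hc'
  obtain ⟨r, hr⟩ := exists_dist_le_of_hausdorffEDist this
  refine ⟨r, fun t ht => ?_⟩
  obtain ⟨_, ⟨s, hs, rfl⟩, hd⟩ := hr _ ⟨t, ht, rfl⟩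
  exact ⟨s, hs, hd⟩

/-- Sides of a geodesic quadrilateral are close to the union of the three other sides. -/
theorem IsDeltaHyperbolic.slim_quad (h : IsDeltaHyperbolic X δ) {x y u v : X} {c e : ℝ → X}
    (hc : IsGeodesicSegment c x y) (he : IsGeodesicSegment e u v) {t : ℝ}
    (ht : t ∈ Icc 0 (dist x y)) (hδ : 0 ≤ δ) :
    dist (c t) x ≤ 2 * δ + dist x u ∨ dist (c t) y ≤ 2 * δ + dist y v ∨
      ∃ s ∈ Icc 0 (dist u v), dist (c t) (e s) ≤ 2 * δ := by
  obtain ⟨a, ha⟩ := h.2.1 y v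
  obtain ⟨b, hb⟩ := h.2.1 v x
  obtain ⟨f, hf⟩ := h.2.1 x u
  rcases h.slim hc ha hb ht with ⟨s, hs, hd⟩ | ⟨s, hs, hd⟩
  · right; left
    have := ha.dist_left hs
    linarith [dist_triangle_right (c t) y (a s), hs.2]
  rcases h.slim hb hf he hs with ⟨s', hs', hd'⟩ | ⟨s', hs', hd'⟩
  · left
    have := hf.dist_left hs'
    have := dist_triangle (c t) (b s) x
    have := dist_triangle_right (b s) x (f s')
    linarith [hs'.2]
  · right; right
    exact ⟨s', hs', by linarith [dist_triangle (c t) (b s) (e s')]⟩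

/-- A quasi-geodesic is uniformly close to a line with the same ends, in an oriented way. -/
theorem IsDeltaHyperbolic.exists_quasiGeodesic_near_line (h : IsDeltaHyperbolic X δ) (hδ : 0 ≤ δ)
    {lam ε : ℝ} (hlam : 1 ≤ lam) (hε : 0 ≤ ε) :
    ∃ D, 0 ≤ D ∧ ∀ (l l' : ℝ → X) (x y : GromovBoundary X), IsQuasiGeodesic lam ε l →
      ForwardEnd l x → BackwardEnd l y → IsLine l' x y →
        ∃ s₀, dist (l 0) (l' s₀) ≤ D ∧ ∀ t, 0 ≤ t → ∃ s, s₀ ≤ s ∧ dist (l t) (l' s) ≤ D := by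
  obtain ⟨D, hD, hnear⟩ := h.exists_quasiGeodesic_near hδ hlam hε
  refine ⟨3 * (D + 2 * δ) + (lam + ε), by positivity, fun l l' x y hl hx hy hl' => ?_⟩
  have hseq : ∀ a : ℝ, IsQuasiGeodesicSeq lam ε fun k : ℕ => l (a + k) := fun a i j => by
    have := hl (a + i) (a + j)
    rwa [add_sub_add_left_eq_sub] at this
  have hiso : Isometry l' := hl'.1
  -- Compare a geodesic between two points of `l` with a piece of the line `l'`. A point of `l` in
  -- between is near one of its two ends, in terms of how far that end is from `l'`, or near the
  -- piece of `l'`.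
  have step : ∀ (a : ℝ) (N m : ℕ) (α β : ℝ), m ≤ N → α ≤ β →
      dist (l (a + m)) (l a) ≤ D + 2 * δ + dist (l a) (l' α) ∨
      dist (l (a + m)) (l (a + N)) ≤ D + 2 * δ + dist (l (a + N)) (l' β) ∨
      ∃ s, α ≤ s ∧ dist (l (a + m)) (l' s) ≤ D + 2 * δ := by
    intro a N m α β hm hαβ
    obtain ⟨c, hc⟩ := h.2.1 (l a) (l (a + N))
    obtain ⟨t, ht, hd⟩ := hnear _ (hseq a) N c (by simpa using hc) m hm
    have ht' : t ∈ Icc 0 (dist (l a) (l (a + N))) := by simpa using ht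
    rcases h.slim_quad hc (hiso.isGeodesicSegment hαβ) ht' hδ with h1 | h1 | ⟨s, hs, h1⟩
    · left; linarith [dist_triangle (l (a + m)) (c t) (l a)]
    · right; left; linarith [dist_triangle (l (a + m)) (c t) (l (a + N))]
    · right; right
      exact ⟨α + s, by linarith [hs.1], by linarith [dist_triangle (l (a + m)) (c t) (l' (α + s))]⟩
  have hlow : ∀ s t : ℝ, |s - t| ≤ lam * (dist (l s) (l t) + ε) := fun s t => by
    have h1 := (hl s t).1
    have h2 : lam⁻¹ * |s - t| ≤ dist (l s) (l t) + ε := by linarith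
    rwa [inv_mul_le_iff₀ (by linarith)] at h2
  obtain ⟨r₁, hr₁⟩ := hx.exists_dist_le hl'.forwardEnd
  obtain ⟨r₂, hr₂⟩ := (backwardEnd_iff.1 hy).exists_dist_le hl'.reverse.forwardEnd
  -- The points `l N` and `l (-N)` are at bounded, non-uniform distance from `l'`. For large `N`
  -- they are too far from `l 0` for the first two alternatives, so the uniform third one remains.
  have hmid : ∃ s₀, dist (l 0) (l' s₀) ≤ D + 2 * δ := by
    obtain ⟨N, hN⟩ := exists_nat_gt (lam * (D + 2 * δ + max r₁ r₂ + ε))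
    obtain ⟨β, hβ, hdβ⟩ := hr₁ N (Nat.cast_nonneg N)
    obtain ⟨α, hα, hdα⟩ := hr₂ N (Nat.cast_nonneg N)
    have e : (-(N : ℝ)) + ((N + N : ℕ) : ℝ) = N := by push_cast; ring
    have hN0 : (0 : ℝ) ≤ N := Nat.cast_nonneg N
    rcases step (-N) (N + N) N (-α) β (by omega) (by linarith) with h1 | h1 | ⟨s, -, h1⟩
    · rw [neg_add_cancel] at h1
      have k := hlow 0 (-N)
      rw [zero_sub, neg_neg, abs_of_nonneg hN0] at k
      have := mul_le_mul_of_nonneg_left (show dist (l 0) (l (-N)) + ε ≤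
        D + 2 * δ + max r₁ r₂ + ε by linarith [le_max_right r₁ r₂]) (by linarith : (0 : ℝ) ≤ lam)
      linarith
    · rw [neg_add_cancel, e] at h1
      have k := hlow 0 N
      rw [zero_sub, abs_neg, abs_of_nonneg hN0] at k
      have := mul_le_mul_of_nonneg_left (show dist (l 0) (l N) + ε ≤
        D + 2 * δ + max r₁ r₂ + ε by linarith [le_max_left r₁ r₂]) (by linarith : (0 : ℝ) ≤ lam)
      linarith
    · rw [neg_add_cancel] at h1
      exact ⟨s, h1⟩
  obtain ⟨s₀, hs₀⟩ := hmid
  refine ⟨s₀, by linarith, ?_⟩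
  -- Again only the far end is excluded by the choice of `N`. If `l m` is near the end `l 0`, the
  -- parameter `s₀` itself serves, which accounts for the factor three.
  have hnat : ∀ m : ℕ, ∃ s, s₀ ≤ s ∧ dist (l m) (l' s) ≤ 3 * (D + 2 * δ) := by
    intro m
    obtain ⟨N, hN⟩ := exists_nat_gt (m + lam * (D + 2 * δ + r₁ + |s₀| + ε))
    obtain ⟨β, hβ, hdβ⟩ := hr₁ N (Nat.cast_nonneg N)
    have hr0 : 0 ≤ r₁ := dist_nonneg.trans hdβ
    have hpos : 0 ≤ lam * (D + 2 * δ + r₁ + |s₀| + ε) := by positivity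
    have hmN : (m : ℝ) ≤ N := by linarith
    have hsβ : s₀ ≤ β := by
      by_contra hlt
      push Not at hlt
      have k := hlow 0 N
      rw [zero_sub, abs_neg, abs_of_nonneg (Nat.cast_nonneg N)] at k
      have k2 : dist (l' s₀) (l' β) ≤ |s₀| := by
        rw [hiso.dist_eq, Real.dist_eq, abs_of_nonneg (by linarith)]
        linarith [le_abs_self s₀]
      have k3 := dist_triangle4 (l 0) (l' s₀) (l' β) (l N)
      rw [dist_comm (l' β)] at k3
      have := mul_le_mul_of_nonneg_left (show dist (l 0) (l N) + ε ≤
        D + 2 * δ + r₁ + |s₀| + ε by linarith) (by linarith : (0 : ℝ) ≤ lam)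
      linarith [(Nat.cast_nonneg m : (0 : ℝ) ≤ m)]
    rcases step 0 N m s₀ β (by exact_mod_cast hmN) hsβ with h1 | h1 | ⟨s, hs, h1⟩
    · rw [zero_add] at h1
      exact ⟨s₀, le_rfl, by linarith [dist_triangle (l m) (l 0) (l' s₀)]⟩
    · rw [zero_add, zero_add] at h1
      have k := hlow N m
      rw [abs_of_nonneg (by linarith), dist_comm] at k
      have := mul_le_mul_of_nonneg_left (show dist (l m) (l N) + ε ≤
        D + 2 * δ + r₁ + |s₀| + ε by linarith [abs_nonneg s₀]) (by linarith : (0 : ℝ) ≤ lam)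
      linarith
    · rw [zero_add] at h1
      exact ⟨s, hs, by linarith⟩
  intro t ht
  obtain ⟨s, hs, hd⟩ := hnat ⌊t⌋₊
  refine ⟨s, hs, ?_⟩
  have k1 := (hl t ⌊t⌋₊).2
  have k2 : |t - ⌊t⌋₊| ≤ 1 := by
    rw [abs_of_nonneg (by linarith [Nat.floor_le ht])]
    linarith [Nat.lt_floor_add_one t]
  have := mul_le_mul_of_nonneg_left k2 (by linarith : (0 : ℝ) ≤ lam)
  linarith [dist_triangle (l t) (l ⌊t⌋₊) (l' s)]

end HyperbolicGeometry

open Filter Topology Set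
open scoped NNReal ENNReal
noncomputable section

section BoundaryProduct

variable {X : Type*} [MetricSpace X] {δ δ' : ℝ} {p : X}

/-! ### Convergence to boundary points -/

/-- Points on converging rays, at times that go to infinity, converge to the end of the limit. -/
theorem convergesTo_of_rays {f : ℕ → GeodesicRay X} {g : GeodesicRay X}
    (hf : ∀ n, (f n).1 0 = p) (hg : g.1 0 = p)
    (hu : ∀ K : Set ℝ≥0, IsCompact K → TendstoUniformlyOn (fun n => (f n).1) g.1 atTop K)
    {R : ℕ → ℝ≥0} (hR : Tendsto R atTop atTop) :
    ConvergesTo p (fun n => Sum.inl ((f n).1 (R n))) (Sum.inr g.endpoint) := by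
  refine ⟨fun n t => (f n).1 (min t (R n)), fun n => ⟨by simp [hf], R n, fun s hs t ht => ?_,
    fun t ht => congrArg (f n).1 (min_eq_right ht)⟩, fun φ hφ => ⟨id, strictMono_id, g.1, ⟨hg, g.2, rfl⟩, ?_⟩⟩
  · change dist ((f n).1 (min s (R n))) ((f n).1 (min t (R n))) = _
    rw [min_eq_left hs, min_eq_left ht, (f n).2.dist_eq]
  · intro K hK u hu'
    obtain ⟨N, hN⟩ := hK.bddAbove
    filter_upwards [hφ.tendsto_atTop.eventually (hu K hK u hu'),
      hφ.tendsto_atTop.eventually (hR.eventually_ge_atTop N)] with n hn hn' t ht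
    simp only [id]
    rw [min_eq_left ((hN ht).trans hn')]
    exact hn t ht

theorem convergesTo_ends_of_rays {f : ℕ → GeodesicRay X} {g : GeodesicRay X}
    (hf : ∀ n, (f n).1 0 = p) (hg : g.1 0 = p)
    (hu : ∀ K : Set ℝ≥0, IsCompact K → TendstoUniformlyOn (fun n => (f n).1) g.1 atTop K) :
    ConvergesTo p (fun n => Sum.inr (f n).endpoint) (Sum.inr g.endpoint) :=
  ⟨fun n => (f n).1, fun n => ⟨hf n, (f n).2, rfl⟩, fun _ hφ => ⟨id, strictMono_id, g.1,
    ⟨hg, g.2, rfl⟩, fun K hK u hu' => hφ.tendsto_atTop.eventually (hu K hK u hu')⟩⟩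

theorem convergesTo_ray {c : GeodesicRay X} (hc : c.1 0 = p) :
    ConvergesTo p (fun n : ℕ => Sum.inl (c.1 n)) (Sum.inr c.endpoint) :=
  convergesTo_of_rays (f := fun _ => c) (fun _ => hc) hc
    (fun _ _ _ hu => Eventually.of_forall fun _ _ _ => refl_mem_uniformity hu)
    tendsto_natCast_atTop_atTop

theorem FourPoint.close_of_endpoint_eq (h4 : FourPoint X δ') (hδ : 0 ≤ δ') {c c' : GeodesicRay X}
    (hc : c.1 0 = p) (hc' : c'.1 0 = p) (h : c.endpoint = c'.endpoint) (t : ℝ≥0) :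
    dist (c.1 t) (c'.1 t) ≤ 4 * δ' := by
  obtain ⟨C, hC⟩ := GeodesicRay.endpoint_eq_iff.1 h
  have := h4.asymptotic_close hδ c.2 c'.2 hC (p := p) (b := 0) (by rw [hc, dist_self])
    (by rw [hc', dist_self]) t
  linarith

/-- If every subsequence has a subsequence along which `Q` holds at some time, then `Q` holds
eventually. -/
theorem eventually_of_subseq {Q : ℕ → Prop}
    (h : ∀ φ : ℕ → ℕ, StrictMono φ → ∃ n, Q (φ n)) : ∀ᶠ n in atTop, Q n := by
  by_contra hcon
  obtain ⟨φ, hφ, hφ'⟩ := extraction_of_frequently_atTop (not_eventually.1 hcon)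
  obtain ⟨n, hn⟩ := h φ hφ
  exact hφ' n hn

theorem gromovProduct_le_add_dist (p x y z : X) :
    gromovProduct p x y ≤ gromovProduct p x z + dist y z := by
  unfold gromovProduct
  linarith [dist_triangle y z p, dist_triangle x y z]

/-- The generalized rays to `u n` subconverge to a ray with the same endpoint as `c`, hence pass
near `c.1 T` at time `T`. If such a ray stops before `T`, the point `u n` itself is near `c.1 T`. -/
theorem FourPoint.eventually_gromovProduct (h4 : FourPoint X δ') (hδ : 0 ≤ δ') {u : ℕ → X}
    {c : GeodesicRay X} (hc : c.1 0 = p)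
    (hu : ConvergesTo p (fun n => Sum.inl (u n)) (Sum.inr c.endpoint)) (T : ℝ≥0) :
    ∀ᶠ n in atTop, (T : ℝ) - (4 * δ' + 2) ≤ gromovProduct p (u n) (c.1 T) := by
  obtain ⟨e, he, hsub⟩ := hu
  refine eventually_of_subseq fun φ hφ => ?_
  obtain ⟨ψ, hψ, c', ⟨h0, hiso, hend⟩, hlim⟩ := hsub φ hφ
  obtain ⟨n, hn⟩ := ((Metric.tendstoUniformlyOn_iff.1 (hlim {T} isCompact_singleton)) 1
    one_pos).exists
  refine ⟨ψ n, ?_⟩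
  have h1 := hn T rfl
  have h2 : dist (c' T) (c.1 T) ≤ 4 * δ' :=
    h4.close_of_endpoint_eq hδ (c := ⟨c', hiso⟩) h0 hc hend T
  obtain ⟨h5, R, h6, h7⟩ := he (φ (ψ n))
  set w := e (φ (ψ n))
  have h3 : (T : ℝ) - 1 ≤ gromovProduct p (u (φ (ψ n))) (w T) := by
    have h8 : dist (c' T) p = T := GeodesicRay.dist_zero ⟨c', hiso⟩ h0 T
    rcases le_total T R with hTR | hTR
    · have k1 : dist (w T) p = T := by
        rw [← h5, h6 T hTR 0 zero_le, NNReal.dist_eq]; simp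
      have k2 : dist (u (φ (ψ n))) p = R := by
        rw [← h5, ← h7 R le_rfl, h6 R le_rfl 0 zero_le, NNReal.dist_eq]; simp
      have k3 : dist (u (φ (ψ n))) (w T) = R - T := by
        rw [← h7 R le_rfl, h6 R le_rfl T hTR, NNReal.dist_eq, abs_of_nonneg]
        exact sub_nonneg.2 (by exact_mod_cast hTR)
      unfold gromovProduct
      linarith
    · have k1 : w T = u (φ (ψ n)) := h7 T hTR
      unfold gromovProduct
      rw [← k1, dist_self]
      linarith [dist_triangle (c' T) (w T) p]
  have h8 := gromovProduct_le_add_dist p (u (φ (ψ n))) (w T) (c.1 T)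
  linarith [dist_triangle_left (w T) (c.1 T) (c' T)]

theorem FourPoint.eventually_dist_le (h4 : FourPoint X δ') (hδ : 0 ≤ δ') {u : ℕ → GeodesicRay X}
    (hu0 : ∀ n, (u n).1 0 = p) {c : GeodesicRay X} (hc : c.1 0 = p)
    (hu : ConvergesTo p (fun n => Sum.inr (u n).endpoint) (Sum.inr c.endpoint)) (T : ℝ≥0) :
    ∀ᶠ n in atTop, dist ((u n).1 T) (c.1 T) ≤ 8 * δ' + 1 := by
  obtain ⟨e, he, hsub⟩ := hu
  refine eventually_of_subseq fun φ hφ => ?_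
  obtain ⟨ψ, hψ, c', ⟨h0, hiso, hend⟩, hlim⟩ := hsub φ hφ
  obtain ⟨n, hn⟩ := ((Metric.tendstoUniformlyOn_iff.1 (hlim {T} isCompact_singleton)) 1
    one_pos).exists
  refine ⟨ψ n, ?_⟩
  have h1 := hn T rfl
  have h2 : dist (c' T) (c.1 T) ≤ 4 * δ' :=
    h4.close_of_endpoint_eq hδ (c := ⟨c', hiso⟩) h0 hc hend T
  obtain ⟨h5, h6, h7⟩ := he (φ (ψ n))
  have h3 : dist (e (φ (ψ n)) T) ((u (φ (ψ n))).1 T) ≤ 4 * δ' :=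
    h4.close_of_endpoint_eq hδ (c := ⟨_, h6⟩) h5 (hu0 _) h7 T
  have h8 := dist_triangle4 ((u (φ (ψ n))).1 T) (e (φ (ψ n)) T) (c' T) (c.1 T)
  linarith [dist_comm ((u (φ (ψ n))).1 T) (e (φ (ψ n)) T), dist_comm (e (φ (ψ n)) T) (c' T)]

/-! ### The Gromov product of boundary points -/

/-- The rays themselves give sequences that compete in the supremum. With `FourPoint.dist_le_of_lt`
this shows that the product of two boundary points is, up to constants, the time at which their rays
separate. -/
theorem ofReal_le_boundaryGromovProduct {c c' : GeodesicRay X} (hc : c.1 0 = p) (hc' : c'.1 0 = p)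
    {T : ℝ≥0} {E : ℝ} (h : dist (c.1 T) (c'.1 T) ≤ E) :
    ENNReal.ofReal (T - E / 2) ≤ boundaryGromovProduct p c.endpoint c'.endpoint := by
  refine le_trans ?_ (le_iSup₂_of_le (fun n : ℕ => c.1 n) (fun n : ℕ => c'.1 n)
    (le_iSup₂_of_le (convergesTo_ray hc) (convergesTo_ray hc') le_rfl))
  refine le_liminf_of_le (by isBoundedDefault) ?_
  obtain ⟨N, hN⟩ := exists_nat_ge T
  filter_upwards [eventually_ge_atTop (N, N)] with mn hmn
  refine ENNReal.ofReal_le_ofReal ?_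
  have h1 : T ≤ (mn.1 : ℝ≥0) := hN.trans (by exact_mod_cast hmn.1)
  have h2 : T ≤ (mn.2 : ℝ≥0) := hN.trans (by exact_mod_cast hmn.2)
  have e1 : dist (c.1 mn.1) (c.1 T) = (mn.1 : ℝ≥0) - T := by
    rw [c.2.dist_eq, NNReal.dist_eq, abs_of_nonneg]
    exact sub_nonneg.2 (by exact_mod_cast h1)
  have e2 : dist (c'.1 T) (c'.1 mn.2) = (mn.2 : ℝ≥0) - T := by
    rw [c'.2.dist_eq, NNReal.dist_eq, abs_sub_comm, abs_of_nonneg]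
    exact sub_nonneg.2 (by exact_mod_cast h2)
  unfold gromovProduct
  rw [c.dist_zero hc, c'.dist_zero hc']
  linarith [dist_triangle4 (c.1 mn.1) (c.1 T) (c'.1 T) (c'.1 mn.2)]

/-- Take a competing pair with product above `T`. Far out, its points also have product almost `T`
with `c.1 T` and `c'.1 T`, so two applications of the four point inequality compare the rays at time
`T`. -/
theorem FourPoint.dist_le_of_lt (h4 : FourPoint X δ') (hδ : 0 ≤ δ') {c c' : GeodesicRay X}
    (hc : c.1 0 = p) (hc' : c'.1 0 = p) {T : ℝ≥0}
    (h : (T : ℝ≥0∞) < boundaryGromovProduct p c.endpoint c'.endpoint) :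
    dist (c.1 T) (c'.1 T) ≤ 12 * δ' + 4 := by
  unfold boundaryGromovProduct at h
  simp only [lt_iSup_iff] at h
  obtain ⟨u, v, hu, hv, h⟩ := h
  have h1 := eventually_lt_of_lt_liminf h (by isBoundedDefault)
  rw [← prod_atTop_atTop_eq] at h1
  have h2 := (h4.eventually_gromovProduct hδ hc hu T).prod_mk
    (h4.eventually_gromovProduct hδ hc' hv T)
  obtain ⟨⟨m, n⟩, hm1, hm2, hm3⟩ := (h1.and h2).exists
  simp only at hm1 hm2 hm3
  have hm1' : (T : ℝ) ≤ gromovProduct p (u m) (v n) := by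
    rw [← ENNReal.ofReal_coe_nnreal] at hm1
    exact ((ENNReal.ofReal_lt_ofReal_iff_of_nonneg T.2).1 hm1).le
  rw [gromovProduct_comm] at hm2
  have := h4.three hm2 (by linarith : (T : ℝ) - (4 * δ' + 2) ≤ _) hm3 hδ
  have := dist_le_of_gromovProduct (t := T) (a := 0) (b := 0) (by rw [c.dist_zero hc, add_zero])
    (by rw [c'.dist_zero hc', add_zero]) (show (T : ℝ) - (6 * δ' + 2) ≤ _ by linarith)
  linarith

theorem boundaryGromovProduct_comm (p : X) (x y : GromovBoundary X) :
    boundaryGromovProduct p x y = boundaryGromovProduct p y x := by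
  have key : ∀ x y : GromovBoundary X,
      boundaryGromovProduct p x y ≤ boundaryGromovProduct p y x := by
    intro x y
    refine iSup₂_le fun u v => iSup₂_le fun hu hv => ?_
    refine le_iSup₂_of_le v u (le_iSup₂_of_le hv hu ?_)
    have e : (atTop : Filter (ℕ × ℕ)) = map Prod.swap atTop := by
      rw [← prod_atTop_atTop_eq, ← prod_comm]
    have e' : (fun mn : ℕ × ℕ => ENNReal.ofReal (gromovProduct p (u mn.1) (v mn.2))) =
        (fun mn : ℕ × ℕ => ENNReal.ofReal (gromovProduct p (v mn.1) (u mn.2))) ∘ Prod.swap :=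
      funext fun mn => by rw [gromovProduct_comm]; rfl
    rw [e', liminf_comp, ← e]
  exact le_antisymm (key x y) (key y x)

theorem boundaryGromovProduct_self (p : X) {c : GeodesicRay X} (hc : c.1 0 = p) :
    boundaryGromovProduct p c.endpoint c.endpoint = ⊤ := by
  refine ENNReal.eq_top_of_forall_nnreal_le fun r => ?_
  have := ofReal_le_boundaryGromovProduct hc hc (T := r) (E := 0) (by rw [dist_self])
  simpa using this

theorem FourPoint.eq_of_boundaryGromovProduct_eq_top (h4 : FourPoint X δ') (hδ : 0 ≤ δ')
    {c c' : GeodesicRay X} (hc : c.1 0 = p) (hc' : c'.1 0 = p)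
    (h : boundaryGromovProduct p c.endpoint c'.endpoint = ⊤) : c.endpoint = c'.endpoint :=
  GeodesicRay.endpoint_eq_iff.2 ⟨12 * δ' + 4, fun t => h4.dist_le_of_lt hδ hc hc'
    (by rw [h]; exact ENNReal.coe_lt_top)⟩

/-! ### The exponential of the Gromov product -/

theorem expGromov_nonneg (p : X) (κ : ℝ) (x y : GromovBoundary X) : 0 ≤ expGromov p κ x y := by
  unfold expGromov; split_ifs <;> positivity

theorem expGromov_comm (p : X) (κ : ℝ) (x y : GromovBoundary X) :
    expGromov p κ x y = expGromov p κ y x := by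
  unfold expGromov; rw [boundaryGromovProduct_comm]

theorem expGromov_le {κ : ℝ} (hκ : 0 ≤ κ) {x y : GromovBoundary X} {T : ℝ}
    (h : ENNReal.ofReal T ≤ boundaryGromovProduct p x y) :
    expGromov p κ x y ≤ Real.exp (-κ * T) := by
  unfold expGromov
  split_ifs with ht
  · positivity
  · refine Real.exp_le_exp.2 ?_
    rw [neg_mul, neg_mul]
    exact neg_le_neg (mul_le_mul_of_nonneg_left ((ENNReal.ofReal_le_iff_le_toReal ht).1 h) hκ)

theorem expGromov_le_one {κ : ℝ} (hκ : 0 ≤ κ) (x y : GromovBoundary X) :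
    expGromov p κ x y ≤ 1 := by
  simpa using expGromov_le (p := p) (x := x) (y := y) hκ (T := 0) (by simp)

/-- A bound that holds at all times below the Gromov product. -/
theorem le_expGromov_rpow {κ : ℝ} (hκ : 0 < κ) {x y : GromovBoundary X}
    (hxy : boundaryGromovProduct p x y ≠ ⊤) {A α : ℝ}
    (hA : ∀ T : ℝ≥0, (T : ℝ≥0∞) < boundaryGromovProduct p x y → A ≤ Real.exp (-α * T))
    (hA1 : A ≤ 1) (hα : 0 ≤ α) : A ≤ Real.exp α * expGromov p κ x y ^ (α / κ) := by
  set m := (boundaryGromovProduct p x y).toReal with hm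
  have e1 : Real.exp α * expGromov p κ x y ^ (α / κ) = Real.exp (-α * (m - 1)) := by
    unfold expGromov
    rw [if_neg hxy, ← hm, ← Real.exp_mul, ← Real.exp_add]
    congr 1
    field_simp
    ring
  rw [e1]
  -- The hypothesis needs a time strictly below the product; time `m - 1` is used, and the lost unit
  -- is the factor `Real.exp α`.
  by_cases h1 : m < 1
  · exact hA1.trans (Real.one_le_exp (by nlinarith))
  · push Not at h1
    let T : ℝ≥0 := ⟨m - 1, by linarith⟩
    exact hA T (by
      rw [← ENNReal.toReal_lt_toReal ENNReal.coe_ne_top hxy]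
      change m - 1 < m
      linarith)

/-- At time `T` the ray to `y` is close to the rays to `x` and to `z`, so these are close to each
other. -/
theorem IsDeltaHyperbolic.le_boundaryGromovProduct (h : IsDeltaHyperbolic X δ) (hδ : 0 ≤ δ)
    {x y z : GromovBoundary X} {T : ℝ≥0} (hxy : (T : ℝ≥0∞) < boundaryGromovProduct p x y)
    (hyz : (T : ℝ≥0∞) < boundaryGromovProduct p y z) :
    ENNReal.ofReal (T - (12 * (3 * δ + 2) + 4)) ≤ boundaryGromovProduct p x z := by
  obtain ⟨a, ha, rfl⟩ := h.exists_ray hδ p x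
  obtain ⟨b, hb, rfl⟩ := h.exists_ray hδ p y
  obtain ⟨c, hc, rfl⟩ := h.exists_ray hδ p z
  have h4 := h.fourPoint hδ
  have hδ' : 0 ≤ 3 * δ + 2 := by positivity
  have h1 := h4.dist_le_of_lt hδ' ha hb hxy
  have h2 := h4.dist_le_of_lt hδ' hb hc hyz
  have := ofReal_le_boundaryGromovProduct ha hc
    ((dist_triangle (a.1 T) (b.1 T) (c.1 T)).trans (add_le_add h1 h2))
  convert this using 2
  ring

theorem IsDeltaHyperbolic.boundaryGromovProduct_eq_top_iff (h : IsDeltaHyperbolic X δ)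
    (hδ : 0 ≤ δ) {x y : GromovBoundary X} : boundaryGromovProduct p x y = ⊤ ↔ x = y := by
  obtain ⟨a, ha, rfl⟩ := h.exists_ray hδ p x
  obtain ⟨b, hb, rfl⟩ := h.exists_ray hδ p y
  refine ⟨(h.fourPoint hδ).eq_of_boundaryGromovProduct_eq_top (by positivity) ha hb, fun e => ?_⟩
  rw [← e]
  exact boundaryGromovProduct_self p ha

theorem IsDeltaHyperbolic.expGromov_eq_zero_iff (h : IsDeltaHyperbolic X δ)
    (hδ : 0 ≤ δ) {κ : ℝ} {x y : GromovBoundary X} : expGromov p κ x y = 0 ↔ x = y := by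
  rw [← h.boundaryGromovProduct_eq_top_iff hδ (p := p)]
  unfold expGromov
  split_ifs with ht
  · simp [ht]
  · simp [ht, Real.exp_ne_zero]

/-- The constant of the ultrametric inequality for the Gromov product on the boundary. -/
def ultraConst (δ : ℝ) : ℝ := 12 * (3 * δ + 2) + 5

theorem ultraConst_pos (hδ : 0 ≤ δ) : 0 < ultraConst δ := by unfold ultraConst; positivity

theorem IsDeltaHyperbolic.expGromov_le_max (h : IsDeltaHyperbolic X δ) (hδ : 0 ≤ δ) {κ : ℝ}
    (hκ : 0 ≤ κ) (x y z : GromovBoundary X) :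
    expGromov p κ x z ≤ Real.exp (κ * ultraConst δ) *
      max (expGromov p κ x y) (expGromov p κ y z) := by
  have hone : 1 ≤ Real.exp (κ * ultraConst δ) :=
    Real.one_le_exp (mul_nonneg hκ (ultraConst_pos hδ).le)
  have hmax : 0 ≤ max (expGromov p κ x y) (expGromov p κ y z) :=
    le_max_of_le_left (expGromov_nonneg _ _ _ _)
  by_cases hxy : boundaryGromovProduct p x y = ⊤
  · obtain rfl := (h.boundaryGromovProduct_eq_top_iff hδ).1 hxy
    exact (le_max_right _ _).trans (le_mul_of_one_le_left hmax hone)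
  by_cases hyz : boundaryGromovProduct p y z = ⊤
  · obtain rfl := (h.boundaryGromovProduct_eq_top_iff hδ).1 hyz
    exact (le_max_left _ _).trans (le_mul_of_one_le_left hmax hone)
  set m := min (boundaryGromovProduct p x y).toReal (boundaryGromovProduct p y z).toReal with hm
  have e1 : Real.exp (-κ * m) ≤ max (expGromov p κ x y) (expGromov p κ y z) := by
    unfold expGromov
    rw [if_neg hxy, if_neg hyz]
    rcases min_choice (boundaryGromovProduct p x y).toReal
      (boundaryGromovProduct p y z).toReal with e | e
    · rw [hm, e]; exact le_max_left _ _
    · rw [hm, e]; exact le_max_right _ _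
  refine le_trans ?_ (mul_le_mul_of_nonneg_left e1 (Real.exp_nonneg _))
  rw [← Real.exp_add, show κ * ultraConst δ + -κ * m = -κ * (m - ultraConst δ) by ring]
  by_cases h1 : m < 1
  · refine (expGromov_le_one hκ x z).trans (Real.one_le_exp ?_)
    unfold ultraConst
    nlinarith
  · push Not at h1
    let T : ℝ≥0 := ⟨m - 1, by linarith⟩
    have hT : (T : ℝ) = m - 1 := rfl
    refine expGromov_le hκ ?_
    have := h.le_boundaryGromovProduct hδ (p := p) (x := x) (y := y) (z := z) (T := T)
      (by rw [← ENNReal.toReal_lt_toReal ENNReal.coe_ne_top hxy]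
          change m - 1 < _
          linarith [min_le_left (boundaryGromovProduct p x y).toReal
            (boundaryGromovProduct p y z).toReal])
      (by rw [← ENNReal.toReal_lt_toReal ENNReal.coe_ne_top hyz]
          change m - 1 < _
          linarith [min_le_right (boundaryGromovProduct p x y).toReal
            (boundaryGromovProduct p y z).toReal])
    convert this using 2
    rw [hT]; unfold ultraConst; ring

/-! ### Visual metrics -/

theorem bddBelow_chainSums (p : X) (κ : ℝ) (x y : GromovBoundary X) :
    BddBelow {r | ∃ (n : ℕ) (c : ℕ → GromovBoundary X), c 0 = x ∧ c n = y ∧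
      r = ∑ i ∈ Finset.range n, expGromov p κ (c i) (c (i + 1))} :=
  ⟨0, by
    rintro r ⟨n, c, -, -, rfl⟩
    exact Finset.sum_nonneg fun i _ => expGromov_nonneg _ _ _ _⟩

theorem chainDist_le (p : X) (κ : ℝ) {n : ℕ} (c : ℕ → GromovBoundary X) :
    chainDist p κ (c 0) (c n) ≤ ∑ i ∈ Finset.range n, expGromov p κ (c i) (c (i + 1)) :=
  csInf_le (bddBelow_chainSums p κ _ _) ⟨n, c, rfl, rfl, rfl⟩

theorem chainDist_le_expGromov (p : X) (κ : ℝ) (x y : GromovBoundary X) :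
    chainDist p κ x y ≤ expGromov p κ x y := by
  simpa using chainDist_le p κ (n := 1) (fun i => if i = 0 then x else y)

theorem le_chainDist {p : X} {κ : ℝ} {x y : GromovBoundary X} {r : ℝ}
    (h : ∀ (n : ℕ) (c : ℕ → GromovBoundary X), c 0 = x → c n = y →
      r ≤ ∑ i ∈ Finset.range n, expGromov p κ (c i) (c (i + 1))) : r ≤ chainDist p κ x y :=
  le_csInf ⟨_, 1, fun i => if i = 0 then x else y, by simp, by simp, rfl⟩
    (by rintro _ ⟨n, c, h0, h1, rfl⟩; exact h n c h0 h1)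

theorem chainDist_comm_le (p : X) (κ : ℝ) (x y : GromovBoundary X) :
    chainDist p κ y x ≤ chainDist p κ x y := by
  refine le_chainDist fun n c h0 h1 => ?_
  have := chainDist_le p κ (n := n) (fun i => c (n - i))
  simp only [tsub_zero, tsub_self, h0, h1] at this
  refine this.trans (le_of_eq ?_)
  rw [← Finset.sum_range_reflect]
  refine Finset.sum_congr rfl fun i hi => ?_
  rw [Finset.mem_range] at hi
  rw [expGromov_comm]
  congr 2 <;> omega

theorem chainDist_triangle (p : X) (κ : ℝ) (x y z : GromovBoundary X) :
    chainDist p κ x z ≤ chainDist p κ x y + chainDist p κ y z := by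
  rw [← sub_le_iff_le_add]
  refine le_chainDist fun n c h0 h1 => ?_
  rw [sub_le_comm]
  refine le_chainDist fun m e h2 h3 => ?_
  rw [sub_le_iff_le_add']
  have := chainDist_le p κ (n := n + m) (fun i => if i ≤ n then c i else e (i - n))
  rw [Finset.sum_range_add] at this
  have e1 : (if n + m ≤ n then c (n + m) else e (n + m - n)) = z := by
    split_ifs with hm
    · have : m = 0 := by omega
      subst this
      rw [add_zero, h1, ← h2, h3]
    · rw [Nat.add_sub_cancel_left, h3]
  simp only [e1, zero_le, if_true, h0] at this
  refine this.trans (add_le_add (le_of_eq ?_) (le_of_eq ?_))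
  · refine Finset.sum_congr rfl fun i hi => ?_
    rw [Finset.mem_range] at hi
    rw [if_pos hi.le, if_pos (by omega)]
  · refine Finset.sum_congr rfl fun i hi => ?_
    rw [if_neg (show ¬ n + i + 1 ≤ n by omega), show n + i + 1 - n = i + 1 by omega]
    split_ifs with hi'
    · obtain rfl : i = 0 := by omega
      rw [add_zero, h1, h2]
    · rw [Nat.add_sub_cancel_left]

/-- Frink's chain lemma: a symmetric function whose value over three steps is at most twice the
maximum of the steps is at most twice its chain pseudometric. The bound on `κ` makes the square of
the ultrametric constant at most two. -/
theorem IsDeltaHyperbolic.expGromov_le_chainDist (h : IsDeltaHyperbolic X δ) (hδ : 0 ≤ δ) {κ : ℝ}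
    (hκ : 0 ≤ κ) (hκ2 : κ * (2 * ultraConst δ) ≤ Real.log 2) (x y : GromovBoundary X) :
    expGromov p κ x y ≤ 2 * chainDist p κ x y := by
  let D : GromovBoundary X → GromovBoundary X → ℝ≥0 :=
    fun x y => ⟨expGromov p κ x y, expGromov_nonneg _ _ _ _⟩
  have hself : ∀ x, D x x = 0 := fun x =>
    NNReal.eq ((h.expGromov_eq_zero_iff hδ).2 rfl)
  have hcomm : ∀ x y, D x y = D y x := fun x y => NNReal.eq (expGromov_comm _ _ _ _)
  have h2 : Real.exp (κ * ultraConst δ) * Real.exp (κ * ultraConst δ) ≤ 2 := by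
    rw [← Real.exp_add, ← Real.le_log_iff_exp_le (by norm_num)]
    linarith
  have h1 : 1 ≤ Real.exp (κ * ultraConst δ) :=
    Real.one_le_exp (mul_nonneg hκ (ultraConst_pos hδ).le)
  let inst : PseudoMetricSpace (GromovBoundary X) :=
    PseudoMetricSpace.ofPreNNDist D hself hcomm
  have hle : ∀ x y, D x y ≤ 2 * nndist x y := by
    intro x y
    have := PseudoMetricSpace.le_two_mul_dist_ofPreNNDist D hself hcomm (fun a b c d => by
      rw [← NNReal.coe_le_coe]
      push_cast
      change expGromov p κ a d ≤ 2 * max (expGromov p κ a b)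
        (max (expGromov p κ b c) (expGromov p κ c d))
      have k1 := h.expGromov_le_max hδ hκ (p := p) a b d
      have k2 := h.expGromov_le_max hδ hκ (p := p) b c d
      set E := Real.exp (κ * ultraConst δ)
      set M := max (expGromov p κ b c) (expGromov p κ c d)
      have hM : 0 ≤ max (expGromov p κ a b) M := le_max_of_le_left (expGromov_nonneg _ _ _ _)
      have k3 : max (expGromov p κ a b) (expGromov p κ b d) ≤ E * max (expGromov p κ a b) M := by
        refine max_le ((le_max_left _ _).trans (le_mul_of_one_le_left hM h1)) (k2.trans ?_)
        exact mul_le_mul_of_nonneg_left (le_max_right _ _) (by positivity)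
      calc expGromov p κ a d ≤ E * (E * max (expGromov p κ a b) M) :=
            k1.trans (mul_le_mul_of_nonneg_left k3 (by positivity))
        _ = (E * E) * max (expGromov p κ a b) M := by ring
        _ ≤ 2 * max (expGromov p κ a b) M := mul_le_mul_of_nonneg_right h2 hM) x y
    rw [← NNReal.coe_le_coe]
    exact this
  have hle' : expGromov p κ x y ≤ 2 * dist x y := hle x y
  have hge : dist x y ≤ chainDist p κ x y := by
    refine le_chainDist fun n c h0 h1 => ?_
    rw [← h0, ← h1]
    refine (dist_le_range_sum_dist c n).trans (Finset.sum_le_sum fun i _ => ?_)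
    exact PseudoMetricSpace.dist_ofPreNNDist_le D hself hcomm _ _
  linarith

theorem IsDeltaHyperbolic.exists_isVisualMetric (h : IsDeltaHyperbolic X δ) (hδ : 0 ≤ δ) (p : X) :
    ∃ κ₀ : ℝ, 0 < κ₀ ∧ ∀ κ : ℝ, 0 < κ → κ ≤ κ₀ → IsVisualMetric p κ (chainDist p κ) := by
  have hc : 0 < 2 * ultraConst δ := by linarith [ultraConst_pos hδ]
  refine ⟨Real.log 2 / (2 * ultraConst δ), div_pos (Real.log_pos (by norm_num)) hc,
    fun κ hκ hκ0 => ?_⟩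
  have hle := h.expGromov_le_chainDist hδ (p := p) hκ.le ((le_div_iff₀ hc).1 hκ0)
  have hle' := chainDist_le_expGromov p κ
  refine ⟨hκ, fun x y => ⟨fun h0 => ?_, fun h0 => ?_⟩,
    fun x y => le_antisymm (chainDist_comm_le _ _ _ _) (chainDist_comm_le _ _ _ _),
    chainDist_triangle p κ, 1 / 2, 1, by norm_num, one_pos, fun x y => ⟨?_, ?_⟩⟩
  · refine (h.expGromov_eq_zero_iff hδ (p := p) (κ := κ)).1
      (le_antisymm ?_ (expGromov_nonneg _ _ _ _))
    linarith [hle x y]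
  · have h1 := (h.expGromov_eq_zero_iff hδ (p := p) (κ := κ)).2 h0
    linarith [hle x y, hle' x y]
  · linarith [hle x y]
  · linarith [hle' x y]

/-! ### The topology of the boundary -/

theorem ConvergesTo.tendsto {u : ℕ → GromovBoundary X} {x : GromovBoundary X}
    (h : ConvergesTo p (fun n => Sum.inr (u n)) (Sum.inr x)) :
    Tendsto u atTop (@nhds _ (boundaryTopology p) x) := by
  let := boundaryTopology p
  rw [tendsto_nhds]
  intro U hU hx
  by_contra hcon
  obtain ⟨φ, hφ, hφ'⟩ := extraction_of_frequently_atTop (not_eventually.1 hcon)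
  exact hU (u ∘ φ) x hφ' (h.subseq hφ) hx

theorem IsDeltaHyperbolic.tendsto_visual (h : IsDeltaHyperbolic X δ) (hδ : 0 ≤ δ) {κ : ℝ}
    {dv : GromovBoundary X → GromovBoundary X → ℝ} (hv : IsVisualMetric p κ dv)
    {u : ℕ → GromovBoundary X} {x : GromovBoundary X}
    (hu : ConvergesTo p (fun n => Sum.inr (u n)) (Sum.inr x)) :
    Tendsto (fun n => dv (u n) x) atTop (𝓝 0) := by
  obtain ⟨c₁, c₂, hc₁, hc₂, hle⟩ := hv.comparable
  choose a ha hau using fun n => h.exists_ray hδ p (u n)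
  obtain ⟨c, hc, rfl⟩ := h.exists_ray hδ p x
  have h4 := h.fourPoint hδ
  have hlim : Tendsto (fun T : ℝ≥0 => c₂ * Real.exp (-κ * (T - (8 * (3 * δ + 2) + 1) / 2)))
      atTop (𝓝 0) := by
    rw [← mul_zero c₂]
    refine Tendsto.const_mul _ (Real.tendsto_exp_atBot.comp ?_)
    refine (tendsto_const_mul_atBot_of_neg (neg_lt_zero.2 hv.pos)).2 ?_
    exact tendsto_atTop_add_const_right _ _ (NNReal.tendsto_coe_atTop.2 tendsto_id)
  have hnn : ∀ x y, 0 ≤ dv x y := fun x y =>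
    (mul_nonneg hc₁.le (expGromov_nonneg p κ x y)).trans (hle x y).1
  refine tendsto_order.2 ⟨fun r hr => Eventually.of_forall fun n => hr.trans_le (hnn _ _),
    fun r hr => ?_⟩
  obtain ⟨T, hT⟩ := ((tendsto_order.1 hlim).2 r hr).exists
  have hu' : ConvergesTo p (fun n => Sum.inr (a n).endpoint) (Sum.inr c.endpoint) := by
    simpa only [hau] using hu
  filter_upwards [h4.eventually_dist_le (by positivity) ha hc hu' T] with n hn
  refine lt_of_le_of_lt ((hle _ _).2.trans (mul_le_mul_of_nonneg_left ?_ hc₂.le)) hT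
  have := ofReal_le_boundaryGromovProduct (ha n) hc hn
  rw [hau] at this
  exact expGromov_le hv.pos.le this

/-- Closed sets of the boundary are defined by sequences, so openness of a ball is tested on
sequences outside it. Later arguments need only that `dv` is continuous in this topology, not that
it induces it. -/
theorem IsDeltaHyperbolic.visual_ball_mem_nhds (h : IsDeltaHyperbolic X δ) (hδ : 0 ≤ δ) {κ : ℝ}
    {dv : GromovBoundary X → GromovBoundary X → ℝ} (hv : IsVisualMetric p κ dv)
    (x : GromovBoundary X) {r : ℝ} (hr : 0 < r) :
    {x' | dv x x' < r} ∈ @nhds _ (boundaryTopology p) x := by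
  let := boundaryTopology p
  refine IsOpen.mem_nhds ?_ (show dv x x < r by rwa [(hv.eq_zero_iff x x).2 rfl])
  intro u y hu hy
  change ¬ dv x y < r
  rw [not_lt]
  have hlim := h.tendsto_visual hδ hv hy
  have h0 : ∀ n, r - dv (u n) y ≤ dv x y := fun n => by
    have h1 : r ≤ dv x (u n) := not_lt.1 (hu n)
    linarith [hv.triangle x y (u n), hv.symm y (u n)]
  have := hlim.const_sub r
  rw [sub_zero] at this
  exact le_of_tendsto' this h0

theorem IsDeltaHyperbolic.continuous_visual (h : IsDeltaHyperbolic X δ) (hδ : 0 ≤ δ) {κ : ℝ}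
    {dv : GromovBoundary X → GromovBoundary X → ℝ} (hv : IsVisualMetric p κ dv) :
    let := boundaryTopology p
    Continuous fun q : GromovBoundary X × GromovBoundary X => dv q.1 q.2 := by
  intro top
  rw [continuous_iff_continuousAt]
  rintro ⟨x, y⟩
  rw [ContinuousAt, Metric.tendsto_nhds]
  intro r hr
  have h1 := h.visual_ball_mem_nhds hδ hv x (half_pos hr)
  have h2 := h.visual_ball_mem_nhds hδ hv y (half_pos hr)
  filter_upwards [prod_mem_nhds h1 h2] with q hq
  obtain ⟨hq1, hq2⟩ : dv x q.1 < r / 2 ∧ dv y q.2 < r / 2 := hq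
  rw [Real.dist_eq, abs_lt]
  constructor
  · linarith [hv.triangle x q.1 y, hv.triangle q.1 q.2 y, hv.symm q.2 y]
  · linarith [hv.triangle q.1 x q.2, hv.triangle x y q.2, hv.symm q.1 x]

end BoundaryProduct

/-! ### Singular value decompositions -/

section SingularValues

open Module

variable {d : ℕ}

theorem euclideanMap_mul (A B : GL (Fin d) ℝ) (v : EuclideanSpace ℝ (Fin d)) :
    euclideanMap (A * B) v = euclideanMap A (euclideanMap B v) := by
  simp [euclideanMap, Matrix.toLpLin_apply]

theorem euclideanMap_one (v : EuclideanSpace ℝ (Fin d)) : euclideanMap 1 v = v := by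
  simp [euclideanMap]

theorem euclideanMap_inv_apply (A : GL (Fin d) ℝ) (v : EuclideanSpace ℝ (Fin d)) :
    euclideanMap A⁻¹ (euclideanMap A v) = v := by
  rw [← euclideanMap_mul, inv_mul_cancel, euclideanMap_one]

theorem euclideanMap_apply_inv (A : GL (Fin d) ℝ) (v : EuclideanSpace ℝ (Fin d)) :
    euclideanMap A (euclideanMap A⁻¹ v) = v := by
  rw [← euclideanMap_mul, mul_inv_cancel, euclideanMap_one]

theorem euclideanMap_injective (A : GL (Fin d) ℝ) : Function.Injective (euclideanMap A) :=
  Function.LeftInverse.injective (euclideanMap_inv_apply A)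

theorem finrank_map_euclideanMap (A : GL (Fin d) ℝ) (V : Submodule ℝ (EuclideanSpace ℝ (Fin d))) :
    finrank ℝ (V.map (euclideanMap A)) = finrank ℝ V :=
  (V.equivMapOfInjective _ (euclideanMap_injective A)).finrank_eq.symm

theorem sigma_pos (A : GL (Fin d) ℝ) {i : ℕ} (h : i < d) : 0 < sigma (i + 1) A :=
  (LinearMap.injective_iff_forall_lt_finrank_singularValues_pos _).1 (euclideanMap_injective A) i
    (by rwa [finrank_euclideanSpace_fin])

theorem sigma_nonneg (A : GL (Fin d) ℝ) (i : ℕ) : 0 ≤ sigma i A :=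
  LinearMap.singularValues_nonneg _ _

theorem sigma_antitone (A : GL (Fin d) ℝ) {i j : ℕ} (h : i ≤ j) : sigma j A ≤ sigma i A :=
  LinearMap.singularValues_antitone _ (Nat.sub_le_sub_right h 1)

/-- The bases `a` and `u` diagonalize `A`. -/
def IsSVD (A : GL (Fin d) ℝ) (a u : OrthonormalBasis (Fin d) ℝ (EuclideanSpace ℝ (Fin d))) :
    Prop :=
  ∀ i, euclideanMap A (a i) = sigma (i + 1) A • u i

/-- Eigenvectors of `A* A` have orthogonal images whose norms are the singular values. These are
positive since `A` is invertible, so the images can be normalized. -/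
theorem exists_isSVD (A : GL (Fin d) ℝ) : ∃ a u, IsSVD A a u := by
  have hn : finrank ℝ (EuclideanSpace ℝ (Fin d)) = d := finrank_euclideanSpace_fin
  set T := euclideanMap A with hT
  have hs := T.isSymmetric_adjoint_comp_self
  set a := hs.eigenvectorBasis hn with ha
  have hpos : ∀ i : Fin d, 0 < sigma (i + 1) A := fun i => sigma_pos A i.2
  have horth : ∀ i j, inner ℝ (T (a i)) (T (a j)) = if i = j then sigma (i + 1) A ^ 2 else 0 := by
    intro i j
    rw [← LinearMap.adjoint_inner_left]
    have h1 : LinearMap.adjoint T (T (a i)) = sigma (i + 1) A ^ 2 • a i := by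
      have := hs.apply_eigenvectorBasis hn i
      rw [← T.sq_singularValues_fin hn i] at this
      exact this
    rw [h1, inner_smul_left, a.inner_eq_ite]
    split_ifs <;> simp
  have hon : Orthonormal ℝ fun i : Fin d => (sigma (i + 1) A)⁻¹ • T (a i) := by
    rw [orthonormal_iff_ite]
    intro i j
    rw [inner_smul_left, inner_smul_right, horth]
    split_ifs with hij
    · subst hij
      have := (hpos i).ne'
      simp only [conj_trivial]
      field_simp
    · simp
  refine ⟨a, OrthonormalBasis.mk hon
    (hon.linearIndependent.span_eq_top_of_card_eq_finrank' (by simp)).ge, fun i => ?_⟩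
  rw [OrthonormalBasis.coe_mk, smul_smul, mul_inv_cancel₀ (hpos i).ne', one_smul]

/-- The orthonormal basis of right singular vectors. -/
def rightBasis (A : GL (Fin d) ℝ) : OrthonormalBasis (Fin d) ℝ (EuclideanSpace ℝ (Fin d)) :=
  (exists_isSVD A).choose

/-- The orthonormal basis of left singular vectors. -/
def leftBasis (A : GL (Fin d) ℝ) : OrthonormalBasis (Fin d) ℝ (EuclideanSpace ℝ (Fin d)) :=
  (exists_isSVD A).choose_spec.choose

theorem euclideanMap_rightBasis (A : GL (Fin d) ℝ) (i : Fin d) :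
    euclideanMap A (rightBasis A i) = sigma (i + 1) A • leftBasis A i :=
  (exists_isSVD A).choose_spec.choose_spec i

theorem inner_leftBasis (A : GL (Fin d) ℝ) (i : Fin d) (v : EuclideanSpace ℝ (Fin d)) :
    inner ℝ (leftBasis A i) (euclideanMap A v) = sigma (i + 1) A * inner ℝ (rightBasis A i) v := by
  conv_lhs => rw [← (rightBasis A).sum_repr' v]
  rw [map_sum, inner_sum, Finset.sum_eq_single i]
  · rw [map_smul, euclideanMap_rightBasis, inner_smul_right, inner_smul_right,
      (leftBasis A).inner_eq_one]
    ring
  · intro j _ hj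
    rw [map_smul, euclideanMap_rightBasis, inner_smul_right, inner_smul_right,
      (leftBasis A).inner_eq_zero hj.symm]
    simp
  · simp

/-- The span of the basis vectors whose index satisfies `I`. -/
def coordSpace (u : OrthonormalBasis (Fin d) ℝ (EuclideanSpace ℝ (Fin d))) (I : Set (Fin d)) :
    Submodule ℝ (EuclideanSpace ℝ (Fin d)) := Submodule.span ℝ (u '' I)

variable (u : OrthonormalBasis (Fin d) ℝ (EuclideanSpace ℝ (Fin d)))

theorem mem_coordSpace {I : Set (Fin d)} {v : EuclideanSpace ℝ (Fin d)} :
    v ∈ coordSpace u I ↔ ∀ i ∉ I, inner ℝ (u i) v = 0 := by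
  constructor
  · intro hv i hi
    induction hv using Submodule.span_induction with
    | mem x hx =>
      obtain ⟨j, hj, rfl⟩ := hx
      exact u.inner_eq_zero (fun h => hi (h ▸ hj))
    | zero => simp
    | add x y _ _ hx hy => rw [inner_add_right, hx, hy, add_zero]
    | smul c x _ hx => rw [inner_smul_right, hx, mul_zero]
  · intro h
    rw [← u.sum_repr' v]
    refine Submodule.sum_mem _ fun i _ => ?_
    by_cases hi : i ∈ I
    · exact Submodule.smul_mem _ _ (Submodule.subset_span ⟨i, hi, rfl⟩)
    · rw [h i hi, zero_smul]; exact Submodule.zero_mem _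

theorem finrank_coordSpace (I : Set (Fin d)) : finrank ℝ (coordSpace u I) = I.ncard := by
  classical
  have hli : LinearIndependent ℝ fun i : I => u i :=
    u.orthonormal.linearIndependent.comp _ Subtype.val_injective
  have := finrank_span_eq_card hli
  rw [show Set.range (fun i : I => u i) = u '' I by ext; simp] at this
  rw [coordSpace, this, ← Nat.card_eq_fintype_card]
  rfl

theorem sq_norm_eq_sum (v : EuclideanSpace ℝ (Fin d)) : ‖v‖ ^ 2 = ∑ i, inner ℝ (u i) v ^ 2 := by
  rw [← u.sum_sq_norm_inner_right]
  simp

theorem norm_le_of_inner_le {u' : OrthonormalBasis (Fin d) ℝ (EuclideanSpace ℝ (Fin d))}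
    {v w : EuclideanSpace ℝ (Fin d)}
    (h : ∀ i, |inner ℝ (u i) v| ≤ |inner ℝ (u' i) w|) : ‖v‖ ≤ ‖w‖ := by
  rw [← sq_le_sq₀ (norm_nonneg _) (norm_nonneg _), sq_norm_eq_sum u, sq_norm_eq_sum u']
  exact Finset.sum_le_sum fun i _ => sq_le_sq.2 (h i)

/-- Singular values from below. -/
theorem le_norm_euclideanMap {A : GL (Fin d) ℝ} {j : ℕ} {v : EuclideanSpace ℝ (Fin d)}
    (hv : v ∈ coordSpace (rightBasis A) {i | i.1 < j}) : sigma j A * ‖v‖ ≤ ‖euclideanMap A v‖ := by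
  have h0 := sigma_nonneg A j
  rw [← Real.norm_of_nonneg h0, ← norm_smul]
  refine norm_le_of_inner_le (rightBasis A) (u' := leftBasis A) fun i => ?_
  rw [inner_leftBasis, inner_smul_right, abs_mul, abs_mul, abs_of_nonneg h0,
    abs_of_nonneg (sigma_nonneg A _)]
  by_cases hi : i.1 < j
  · exact mul_le_mul_of_nonneg_right (sigma_antitone A hi) (abs_nonneg _)
  · rw [(mem_coordSpace _).1 hv i hi]; simp

/-- Singular values from above. -/
theorem norm_euclideanMap_le_of_mem {A : GL (Fin d) ℝ} {j : ℕ} {v : EuclideanSpace ℝ (Fin d)}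
    (hv : v ∈ coordSpace (rightBasis A) {i | j ≤ i.1}) :
    ‖euclideanMap A v‖ ≤ sigma (j + 1) A * ‖v‖ := by
  have h0 := sigma_nonneg A (j + 1)
  rw [← Real.norm_of_nonneg h0, ← norm_smul]
  refine norm_le_of_inner_le (leftBasis A) (u' := rightBasis A) fun i => ?_
  rw [inner_leftBasis, inner_smul_right, abs_mul, abs_mul, abs_of_nonneg h0,
    abs_of_nonneg (sigma_nonneg A _)]
  by_cases hi : j ≤ i.1
  · exact mul_le_mul_of_nonneg_right (sigma_antitone A (by omega)) (abs_nonneg _)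
  · rw [(mem_coordSpace _).1 hv i hi]; simp

theorem norm_euclideanMap_le (A : GL (Fin d) ℝ) (v : EuclideanSpace ℝ (Fin d)) :
    ‖euclideanMap A v‖ ≤ sigma 1 A * ‖v‖ :=
  norm_euclideanMap_le_of_mem (j := 0) ((mem_coordSpace _).2 fun _ hi => (hi (Nat.zero_le _)).elim)

theorem ncard_fin_lt {j : ℕ} (h : j ≤ d) : {i : Fin d | i.1 < j}.ncard = j := by
  rw [Set.ncard_eq_toFinset_card']
  simp [Fin.card_filter_val_lt, h]

theorem ncard_fin_le (j : ℕ) : {i : Fin d | j ≤ i.1}.ncard = d - j := by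
  rw [show {i : Fin d | j ≤ i.1} = {i : Fin d | i.1 < j}ᶜ by ext i; simp, Set.ncard_compl,
    Nat.card_eq_fintype_card, Fintype.card_fin]
  rcases le_total j d with h | h
  · rw [ncard_fin_lt h]
  · rw [show {i : Fin d | i.1 < j} = Set.univ by ext i; simp; omega, Set.ncard_univ]
    simp [h]

theorem exists_mem_inf {V W : Submodule ℝ (EuclideanSpace ℝ (Fin d))}
    (h : d < finrank ℝ V + finrank ℝ W) : ∃ v ∈ V, v ∈ W ∧ v ≠ 0 := by
  have h1 := Submodule.finrank_sup_add_finrank_inf_eq V W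
  have h2 := Submodule.finrank_le (V ⊔ W)
  rw [finrank_euclideanSpace_fin] at h2
  have : V ⊓ W ≠ ⊥ := by
    intro h0
    rw [h0, finrank_bot] at h1
    omega
  obtain ⟨v, hv, h0⟩ := Submodule.exists_mem_ne_zero_of_ne_bot this
  exact ⟨v, hv.1, hv.2, h0⟩

/-- Min-max principle: for dimension reasons `W` meets the span of the first `j + 1` right singular
vectors. Here and in `le_sigma_of_forall` one suitable subspace suffices as a certificate. -/
theorem sigma_le_of_forall {A : GL (Fin d) ℝ} {j : ℕ} (hj : j < d)
    {W : Submodule ℝ (EuclideanSpace ℝ (Fin d))} (hW : d ≤ finrank ℝ W + j) {c : ℝ}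
    (h : ∀ v ∈ W, ‖euclideanMap A v‖ ≤ c * ‖v‖) : sigma (j + 1) A ≤ c := by
  obtain ⟨v, hv, hv', h0⟩ := exists_mem_inf (d := d) (V := W)
    (W := coordSpace (rightBasis A) {i | i.1 < j + 1})
    (by rw [finrank_coordSpace, ncard_fin_lt (by omega)]; omega)
  exact le_of_mul_le_mul_right ((le_norm_euclideanMap hv').trans (h v hv)) (norm_pos_iff.2 h0)

theorem le_sigma_of_forall {A : GL (Fin d) ℝ} {j : ℕ}
    {W : Submodule ℝ (EuclideanSpace ℝ (Fin d))} (hW : j < finrank ℝ W) {c : ℝ}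
    (h : ∀ v ∈ W, c * ‖v‖ ≤ ‖euclideanMap A v‖) : c ≤ sigma (j + 1) A := by
  obtain ⟨v, hv, hv', h0⟩ := exists_mem_inf (d := d) (V := W)
    (W := coordSpace (rightBasis A) {i | j ≤ i.1})
    (by
      have := Submodule.finrank_le W
      rw [finrank_euclideanSpace_fin] at this
      rw [finrank_coordSpace, ncard_fin_le]; omega)
  exact le_of_mul_le_mul_right ((h v hv).trans (norm_euclideanMap_le_of_mem hv'))
    (norm_pos_iff.2 h0)

theorem sigma_mul_le_left (A B : GL (Fin d) ℝ) {j : ℕ} (hj : j < d) :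
    sigma (j + 1) (B * A) ≤ sigma 1 B * sigma (j + 1) A := by
  refine sigma_le_of_forall hj (W := coordSpace (rightBasis A) {i | j ≤ i.1})
    (by rw [finrank_coordSpace, ncard_fin_le]; omega) fun v hv => ?_
  rw [euclideanMap_mul, mul_assoc]
  exact (norm_euclideanMap_le B _).trans
    (mul_le_mul_of_nonneg_left (norm_euclideanMap_le_of_mem hv) (sigma_nonneg _ _))

theorem sigma_mul_le_right (A B : GL (Fin d) ℝ) {j : ℕ} (hj : j < d) :
    sigma (j + 1) (A * B) ≤ sigma (j + 1) A * sigma 1 B := by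
  refine sigma_le_of_forall hj
    (W := (coordSpace (rightBasis A) {i | j ≤ i.1}).map (euclideanMap B⁻¹))
    (by rw [finrank_map_euclideanMap, finrank_coordSpace, ncard_fin_le]; omega) fun v hv => ?_
  obtain ⟨w, hw, rfl⟩ := hv
  rw [euclideanMap_mul, euclideanMap_apply_inv, mul_assoc]
  refine (norm_euclideanMap_le_of_mem hw).trans (mul_le_mul_of_nonneg_left ?_ (sigma_nonneg _ _))
  conv_lhs => rw [← euclideanMap_apply_inv B w]
  exact norm_euclideanMap_le B _

theorem inner_rightBasis (A : GL (Fin d) ℝ) (i : Fin d) (v : EuclideanSpace ℝ (Fin d)) :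
    inner ℝ (rightBasis A i) (euclideanMap A⁻¹ v) = (sigma (i + 1) A)⁻¹ * inner ℝ (leftBasis A i) v := by
  have h0 := (sigma_pos A i.2).ne'
  have := inner_leftBasis A i (euclideanMap A⁻¹ v)
  rw [euclideanMap_apply_inv] at this
  rw [this]
  field_simp

/-- A vector of a top singular space has a small preimage. -/
theorem norm_euclideanMap_inv_le {A : GL (Fin d) ℝ} {j : ℕ} (hj : j < d)
    {v : EuclideanSpace ℝ (Fin d)} (hv : v ∈ coordSpace (leftBasis A) {i | i.1 < j + 1}) :
    ‖euclideanMap A⁻¹ v‖ ≤ (sigma (j + 1) A)⁻¹ * ‖v‖ := by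
  have h0 : 0 ≤ (sigma (j + 1) A)⁻¹ := inv_nonneg.2 (sigma_nonneg A (j + 1))
  rw [← Real.norm_of_nonneg h0, ← norm_smul]
  refine norm_le_of_inner_le (rightBasis A) (u' := leftBasis A) fun i => ?_
  rw [inner_rightBasis, inner_smul_right, abs_mul, abs_mul, abs_of_nonneg h0,
    abs_of_nonneg (inv_nonneg.2 (sigma_nonneg A _))]
  by_cases hi : i.1 < j + 1
  · exact mul_le_mul_of_nonneg_right
      (inv_anti₀ (sigma_pos A hj) (sigma_antitone A (by omega))) (abs_nonneg _)
  · rw [(mem_coordSpace _).1 hv i hi]; simp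

theorem sigma_inv_le (A : GL (Fin d) ℝ) {j : ℕ} (hj : j < d) :
    sigma (d - j) A⁻¹ ≤ (sigma (j + 1) A)⁻¹ := by
  have := sigma_le_of_forall (A := A⁻¹) (j := d - j - 1) (by omega)
    (W := coordSpace (leftBasis A) {i | i.1 < j + 1})
    (by rw [finrank_coordSpace, ncard_fin_lt (by omega)]; omega)
    (fun v hv => norm_euclideanMap_inv_le hj hv)
  rwa [show d - j - 1 + 1 = d - j by omega] at this

theorem sigma_inv (A : GL (Fin d) ℝ) {j : ℕ} (hj : j < d) :
    sigma (d - j) A⁻¹ = (sigma (j + 1) A)⁻¹ := by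
  refine le_antisymm (sigma_inv_le A hj) ?_
  have h1 := sigma_pos A hj
  have := le_sigma_of_forall (A := A⁻¹) (j := d - j - 1) (c := (sigma (j + 1) A)⁻¹)
    (W := (coordSpace (rightBasis A) {i | j ≤ i.1}).map (euclideanMap A))
    (by rw [finrank_map_euclideanMap, finrank_coordSpace, ncard_fin_le]; omega) (by
      rintro _ ⟨w, hw, rfl⟩
      rw [euclideanMap_inv_apply, inv_mul_le_iff₀ h1]
      exact norm_euclideanMap_le_of_mem hw)
  rwa [show d - j - 1 + 1 = d - j by omega] at this

end SingularValues

/-! ### Distances of subspaces -/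

section Planes

open Module

variable {d : ℕ} {V W : Submodule ℝ (EuclideanSpace ℝ (Fin d))} {ε ε' : ℝ}

/-- The distance of the orthogonal projections onto two subspaces. -/
def projDist (V W : Submodule ℝ (EuclideanSpace ℝ (Fin d))) : ℝ :=
  ‖V.starProjection - W.starProjection‖

/-- All unit vectors of `V` are `ε`-close to `W`. -/
def NearPlane (ε : ℝ) (V W : Submodule ℝ (EuclideanSpace ℝ (Fin d))) : Prop :=
  ∀ v ∈ V, ‖v - W.starProjection v‖ ≤ ε * ‖v‖

theorem projDist_nonneg (V W : Submodule ℝ (EuclideanSpace ℝ (Fin d))) : 0 ≤ projDist V W :=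
  norm_nonneg _

theorem projDist_self (V : Submodule ℝ (EuclideanSpace ℝ (Fin d))) : projDist V V = 0 := by
  simp [projDist]

theorem projDist_comm (V W : Submodule ℝ (EuclideanSpace ℝ (Fin d))) :
    projDist V W = projDist W V := norm_sub_rev _ _

theorem projDist_triangle (V W U : Submodule ℝ (EuclideanSpace ℝ (Fin d))) :
    projDist V U ≤ projDist V W + projDist W U := by
  unfold projDist
  exact norm_sub_le_norm_sub_add_norm_sub _ _ _

theorem eq_of_projDist_le_zero (h : projDist V W ≤ 0) : V = W := by
  have h0 : V.starProjection = W.starProjection :=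
    sub_eq_zero.1 (norm_le_zero_iff.1 h)
  ext v
  rw [← Submodule.starProjection_eq_self_iff (K := V), h0, Submodule.starProjection_eq_self_iff]

theorem norm_sub_starProjection_le (W : Submodule ℝ (EuclideanSpace ℝ (Fin d)))
    (v : EuclideanSpace ℝ (Fin d)) {w : EuclideanSpace ℝ (Fin d)} (hw : w ∈ W) :
    ‖v - W.starProjection v‖ ≤ ‖v - w‖ := by
  rw [Submodule.starProjection_minimal]
  exact ciInf_le ⟨0, by rintro _ ⟨x, rfl⟩; positivity⟩ (⟨w, hw⟩ : W)

theorem norm_sub_starProjection_le_self (W : Submodule ℝ (EuclideanSpace ℝ (Fin d)))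
    (v : EuclideanSpace ℝ (Fin d)) : ‖v - W.starProjection v‖ ≤ ‖v‖ := by
  simpa using norm_sub_starProjection_le W v W.zero_mem

theorem nearPlane_projDist (V W : Submodule ℝ (EuclideanSpace ℝ (Fin d))) :
    NearPlane (projDist V W) V W := by
  intro v hv
  have := (V.starProjection - W.starProjection).le_opNorm v
  rwa [sub_apply, Submodule.starProjection_eq_self_iff.2 hv] at this

theorem NearPlane.mono (h : NearPlane ε V W) (hε : ε ≤ ε') : NearPlane ε' V W :=
  fun v hv => (h v hv).trans (mul_le_mul_of_nonneg_right hε (norm_nonneg _))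

/-- The part of `x` in `V` is moved by at most `ε`. The part orthogonal to `V` has a short
projection `y` to `W`, because `‖y‖ ^ 2` is the inner product of `x` with the component of `y`
orthogonal to `V`. -/
theorem NearPlane.projDist_le (h : NearPlane ε V W) (h' : NearPlane ε' W V) (h0 : 0 ≤ ε)
    (h0' : 0 ≤ ε') : projDist V W ≤ ε + ε' := by
  refine ContinuousLinearMap.opNorm_le_bound _ (by positivity) fun x => ?_
  set z := x - V.starProjection x
  set y := W.starProjection z with hy
  have hyW : y ∈ W := W.starProjection_apply_mem z
  have e1 : (V.starProjection - W.starProjection) x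
      = (V.starProjection x - W.starProjection (V.starProjection x)) - y := by
    rw [sub_apply, hy, map_sub]
    abel
  have h1 : ‖y‖ ≤ ε' * ‖x‖ := by
    have e2 : ‖y‖ ^ 2 = inner ℝ x (y - V.starProjection y) := by
      have e4 : inner ℝ y y = inner ℝ z y := by
        rw [hy, Submodule.inner_starProjection_left_eq_right, ← hy,
          Submodule.starProjection_eq_self_iff.2 hyW]
      rw [← real_inner_self_eq_norm_sq, e4, inner_sub_right,
        ← V.inner_starProjection_left_eq_right x y, ← inner_sub_left]
    have e3 := (real_inner_le_norm x (y - V.starProjection y)).trans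
      (mul_le_mul_of_nonneg_left (h' y hyW) (norm_nonneg x))
    rw [← e2] at e3
    by_contra hcon
    push Not at hcon
    have : 0 < ‖y‖ := lt_of_le_of_lt (by positivity) hcon
    nlinarith
  rw [e1, add_mul]
  refine (norm_sub_le _ _).trans (add_le_add ?_ h1)
  refine (h _ (V.starProjection_apply_mem x)).trans (mul_le_mul_of_nonneg_left ?_ h0)
  exact V.norm_starProjection_apply_le x

/-- For `ε ≤ 1 / 2` the projection from `V` to `W` is injective, hence onto by equality of
dimensions, and its inverse has norm at most two. For larger `ε` the bound is trivial. -/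
theorem NearPlane.symm (h : NearPlane ε V W) (h0 : 0 ≤ ε) (hd : finrank ℝ V = finrank ℝ W) :
    NearPlane (2 * ε) W V := by
  intro w hw
  by_cases hε : 1 / 2 < ε
  · refine (norm_sub_starProjection_le_self V w).trans ?_
    nlinarith [norm_nonneg w]
  push Not at hε
  have hlow : ∀ v ∈ V, ‖v‖ ≤ 2 * ‖W.starProjection v‖ := by
    intro v hv
    have h1 := h v hv
    have h2 := norm_sub_norm_le v (W.starProjection v)
    nlinarith [norm_nonneg v]
  let f : V →ₗ[ℝ] W := (W.orthogonalProjectionOnto : _ →ₗ[ℝ] W) ∘ₗ V.subtype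
  have hf : ∀ v : V, ((f v : W) : EuclideanSpace ℝ (Fin d)) = W.starProjection v := fun v => rfl
  have hinj : Function.Injective f := by
    rw [injective_iff_map_eq_zero]
    intro v hv
    have h1 := hlow v v.2
    rw [← hf, hv] at h1
    simpa using h1
  obtain ⟨v, hv⟩ := (LinearMap.injective_iff_surjective_of_finrank_eq_finrank hd).1 hinj ⟨w, hw⟩
  have hv' : W.starProjection v = w := by rw [← hf, hv]
  refine (norm_sub_starProjection_le V w v.2).trans ?_
  rw [norm_sub_rev]
  have h1 := h v v.2
  have h2 := hlow v v.2
  rw [hv'] at h1 h2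
  nlinarith

theorem NearPlane.projDist_le_of_finrank_eq (h : NearPlane ε V W) (h0 : 0 ≤ ε)
    (hd : finrank ℝ V = finrank ℝ W) : projDist V W ≤ 3 * ε := by
  have := h.projDist_le (h.symm h0 hd) h0 (by positivity)
  linarith

theorem sq_norm_sub_starProjection (W : Submodule ℝ (EuclideanSpace ℝ (Fin d)))
    (v : EuclideanSpace ℝ (Fin d)) :
    ‖v - W.starProjection v‖ ^ 2 = ‖v‖ ^ 2 - ‖W.starProjection v‖ ^ 2 := by
  have := Submodule.norm_sq_eq_add_norm_sq_starProjection v W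
  rw [Submodule.starProjection_orthogonal_val] at this
  linarith

theorem norm_sub_starProjection_le_sin {v w : EuclideanSpace ℝ (Fin d)} (hv : v ≠ 0) (hw : w ∈ W)
    (hw0 : w ≠ 0) :
    ‖v - W.starProjection v‖ ≤ Real.sin (InnerProductGeometry.angle v w) * ‖v‖ := by
  have hs := InnerProductGeometry.sin_angle_nonneg v w
  rw [← sq_le_sq₀ (norm_nonneg _) (by positivity), sq_norm_sub_starProjection, mul_pow, Real.sin_sq]
  have h1 : Real.cos (InnerProductGeometry.angle v w) * (‖v‖ * ‖w‖) = inner ℝ v w :=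
    InnerProductGeometry.cos_angle_mul_norm_mul_norm v w
  have h2 : |inner ℝ v w| ≤ ‖W.starProjection v‖ * ‖w‖ := by
    rw [← Submodule.starProjection_eq_self_iff.2 hw, ← Submodule.inner_starProjection_left_eq_right]
    rw [Submodule.starProjection_eq_self_iff.2 hw]
    exact abs_real_inner_le_norm _ _
  rw [← h1, ← mul_assoc, abs_mul, abs_of_nonneg (norm_nonneg w)] at h2
  have h3 := le_of_mul_le_mul_right h2 (norm_pos_iff.2 hw0)
  have h4 := pow_le_pow_left₀ (abs_nonneg _) h3 2
  rw [sq_abs, mul_pow] at h4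
  linarith

theorem exists_sin_le (hW : W ≠ ⊥) {v : EuclideanSpace ℝ (Fin d)} (hv : v ≠ 0) :
    ∃ w ∈ W, w ≠ 0 ∧
      Real.sin (InnerProductGeometry.angle v w) * ‖v‖ ≤ ‖v - W.starProjection v‖ := by
  by_cases h0 : W.starProjection v = 0
  · obtain ⟨w, hw, hw0⟩ := Submodule.exists_mem_ne_zero_of_ne_bot hW
    refine ⟨w, hw, hw0, ?_⟩
    rw [h0, sub_zero]
    exact mul_le_of_le_one_left (norm_nonneg v) (Real.sin_le_one _)
  · refine ⟨_, W.starProjection_apply_mem v, h0, ?_⟩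
    have hs := InnerProductGeometry.sin_angle_nonneg v (W.starProjection v)
    rw [← sq_le_sq₀ (by positivity) (norm_nonneg _), sq_norm_sub_starProjection, mul_pow,
      Real.sin_sq]
    have h1 := InnerProductGeometry.cos_angle_mul_norm_mul_norm v (W.starProjection v)
    have h2 : inner ℝ v (W.starProjection v) = ‖W.starProjection v‖ ^ 2 := by
      rw [← real_inner_self_eq_norm_sq, Submodule.inner_starProjection_left_eq_right,
        Submodule.starProjection_eq_self_iff.2 (W.starProjection_apply_mem v)]
    rw [h2, ← mul_assoc, sq ‖W.starProjection v‖] at h1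
    have h3 := mul_right_cancel₀ (norm_ne_zero_iff.2 h0) h1
    have h4 : (Real.cos (InnerProductGeometry.angle v (W.starProjection v)) * ‖v‖) ^ 2
      = ‖W.starProjection v‖ ^ 2 := by rw [h3]
    rw [mul_pow] at h4
    linarith

theorem bddBelow_sin (W : Submodule ℝ (EuclideanSpace ℝ (Fin d))) (v : EuclideanSpace ℝ (Fin d)) :
    BddBelow (Set.range fun w : {w : EuclideanSpace ℝ (Fin d) // w ∈ W ∧ w ≠ 0} =>
      Real.sin (InnerProductGeometry.angle v w.1)) :=
  ⟨0, by rintro _ ⟨w, rfl⟩; exact InnerProductGeometry.sin_angle_nonneg _ _⟩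

/-- The minimum is attained at the projection of `v`, or at any vector of `W` if that projection
vanishes. For `W = ⊥` the infimum over the empty type would be zero by convention, so comparisons of
`grDist` and `projDist` exclude zero planes. -/
theorem iInf_sin_eq (hW : W ≠ ⊥) {v : EuclideanSpace ℝ (Fin d)} (hv : v ≠ 0) :
    ⨅ w : {w : EuclideanSpace ℝ (Fin d) // w ∈ W ∧ w ≠ 0},
      Real.sin (InnerProductGeometry.angle v w.1) = ‖v - W.starProjection v‖ / ‖v‖ := by
  have hv' := norm_pos_iff.2 hv
  obtain ⟨w, hw, hw0, hle⟩ := exists_sin_le hW hv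
  have : Nonempty {w : EuclideanSpace ℝ (Fin d) // w ∈ W ∧ w ≠ 0} := ⟨⟨w, hw, hw0⟩⟩
  refine le_antisymm ((ciInf_le (bddBelow_sin W v) ⟨w, hw, hw0⟩).trans ((le_div_iff₀ hv').2 hle))
    (le_ciInf fun w' => (div_le_iff₀ hv').2 (norm_sub_starProjection_le_sin hv w'.2.1 w'.2.2))

theorem maxMinSin_le (hW : W ≠ ⊥) (h0 : 0 ≤ ε) (h : NearPlane ε V W) : maxMinSin V W ≤ ε :=
  Real.iSup_le (fun v => by
    rw [iInf_sin_eq hW v.2.2, div_le_iff₀ (norm_pos_iff.2 v.2.2)]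
    exact h v.1 v.2.1) h0

theorem nearPlane_maxMinSin (hW : W ≠ ⊥) : NearPlane (maxMinSin V W) V W := by
  intro v hv
  by_cases h0 : v = 0
  · simp [h0]
  rw [← div_le_iff₀ (norm_pos_iff.2 h0), ← iInf_sin_eq hW h0]
  refine le_ciSup (f := fun v : {v : EuclideanSpace ℝ (Fin d) // v ∈ V ∧ v ≠ 0} =>
    ⨅ w : {w : EuclideanSpace ℝ (Fin d) // w ∈ W ∧ w ≠ 0},
      Real.sin (InnerProductGeometry.angle v.1 w.1)) ⟨1, ?_⟩ ⟨v, hv, h0⟩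
  rintro _ ⟨v', rfl⟩
  change iInf _ ≤ _
  rw [iInf_sin_eq hW v'.2.2]
  exact div_le_one_of_le₀ (norm_sub_starProjection_le_self W _) (norm_nonneg _)

theorem maxMinSin_nonneg (V W : Submodule ℝ (EuclideanSpace ℝ (Fin d))) : 0 ≤ maxMinSin V W :=
  Real.iSup_nonneg fun _ => Real.iInf_nonneg fun _ => InnerProductGeometry.sin_angle_nonneg _ _

theorem grDist_nonneg (V W : Submodule ℝ (EuclideanSpace ℝ (Fin d))) : 0 ≤ grDist V W :=
  (maxMinSin_nonneg V W).trans (le_max_left _ _)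

theorem grDist_le_projDist (hV : V ≠ ⊥) (hW : W ≠ ⊥) : grDist V W ≤ projDist V W :=
  max_le (maxMinSin_le hW (projDist_nonneg _ _) (nearPlane_projDist V W))
    (maxMinSin_le hV (projDist_nonneg _ _) (projDist_comm V W ▸ nearPlane_projDist W V))

theorem projDist_le_grDist (hV : V ≠ ⊥) (hW : W ≠ ⊥) : projDist V W ≤ 2 * grDist V W := by
  have h1 := (nearPlane_maxMinSin hW).projDist_le (nearPlane_maxMinSin hV)
    (maxMinSin_nonneg V W) (maxMinSin_nonneg W V)
  have h2 : maxMinSin V W ≤ grDist V W := le_max_left _ _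
  have h3 : maxMinSin W V ≤ grDist V W := le_max_right _ _
  linarith

theorem ne_bot_of_finrank {k : ℕ} (hk : 1 ≤ k) (h : finrank ℝ V = k) : V ≠ ⊥ := by
  rintro rfl
  rw [finrank_bot] at h
  omega

theorem projDist_le_two (V W : Submodule ℝ (EuclideanSpace ℝ (Fin d))) : projDist V W ≤ 2 := by
  have h : ∀ V W : Submodule ℝ (EuclideanSpace ℝ (Fin d)), NearPlane 1 V W := fun V W v _ => by
    rw [one_mul]; exact norm_sub_starProjection_le_self W v
  have := (h V W).projDist_le (h W V) zero_le_one zero_le_one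
  linarith

theorem NearPlane.finrank_le (h : NearPlane ε V W) (hε : ε < 1) : finrank ℝ V ≤ finrank ℝ W := by
  let f : V →ₗ[ℝ] W := (W.orthogonalProjectionOnto : _ →ₗ[ℝ] W) ∘ₗ V.subtype
  refine LinearMap.finrank_le_finrank_of_injective (f := f) ?_
  rw [injective_iff_map_eq_zero]
  intro v hv
  have h1 := h v v.2
  rw [show W.starProjection v = 0 from congrArg Subtype.val hv, sub_zero] at h1
  by_contra h0
  have : 0 < ‖(v : EuclideanSpace ℝ (Fin d))‖ := norm_pos_iff.2 (by simpa using h0)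
  nlinarith

theorem finrank_eq_of_projDist_lt_one (h : projDist V W < 1) : finrank ℝ V = finrank ℝ W :=
  le_antisymm ((nearPlane_projDist V W).finrank_le h)
    ((nearPlane_projDist W V).finrank_le (projDist_comm V W ▸ h))

/-- A Cauchy sequence of planes has a limit. -/
theorem exists_tendsto_of_cauchySeq {k : ℕ} {V : ℕ → Submodule ℝ (EuclideanSpace ℝ (Fin d))}
    (hV : ∀ n, finrank ℝ (V n) = k) (hc : CauchySeq fun n => (V n).starProjection) :
    ∃ W : Submodule ℝ (EuclideanSpace ℝ (Fin d)), finrank ℝ W = k ∧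
      Tendsto (fun n => projDist (V n) W) atTop (𝓝 0) := by
  obtain ⟨Q, hQ⟩ := cauchySeq_tendsto_of_complete hc
  have happ : ∀ v, Tendsto (fun n => (V n).starProjection v) atTop (𝓝 (Q v)) := fun v =>
    ((ContinuousLinearMap.apply ℝ _ v).continuous.tendsto Q).comp hQ
  -- Idempotence and symmetry pass to the limit, so a limit of orthogonal projections is an
  -- orthogonal projection; at distance less than one the ranks agree.
  have hidem : Q * Q = Q := by
    refine tendsto_nhds_unique (hQ.mul hQ) (hQ.congr fun n => ?_)
    exact ((V n).isIdempotentElem_starProjection).symm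
  have hsym : (Q : EuclideanSpace ℝ (Fin d) →ₗ[ℝ] EuclideanSpace ℝ (Fin d)).IsSymmetricProjection :=
    ⟨LinearMap.ext fun v => DFunLike.congr_fun hidem v, fun v w =>
      tendsto_nhds_unique ((happ v).inner tendsto_const_nhds)
        ((tendsto_const_nhds.inner (happ w)).congr fun n =>
          ((V n).inner_starProjection_left_eq_right v w).symm)⟩
  obtain ⟨W, hW, hQW⟩ := LinearMap.isSymmetricProjection_iff_eq_coe_starProjection.1 hsym
  have hQW' : Q = W.starProjection := ContinuousLinearMap.ext fun v => DFunLike.congr_fun hQW v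
  have hlim : Tendsto (fun n => projDist (V n) W) atTop (𝓝 0) := by
    rw [hQW', tendsto_iff_norm_sub_tendsto_zero] at hQ
    exact hQ
  obtain ⟨n, hn⟩ := ((tendsto_order.1 hlim).2 1 one_pos).exists
  exact ⟨W, (finrank_eq_of_projDist_lt_one hn).symm.trans (hV n), hlim⟩

/-- Two subspaces of the same dimension have a common complement. -/
theorem exists_common_isCompl (V W : Submodule ℝ (EuclideanSpace ℝ (Fin d)))
    (h : finrank ℝ V = finrank ℝ W) :
    ∃ U : Submodule ℝ (EuclideanSpace ℝ (Fin d)), IsCompl U V ∧ IsCompl U W := by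
  have key : ∀ V U : Submodule ℝ (EuclideanSpace ℝ (Fin d)), ∀ v,
      Disjoint U (V ⊔ ℝ ∙ v) → v ∉ V → Disjoint (U ⊔ ℝ ∙ v) V := by
    intro V U v hU hv
    rw [Submodule.disjoint_def] at hU ⊢
    intro x hx hxV
    obtain ⟨y, hy, z, hz, rfl⟩ := Submodule.mem_sup.1 hx
    obtain ⟨c, rfl⟩ := Submodule.mem_span_singleton.1 hz
    have hy0 : y = 0 := hU y hy (Submodule.mem_sup.2 ⟨y + c • v, hxV, -(c • v),
      Submodule.neg_mem _ (Submodule.smul_mem _ _ (Submodule.mem_span_singleton_self v)), by abel⟩)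
    rw [hy0, zero_add] at hxV ⊢
    by_contra hne
    have hc : c ≠ 0 := fun h => hne (by rw [h, zero_smul])
    exact hv ((Submodule.smul_mem_iff _ hc).1 hxV)
  induction hn : d - finrank ℝ V generalizing V W with
  | zero =>
    have h1 : ∀ V : Submodule ℝ (EuclideanSpace ℝ (Fin d)), d - finrank ℝ V = 0 → V = ⊤ := by
      intro V hV
      refine Submodule.eq_top_of_finrank_eq (le_antisymm (Submodule.finrank_le V) ?_)
      rw [finrank_euclideanSpace_fin]
      omega
    refine ⟨⊥, ?_, ?_⟩
    · rw [h1 V hn]; exact isCompl_bot_top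
    · rw [h1 W (h ▸ hn)]; exact isCompl_bot_top
  | succ n ih =>
    have hne : ∀ V : Submodule ℝ (EuclideanSpace ℝ (Fin d)), d - finrank ℝ V = n + 1 → V ≠ ⊤ := by
      rintro V hV rfl
      rw [finrank_top, finrank_euclideanSpace_fin] at hV
      omega
    -- Two proper subspaces do not cover the space. Adding `v` to both lowers the codimension, and a
    -- common complement of the enlarged spaces becomes one of `V` and `W` after adding `v` to it.
    obtain ⟨v, hvV, hvW⟩ : ∃ v, v ∉ V ∧ v ∉ W := by
      obtain ⟨a, ha⟩ := SetLike.exists_not_mem_of_ne_top V (hne V hn)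
      obtain ⟨b, hb⟩ := SetLike.exists_not_mem_of_ne_top W (hne W (h ▸ hn))
      by_cases ha' : a ∈ W
      · by_cases hb' : b ∈ V
        · exact ⟨a + b, fun h => ha ((V.add_mem_iff_left hb').1 h),
            fun h => hb ((W.add_mem_iff_right ha').1 h)⟩
        · exact ⟨b, hb', hb⟩
      · exact ⟨a, ha, ha'⟩
    have hrank : ∀ V : Submodule ℝ (EuclideanSpace ℝ (Fin d)), v ∉ V →
        finrank ℝ ↥(V ⊔ ℝ ∙ v) = finrank ℝ V + 1 := by
      intro V hv
      have h0 : v ≠ 0 := fun h => hv (h ▸ V.zero_mem)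
      have h1 := Submodule.finrank_sup_add_finrank_inf_eq V (ℝ ∙ v)
      rw [finrank_span_singleton h0] at h1
      have : V ⊓ ℝ ∙ v = ⊥ := ((Submodule.disjoint_span_singleton' h0).2 hv).eq_bot
      rw [this, finrank_bot] at h1
      exact h1
    obtain ⟨U, hU1, hU2⟩ := ih (V ⊔ ℝ ∙ v) (W ⊔ ℝ ∙ v) (by rw [hrank V hvV, hrank W hvW, h])
      (by rw [hrank V hvV]; omega)
    refine ⟨U ⊔ ℝ ∙ v, ⟨key V U v hU1.disjoint hvV, ?_⟩, ⟨key W U v hU2.disjoint hvW, ?_⟩⟩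
    · rw [codisjoint_iff, sup_assoc, sup_comm (ℝ ∙ v), hU1.sup_eq_top]
    · rw [codisjoint_iff, sup_assoc, sup_comm (ℝ ∙ v), hU2.sup_eq_top]

end Planes

/-! ### Top singular planes -/

section TopPlane

open Module

variable {d k : ℕ}

/-- The span of the first `k` left singular vectors. -/
def topPlane (k : ℕ) (A : GL (Fin d) ℝ) : Submodule ℝ (EuclideanSpace ℝ (Fin d)) :=
  coordSpace (leftBasis A) {i | i.1 < k}

/-- The quotient of the singular values on both sides of the index `k`. -/
def gapRatio (k : ℕ) (A : GL (Fin d) ℝ) : ℝ := sigma (k + 1) A / sigma k A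

/-- The condition number. -/
def condNum (A : GL (Fin d) ℝ) : ℝ := sigma 1 A * sigma 1 A⁻¹

theorem finrank_topPlane (hk : k ≤ d) (A : GL (Fin d) ℝ) : finrank ℝ (topPlane k A) = k := by
  rw [topPlane, finrank_coordSpace, ncard_fin_lt hk]

theorem sigma_pos' (hk : 1 ≤ k) (hkd : k ≤ d) (A : GL (Fin d) ℝ) : 0 < sigma k A := by
  have := sigma_pos A (i := k - 1) (by omega)
  rwa [Nat.sub_add_cancel hk] at this

theorem gapRatio_nonneg (k : ℕ) (A : GL (Fin d) ℝ) : 0 ≤ gapRatio k A :=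
  div_nonneg (sigma_nonneg _ _) (sigma_nonneg _ _)

theorem condNum_nonneg (A : GL (Fin d) ℝ) : 0 ≤ condNum A :=
  mul_nonneg (sigma_nonneg _ _) (sigma_nonneg _ _)

theorem inner_leftBasis_gram (A : GL (Fin d) ℝ) (i : Fin d) (v : EuclideanSpace ℝ (Fin d)) :
    inner ℝ (leftBasis A i) ((euclideanMap A ∘ₗ LinearMap.adjoint (euclideanMap A)) v)
      = sigma (i + 1) A ^ 2 * inner ℝ (leftBasis A i) v := by
  rw [LinearMap.comp_apply, inner_leftBasis, LinearMap.adjoint_inner_right,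
    euclideanMap_rightBasis, inner_smul_left]
  simp only [conj_trivial]
  ring

/-- With a gap, the eigenvalues of `A A*` that are at least `σ_k²` are exactly those of the first
`k` left singular vectors. Without it the two spaces may differ; `topPlane` is used throughout
because for `k ≤ d` its dimension is always `k`. -/
theorem topSpace_eq_topPlane {A : GL (Fin d) ℝ} (h : sigma (k + 1) A < sigma k A) :
    topSpace k A = topPlane k A := by
  refine le_antisymm (iSup₂_le fun μ hμ v hv => ?_) (Submodule.span_le.2 ?_)
  · rw [Module.End.mem_eigenspace_iff] at hv
    refine (mem_coordSpace _).2 fun i hi => ?_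
    have h1 := inner_leftBasis_gram A i v
    rw [hv, inner_smul_right] at h1
    have h2 : sigma (i + 1) A ^ 2 < μ := by
      refine lt_of_lt_of_le ?_ hμ
      have h3 : sigma (i + 1) A ≤ sigma (k + 1) A :=
        sigma_antitone A (by simp only [mem_ofPred_eq] at hi; omega)
      exact pow_lt_pow_left₀ (h3.trans_lt h) (sigma_nonneg _ _) two_ne_zero
    by_contra h0
    exact h2.ne' (mul_right_cancel₀ h0 h1)
  · rintro _ ⟨i, hi, rfl⟩
    have hi' : i.1 + 1 ≤ k := hi
    refine Submodule.mem_iSup_of_mem (sigma (i + 1) A ^ 2) (Submodule.mem_iSup_of_mem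
      (pow_le_pow_left₀ (sigma_nonneg _ _) (sigma_antitone A hi') 2) ?_)
    rw [Module.End.mem_eigenspace_iff]
    refine InnerProductSpace.ext_inner_left_basis (leftBasis A).toBasis fun j => ?_
    rw [OrthonormalBasis.coe_toBasis, inner_leftBasis_gram, inner_smul_right,
      (leftBasis A).inner_eq_ite]
    split_ifs with hji
    · rw [hji]
    · simp

/-- The part of an image outside the top plane is small. -/
theorem norm_sub_topPlane_le (k : ℕ) (A : GL (Fin d) ℝ) (v : EuclideanSpace ℝ (Fin d)) :
    ‖euclideanMap A v - (topPlane k A).starProjection (euclideanMap A v)‖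
      ≤ sigma (k + 1) A * ‖v‖ := by
  set C := coordSpace (rightBasis A) {i | i.1 < k}
  have h1 : euclideanMap A (C.starProjection v) ∈ topPlane k A :=
    (mem_coordSpace _).2 fun i hi => by
      rw [inner_leftBasis, (mem_coordSpace _).1 (C.starProjection_apply_mem v) i hi, mul_zero]
  refine (norm_sub_starProjection_le _ _ h1).trans ?_
  rw [← map_sub]
  refine (norm_euclideanMap_le_of_mem ((mem_coordSpace _).2 fun i hi => ?_)).trans
    (mul_le_mul_of_nonneg_left (norm_sub_starProjection_le_self C v) (sigma_nonneg _ _))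
  have hi' : i.1 < k := by simpa using hi
  rw [real_inner_comm]
  exact C.starProjection_inner_eq_zero v _ (Submodule.subset_span ⟨i, hi', rfl⟩)

theorem norm_inv_le_of_mem_topPlane (hk : 1 ≤ k) (hkd : k ≤ d) {A : GL (Fin d) ℝ}
    {v : EuclideanSpace ℝ (Fin d)} (hv : v ∈ topPlane k A) :
    ‖euclideanMap A⁻¹ v‖ ≤ (sigma k A)⁻¹ * ‖v‖ := by
  obtain ⟨j, rfl⟩ : ∃ j, k = j + 1 := ⟨k - 1, by omega⟩
  exact norm_euclideanMap_inv_le (by omega) hv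

theorem sigma_mul_le_condNum (hk : 1 ≤ k) (hkd : k ≤ d) (A h : GL (Fin d) ℝ) :
    (sigma k (A * h))⁻¹ ≤ sigma 1 h⁻¹ * (sigma k A)⁻¹ := by
  obtain ⟨j, rfl⟩ : ∃ j, k = j + 1 := ⟨k - 1, by omega⟩
  have h1 := sigma_mul_le_right (A * h) h⁻¹ (j := j) (by omega)
  rw [mul_inv_cancel_right] at h1
  have h2 := sigma_pos A (i := j) (by omega)
  have h3 := sigma_pos (A * h) (i := j) (by omega)
  rw [← div_eq_mul_inv, le_div_iff₀ h2, inv_mul_le_iff₀ h3]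
  exact h1

/-- A vector of the top plane of `A * h` has a preimage of size at most `(σ_k)⁻¹`, while the part of
any image of `A` outside the top plane of `A` is at most `σ_{k+1}` times the size of the argument.
-/
theorem projDist_topPlane_mul (hk : 1 ≤ k) (hkd : k < d) (A h : GL (Fin d) ℝ) :
    projDist (topPlane k (A * h)) (topPlane k A) ≤ 3 * (condNum h * gapRatio k A) := by
  refine NearPlane.projDist_le_of_finrank_eq (fun v hv => ?_)
    (mul_nonneg (condNum_nonneg _) (gapRatio_nonneg _ _))
    (by rw [finrank_topPlane hkd.le, finrank_topPlane hkd.le])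
  have h1 := norm_inv_le_of_mem_topPlane hk hkd.le hv
  set w := euclideanMap (A * h)⁻¹ v with hw
  have h2 : v = euclideanMap A (euclideanMap h w) := by
    rw [← euclideanMap_mul, hw, euclideanMap_apply_inv]
  have h3 := norm_sub_topPlane_le k A (euclideanMap h w)
  rw [← h2] at h3
  have h4 := sigma_nonneg A (k + 1)
  have h5 := sigma_nonneg h 1
  calc _ ≤ sigma (k + 1) A * ‖euclideanMap h w‖ := h3
    _ ≤ sigma (k + 1) A * (sigma 1 h * ‖w‖) :=
      mul_le_mul_of_nonneg_left (norm_euclideanMap_le h w) h4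
    _ ≤ sigma (k + 1) A * (sigma 1 h * ((sigma 1 h⁻¹ * (sigma k A)⁻¹) * ‖v‖)) := by
      refine mul_le_mul_of_nonneg_left (mul_le_mul_of_nonneg_left (h1.trans ?_) h5) h4
      exact mul_le_mul_of_nonneg_right (sigma_mul_le_condNum hk hkd.le A h) (norm_nonneg _)
    _ = _ := by unfold condNum gapRatio; ring

theorem projDist_map_topPlane (hk : 1 ≤ k) (hkd : k < d) (B A : GL (Fin d) ℝ) :
    projDist ((topPlane k A).map (euclideanMap B)) (topPlane k (B * A))
      ≤ 3 * (condNum B * gapRatio k A) := by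
  refine NearPlane.projDist_le_of_finrank_eq ?_
    (mul_nonneg (condNum_nonneg _) (gapRatio_nonneg _ _))
    (by rw [finrank_map_euclideanMap, finrank_topPlane hkd.le, finrank_topPlane hkd.le])
  rintro _ ⟨v, hv, rfl⟩
  have h1 := norm_inv_le_of_mem_topPlane hk hkd.le hv
  set w := euclideanMap A⁻¹ v with hw
  have h2 : euclideanMap B v = euclideanMap (B * A) w := by
    rw [euclideanMap_mul, hw, euclideanMap_apply_inv]
  have h3 := norm_sub_topPlane_le k (B * A) w
  rw [← h2] at h3
  have h4 : ‖v‖ ≤ sigma 1 B⁻¹ * ‖euclideanMap B v‖ := by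
    conv_lhs => rw [← euclideanMap_inv_apply B v]
    exact norm_euclideanMap_le _ _
  have h5 := sigma_mul_le_left A B hkd
  have h6 : 0 ≤ (sigma k A)⁻¹ := inv_nonneg.2 (sigma_nonneg _ _)
  calc _ ≤ sigma (k + 1) (B * A) * ‖w‖ := h3
    _ ≤ (sigma 1 B * sigma (k + 1) A) * ((sigma k A)⁻¹ * (sigma 1 B⁻¹ * ‖euclideanMap B v‖)) :=
      mul_le_mul h5 (h1.trans (mul_le_mul_of_nonneg_left h4 h6)) (norm_nonneg _)
        (mul_nonneg (sigma_nonneg _ _) (sigma_nonneg _ _))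
    _ = _ := by unfold condNum gapRatio; ring

theorem NearPlane.map {V W : Submodule ℝ (EuclideanSpace ℝ (Fin d))} {ε : ℝ}
    (h : NearPlane ε V W) (h0 : 0 ≤ ε) (B : GL (Fin d) ℝ) :
    NearPlane (condNum B * ε) (V.map (euclideanMap B)) (W.map (euclideanMap B)) := by
  rintro _ ⟨v, hv, rfl⟩
  refine (norm_sub_starProjection_le _ _
    (Submodule.mem_map_of_mem (W.starProjection_apply_mem v))).trans ?_
  rw [← map_sub]
  have h4 : ‖v‖ ≤ sigma 1 B⁻¹ * ‖euclideanMap B v‖ := by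
    conv_lhs => rw [← euclideanMap_inv_apply B v]
    exact norm_euclideanMap_le _ _
  calc _ ≤ sigma 1 B * ‖v - W.starProjection v‖ := norm_euclideanMap_le _ _
    _ ≤ sigma 1 B * (ε * (sigma 1 B⁻¹ * ‖euclideanMap B v‖)) :=
      mul_le_mul_of_nonneg_left ((h v hv).trans (mul_le_mul_of_nonneg_left h4 h0))
        (sigma_nonneg _ _)
    _ = _ := by unfold condNum; ring

theorem projDist_map_le (V W : Submodule ℝ (EuclideanSpace ℝ (Fin d))) (B : GL (Fin d) ℝ) :
    projDist (V.map (euclideanMap B)) (W.map (euclideanMap B))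
      ≤ 2 * (condNum B * projDist V W) := by
  have h0 := mul_nonneg (condNum_nonneg B) (projDist_nonneg V W)
  have := ((nearPlane_projDist V W).map (projDist_nonneg _ _) B).projDist_le
    ((projDist_comm V W ▸ nearPlane_projDist W V).map (projDist_nonneg V W) B) h0 h0
  linarith

theorem sigma_inv_sub (hkd : k < d) (A : GL (Fin d) ℝ) :
    sigma (d - k) A⁻¹ = (sigma (k + 1) A)⁻¹ := sigma_inv A hkd

theorem sigma_inv_sub_add_one (hk : 1 ≤ k) (hkd : k < d) (A : GL (Fin d) ℝ) :
    sigma (d - k + 1) A⁻¹ = (sigma k A)⁻¹ := by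
  have := sigma_inv A (j := k - 1) (by omega)
  rwa [show d - (k - 1) = d - k + 1 by omega, Nat.sub_add_cancel hk] at this

/-- Inversion reverses the list of singular values. By this duality all results for index `k` also
serve the second limit map, with inverses and index `d - k`. -/
theorem gapRatio_inv (hk : 1 ≤ k) (hkd : k < d) (A : GL (Fin d) ℝ) :
    gapRatio (d - k) A⁻¹ = gapRatio k A := by
  rw [gapRatio, sigma_inv_sub hkd, sigma_inv_sub_add_one hk hkd, gapRatio]
  field_simp

theorem norm_le_of_mem_topPlane_inv (hkd : k < d) {A : GL (Fin d) ℝ}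
    {v : EuclideanSpace ℝ (Fin d)} (hv : v ∈ topPlane (d - k) A⁻¹) :
    ‖euclideanMap A v‖ ≤ sigma (k + 1) A * ‖v‖ := by
  have := norm_inv_le_of_mem_topPlane (by omega) (by omega) hv
  rwa [inv_inv, sigma_inv_sub hkd, inv_inv] at this

theorem norm_sub_topPlane_inv_le (hk : 1 ≤ k) (hkd : k < d) (A : GL (Fin d) ℝ)
    (v : EuclideanSpace ℝ (Fin d)) :
    ‖v - (topPlane (d - k) A⁻¹).starProjection v‖ ≤ (sigma k A)⁻¹ * ‖euclideanMap A v‖ := by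
  have := norm_sub_topPlane_le (d - k) A⁻¹ (euclideanMap A v)
  rwa [euclideanMap_inv_apply, sigma_inv_sub_add_one hk hkd] at this

/-- Vectors away from the repelling plane are mapped close to the attracting plane. -/
theorem norm_sub_topPlane_le_of_far (hk : 1 ≤ k) (hkd : k < d) {A : GL (Fin d) ℝ}
    {v : EuclideanSpace ℝ (Fin d)} {c : ℝ} (hc : 0 < c)
    (h : c * ‖v‖ ≤ ‖v - (topPlane (d - k) A⁻¹).starProjection v‖) :
    ‖euclideanMap A v - (topPlane k A).starProjection (euclideanMap A v)‖
      ≤ c⁻¹ * gapRatio k A * ‖euclideanMap A v‖ := by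
  have h1 := (h.trans (norm_sub_topPlane_inv_le hk hkd A v))
  rw [← le_inv_mul_iff₀ hc] at h1
  refine (norm_sub_topPlane_le k A v).trans
    ((mul_le_mul_of_nonneg_left h1 (sigma_nonneg _ _)).trans (le_of_eq ?_))
  unfold gapRatio
  ring

end TopPlane

/-! ### Volumes of parallelepipeds -/

section Volume

open Module

variable {d k : ℕ}

/-- The product of the first `k` singular values. -/
def sigmaProd (k : ℕ) (A : GL (Fin d) ℝ) : ℝ := ∏ i ∈ Finset.range k, sigma (i + 1) A

theorem sigmaProd_nonneg (k : ℕ) (A : GL (Fin d) ℝ) : 0 ≤ sigmaProd k A :=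
  Finset.prod_nonneg fun _ _ => sigma_nonneg _ _

theorem sigmaProd_succ (k : ℕ) (A : GL (Fin d) ℝ) :
    sigmaProd (k + 1) A = sigmaProd k A * sigma (k + 1) A := Finset.prod_range_succ _ _

theorem sigmaProd_pos (hk : k ≤ d) (A : GL (Fin d) ℝ) : 0 < sigmaProd k A :=
  Finset.prod_pos fun _ hi => sigma_pos A ((Finset.mem_range.1 hi).trans_le hk)

theorem prod_le_prod_range {s : ℕ → ℝ} (hs : Antitone s) (h0 : ∀ i, 0 ≤ s i) {n : ℕ}
    {t : Finset ℕ} (ht : t.card = n) : ∏ i ∈ t, s i ≤ ∏ i ∈ Finset.range n, s i := by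
  induction n generalizing t with
  | zero => simp [Finset.card_eq_zero.1 ht]
  | succ n ih =>
    have hne : t.Nonempty := Finset.card_pos.1 (by omega)
    have hmem := t.max'_mem hne
    have hge : n ≤ t.max' hne := by
      by_contra hlt
      have : t ⊆ Finset.range n := fun i hi =>
        Finset.mem_range.2 ((t.le_max' i hi).trans_lt (not_le.1 hlt))
      have := Finset.card_le_card this
      rw [Finset.card_range] at this
      omega
    rw [← Finset.mul_prod_erase _ _ hmem, Finset.prod_range_succ, mul_comm]
    exact mul_le_mul (ih (by rw [Finset.card_erase_of_mem hmem, ht]; rfl)) (hs hge) (h0 _)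
      (Finset.prod_nonneg fun _ _ => h0 _)

theorem prod_sigma_le (A : GL (Fin d) ℝ) {f : Fin k → Fin d} {t : Finset (Fin k)} {n : ℕ}
    (hf : Function.Injective f) (ht : t.card = n) :
    ∏ j ∈ t, sigma ((f j).1 + 1) A ≤ sigmaProd n A := by
  have hinj : Function.Injective fun j => (f j).1 := Fin.val_injective.comp hf
  have := prod_le_prod_range (s := fun i => sigma (i + 1) A)
    (fun i j hij => sigma_antitone A (Nat.succ_le_succ hij)) (fun _ => sigma_nonneg _ _)
    (t := t.image fun j => (f j).1) (n := n) (by rw [Finset.card_image_of_injective _ hinj, ht])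
  rwa [Finset.prod_image fun i _ j _ h => hinj h] at this

/-- Expansion of an alternating map in an orthonormal basis. -/
theorem abs_alternatingMap_le (Ψ : EuclideanSpace ℝ (Fin d) [⋀^Fin k]→ₗ[ℝ] ℝ)
    (u : OrthonormalBasis (Fin d) ℝ (EuclideanSpace ℝ (Fin d)))
    (w : Fin k → EuclideanSpace ℝ (Fin d)) {R : ℝ} (hR : 0 ≤ R)
    (h : ∀ f : Fin k → Fin d, Function.Injective f →
      (∏ j, |inner ℝ (u (f j)) (w j)|) * |Ψ fun j => u (f j)| ≤ R) :
    |Ψ w| ≤ d ^ k * R := by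
  have e1 : Ψ w = ∑ f : Fin k → Fin d, (∏ j, inner ℝ (u (f j)) (w j)) * Ψ fun j => u (f j) := by
    conv_lhs => rw [show w = fun j => ∑ i, inner ℝ (u i) (w j) • u i from
      funext fun j => (u.sum_repr' (w j)).symm]
    have := MultilinearMap.map_sum (Ψ : MultilinearMap ℝ (fun _ : Fin k => _) ℝ)
      (fun j (i : Fin d) => inner ℝ (u i) (w j) • u i)
    refine this.trans (Finset.sum_congr rfl fun f _ => ?_)
    exact MultilinearMap.map_smul_univ _ _ _
  rw [e1]
  refine (Finset.abs_sum_le_sum_abs _ _).trans ((Finset.sum_le_card_nsmul _ _ R fun f _ => ?_).trans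
    (le_of_eq (by simp)))
  rw [abs_mul, Finset.abs_prod]
  by_cases hf : Function.Injective f
  · exact h f hf
  · rw [Function.Injective] at hf
    push Not at hf
    obtain ⟨i, j, hij, hne⟩ := hf
    rw [Ψ.map_eq_zero_of_eq _ (by simp only [hij] : u (f i) = u (f j)) hne]
    simpa using hR

variable {Ψ : EuclideanSpace ℝ (Fin d) [⋀^Fin k]→ₗ[ℝ] ℝ} {C : ℝ}

theorem abs_inner_le_of_norm_eq_one (u : OrthonormalBasis (Fin d) ℝ (EuclideanSpace ℝ (Fin d)))
    (i : Fin d) (v : EuclideanSpace ℝ (Fin d)) : |inner ℝ (u i) v| ≤ ‖v‖ := by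
  simpa using abs_real_inner_le_norm (u i) v

theorem abs_alternatingMap_basis_le (hC : ∀ w, |Ψ w| ≤ C * ∏ j, ‖w j‖)
    (u : OrthonormalBasis (Fin d) ℝ (EuclideanSpace ℝ (Fin d))) (f : Fin k → Fin d) :
    |Ψ fun j => u (f j)| ≤ C := by
  simpa using hC fun j => u (f j)

/-- In the left singular basis each coordinate carries its singular value as a factor. An
alternating form sees only distinct indices, and the product over `k` distinct indices is at most
the product of the first `k` singular values. -/
theorem abs_alternatingMap_comp_le (hC : ∀ w, |Ψ w| ≤ C * ∏ j, ‖w j‖) (hC0 : 0 ≤ C)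
    (M : GL (Fin d) ℝ) (z : Fin k → EuclideanSpace ℝ (Fin d)) :
    |Ψ fun j => euclideanMap M (z j)| ≤ d ^ k * C * sigmaProd k M * ∏ j, ‖z j‖ := by
  have hz : 0 ≤ ∏ j, ‖z j‖ := Finset.prod_nonneg fun _ _ => norm_nonneg _
  have := abs_alternatingMap_le Ψ (leftBasis M) (fun j => euclideanMap M (z j))
    (R := sigmaProd k M * (∏ j, ‖z j‖) * C)
    (mul_nonneg (mul_nonneg (sigmaProd_nonneg _ _) hz) hC0) (fun f hf => by
      refine mul_le_mul ?_ (abs_alternatingMap_basis_le hC _ f) (abs_nonneg _)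
        (mul_nonneg (sigmaProd_nonneg _ _) hz)
      refine le_trans ?_ (mul_le_mul_of_nonneg_right
        (prod_sigma_le M hf (t := Finset.univ) (by simp)) hz)
      rw [← Finset.prod_mul_distrib]
      refine Finset.prod_le_prod (fun _ _ => abs_nonneg _) fun j _ => ?_
      rw [inner_leftBasis, abs_mul, abs_of_nonneg (sigma_nonneg _ _)]
      exact mul_le_mul_of_nonneg_left (abs_inner_le_of_norm_eq_one _ _ _) (sigma_nonneg _ _))
  linarith

theorem abs_alternatingMap_comp_le_norm {n : ℕ}
    {Ψ : EuclideanSpace ℝ (Fin d) [⋀^Fin (n + 1)]→ₗ[ℝ] ℝ}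
    (hC : ∀ w, |Ψ w| ≤ C * ∏ j, ‖w j‖) (hC0 : 0 ≤ C)
    (M : GL (Fin d) ℝ) {z : Fin (n + 1) → EuclideanSpace ℝ (Fin d)} (j₀ : Fin (n + 1))
    (hz : ∀ j ≠ j₀, ‖z j‖ ≤ 1) :
    |Ψ fun j => euclideanMap M (z j)|
      ≤ d ^ (n + 1) * C * sigmaProd n M * ‖euclideanMap M (z j₀)‖ := by
  have := abs_alternatingMap_le Ψ (leftBasis M) (fun j => euclideanMap M (z j))
    (R := ‖euclideanMap M (z j₀)‖ * sigmaProd n M * C)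
    (mul_nonneg (mul_nonneg (norm_nonneg _) (sigmaProd_nonneg _ _)) hC0) (fun f hf => by
      refine mul_le_mul ?_ (abs_alternatingMap_basis_le hC _ f) (abs_nonneg _)
        (mul_nonneg (norm_nonneg _) (sigmaProd_nonneg _ _))
      rw [← Finset.mul_prod_erase _ _ (Finset.mem_univ j₀)]
      refine mul_le_mul (abs_inner_le_of_norm_eq_one _ _ _) ?_
        (Finset.prod_nonneg fun _ _ => abs_nonneg _) (norm_nonneg _)
      refine le_trans ?_ (prod_sigma_le M hf (t := Finset.univ.erase j₀) (by simp))
      refine Finset.prod_le_prod (fun _ _ => abs_nonneg _) fun j hj => ?_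
      rw [inner_leftBasis, abs_mul, abs_of_nonneg (sigma_nonneg _ _)]
      exact mul_le_of_le_one_right (sigma_nonneg _ _)
        ((abs_inner_le_of_norm_eq_one _ _ _).trans (hz j (Finset.ne_of_mem_erase hj))))
  linarith

/-- The volume of the projection of a parallelepiped. -/
def gramDet (y : Fin k → EuclideanSpace ℝ (Fin d)) : EuclideanSpace ℝ (Fin d) [⋀^Fin k]→ₗ[ℝ] ℝ :=
  Matrix.detRowAlternating.compLinearMap
    (LinearMap.pi fun i => (innerₛₗ ℝ (y i)))

theorem gramDet_apply (y w : Fin k → EuclideanSpace ℝ (Fin d)) :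
    gramDet y w = Matrix.det (Matrix.of fun j i => inner ℝ (y i) (w j)) := rfl

theorem abs_gramDet_le {y : Fin k → EuclideanSpace ℝ (Fin d)} (hy : ∀ i, ‖y i‖ ≤ 1)
    (w : Fin k → EuclideanSpace ℝ (Fin d)) : |gramDet y w| ≤ k.factorial * ∏ j, ‖w j‖ := by
  rw [gramDet_apply, ← Matrix.det_transpose, Matrix.det_apply]
  refine (Finset.abs_sum_le_sum_abs _ _).trans
    ((Finset.sum_le_card_nsmul _ _ (∏ j, ‖w j‖) fun σ _ => ?_).trans (le_of_eq ?_))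
  · rw [Units.smul_def, zsmul_eq_mul, abs_mul, Finset.abs_prod]
    have : |((Equiv.Perm.sign σ : ℤ) : ℝ)| = 1 := by
      rcases Int.units_eq_one_or (Equiv.Perm.sign σ) with h | h <;> simp [h]
    rw [this, one_mul]
    refine Finset.prod_le_prod (fun _ _ => abs_nonneg _) fun j _ => ?_
    exact (abs_real_inner_le_norm _ _).trans (mul_le_of_le_one_left (norm_nonneg _) (hy _))
  · simp [Fintype.card_perm]

/-- In the singular bases the matrix of inner products is diagonal. A bounded alternating form thus
realizes the product of singular values and plays the role of the norm of the exterior power. -/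
theorem sigmaProd_eq_gramDet (hk : k ≤ d) (M : GL (Fin d) ℝ) :
    gramDet (fun i => leftBasis M (Fin.castLE hk i))
      (fun j => euclideanMap M (rightBasis M (Fin.castLE hk j))) = sigmaProd k M := by
  rw [gramDet_apply, sigmaProd, ← Fin.prod_univ_eq_prod_range (fun i => sigma (i + 1) M)]
  have : (Matrix.of fun j i => inner ℝ (leftBasis M (Fin.castLE hk i))
      (euclideanMap M (rightBasis M (Fin.castLE hk j))))
      = Matrix.diagonal fun i : Fin k => sigma (i.1 + 1) M := by
    ext j i
    rw [Matrix.of_apply, euclideanMap_rightBasis, inner_smul_right, (leftBasis M).inner_eq_ite,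
      Matrix.diagonal_apply]
    by_cases h : i = j
    · simp [h]
    · simp [h, Ne.symm h]
  rw [this, Matrix.det_diagonal]

/-- The volume of the image of a top singular plane that nearly meets the repelling plane. -/
theorem abs_alternatingMap_comp_le_of_near {n : ℕ} (hn : n + 1 < d)
    {Ψ : EuclideanSpace ℝ (Fin d) [⋀^Fin (n + 1)]→ₗ[ℝ] ℝ}
    (hC : ∀ w, |Ψ w| ≤ C * ∏ j, ‖w j‖) (hC0 : 0 ≤ C) (A B : GL (Fin d) ℝ)
    {f : Fin (n + 1) → Fin d} (hf : Function.Injective f) (hfn : ∀ j, (f j).1 < n + 1)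
    {v : EuclideanSpace ℝ (Fin d)} (hv : ‖v‖ = 1) {e₁ e₂ : ℝ}
    (h₁ : ‖v - (topPlane (n + 1) A).starProjection v‖ ≤ e₁)
    (h₂ : ‖v - (topPlane (d - (n + 1)) B⁻¹).starProjection v‖ ≤ e₂) :
    |Ψ fun j => euclideanMap B (leftBasis A (f j))| ≤
      2 * (n + 1) * (d ^ (n + 1) * C) * (e₁ + e₂ + gapRatio (n + 1) B) * sigmaProd (n + 1) B := by
  set u := leftBasis A
  set z : Fin (n + 1) → EuclideanSpace ℝ (Fin d) := fun j => u (f j) with hz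
  set Φ : EuclideanSpace ℝ (Fin d) [⋀^Fin (n + 1)]→ₗ[ℝ] ℝ := Ψ.compLinearMap (euclideanMap B)
  set D := (d : ℝ) ^ (n + 1) * C with hD
  have hD0 : 0 ≤ D := by positivity
  have hP := sigmaProd_nonneg (n + 1) B
  have hr := gapRatio_nonneg (n + 1) B
  have h₁' := (norm_nonneg _).trans h₁
  have h₂' := (norm_nonneg _).trans h₂
  have hz1 : ∀ j, ‖z j‖ = 1 := fun j => u.norm_eq_one _
  have hΦ : ∀ x, |Φ x| ≤ D * sigmaProd (n + 1) B * ∏ j, ‖x j‖ :=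
    fun x => abs_alternatingMap_comp_le hC hC0 B x
  have hupd : ∀ j₀ x, |Φ (Function.update z j₀ x)| ≤ D * sigmaProd (n + 1) B * ‖x‖ := by
    intro j₀ x
    refine (hΦ _).trans (le_of_eq ?_)
    rw [← Finset.mul_prod_erase _ _ (Finset.mem_univ j₀), Function.update_self,
      Finset.prod_eq_one, mul_one]
    intro j hj
    rw [Function.update_of_ne (Finset.ne_of_mem_erase hj), hz1]
  change |Φ z| ≤ _
  have hΦz : |Φ z| ≤ D * sigmaProd (n + 1) B := by simpa [hz1] using hΦ z
  have hn0 : (1 : ℝ) ≤ n + 1 := by linarith [Nat.cast_nonneg (α := ℝ) n]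
  -- For large `e₁` the general volume bound is enough; otherwise the projection `w` of `v` to the
  -- top plane has norm at least `1 / 2`.
  by_cases he : 1 / 2 < e₁
  · refine hΦz.trans ?_
    have : (1 : ℝ) ≤ 2 * (n + 1) * (e₁ + e₂ + gapRatio (n + 1) B) := by nlinarith
    calc D * sigmaProd (n + 1) B ≤ (D * sigmaProd (n + 1) B) *
          (2 * (n + 1) * (e₁ + e₂ + gapRatio (n + 1) B)) :=
          le_mul_of_one_le_right (by positivity) this
      _ = _ := by ring
  push Not at he
  set w := (topPlane (n + 1) A).starProjection v with hw
  have hwlow : 1 / 2 ≤ ‖w‖ := by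
    have := norm_sub_norm_le v w
    linarith
  -- The injection `f` exhausts the first `n + 1` indices, so `z` is an orthonormal basis of the top
  -- plane of `A` and `w` expands in it.
  have himage : Finset.univ.image f = Finset.univ.filter fun i : Fin d => i.1 < n + 1 := by
    refine Finset.eq_of_subset_of_card_le (fun i hi => ?_) ?_
    · obtain ⟨j, -, rfl⟩ := Finset.mem_image.1 hi
      simpa using hfn j
    · rw [Finset.card_image_of_injective _ hf, Fin.card_filter_val_lt]
      simp
  have hsum : w = ∑ j, inner ℝ (z j) w • z j := by
    conv_lhs => rw [← u.sum_repr' w]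
    rw [← Finset.sum_image (f := fun i => inner ℝ (u i) w • u i) fun i _ j _ h => hf h, himage]
    refine (Finset.sum_subset (Finset.subset_univ _) fun i _ hi => ?_).symm
    rw [(mem_coordSpace u).1 ((topPlane (n + 1) A).starProjection_apply_mem v) i
      (by simpa using hi), zero_smul]
  obtain ⟨j₀, hj₀⟩ : ∃ j₀, ‖w‖ ≤ (n + 1) * |inner ℝ (z j₀) w| := by
    by_contra! hcon
    have h1 : ‖w‖ ≤ ∑ j, |inner ℝ (z j) w| := by
      conv_lhs => rw [hsum]
      refine (norm_sum_le _ _).trans (le_of_eq (Finset.sum_congr rfl fun j _ => ?_))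
      rw [norm_smul, hz1, mul_one, Real.norm_eq_abs]
    have h2 := Finset.sum_lt_sum_of_nonempty Finset.univ_nonempty fun j _ => hcon j
    rw [← Finset.mul_sum] at h2
    simp only [Finset.sum_const, Finset.card_univ, Fintype.card_fin, nsmul_eq_mul] at h2
    push_cast at h2
    nlinarith
  -- Replacing the vector `z j₀` by `w` multiplies the volume by a coordinate of `w`, and `j₀` was
  -- chosen so that this coordinate is at least `‖w‖ / (n + 1)`.
  have hrepl : Φ (Function.update z j₀ w) = inner ℝ (z j₀) w * Φ z := by
    conv_lhs => rw [hsum]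
    rw [AlternatingMap.map_update_sum, Finset.sum_eq_single j₀]
    · rw [AlternatingMap.map_update_smul, Function.update_eq_self, smul_eq_mul]
    · intro j _ hj
      rw [AlternatingMap.map_update_smul, Φ.map_update_self z hj.symm, smul_zero]
    · simp
  set p := (topPlane (d - (n + 1)) B⁻¹).starProjection v with hp
  have hp1 : ‖p‖ ≤ 1 := hv ▸ Submodule.norm_starProjection_apply_le _ v
  have hwp : ‖w - p‖ ≤ e₁ + e₂ := by
    have := norm_sub_le_norm_sub_add_norm_sub w v p
    rw [norm_sub_rev w v] at this
    linarith
  have hBp : |Φ (Function.update z j₀ p)| ≤ D * gapRatio (n + 1) B * sigmaProd (n + 1) B := by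
    have h1 := abs_alternatingMap_comp_le_norm hC hC0 B (z := Function.update z j₀ p) j₀
      fun j hj => by rw [Function.update_of_ne hj, hz1]
    rw [Function.update_self, ← hD] at h1
    refine h1.trans ?_
    have h2 := norm_le_of_mem_topPlane_inv hn
      ((topPlane (d - (n + 1)) B⁻¹).starProjection_apply_mem v)
    have h3 : ‖euclideanMap B p‖ ≤ sigma (n + 1 + 1) B :=
      h2.trans (mul_le_of_le_one_right (sigma_nonneg _ _) hp1)
    calc _ ≤ D * sigmaProd n B * sigma (n + 1 + 1) B :=
          mul_le_mul_of_nonneg_left h3 (mul_nonneg hD0 (sigmaProd_nonneg _ _))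
      _ = _ := by
          have := (sigma_pos B (i := n) (by omega)).ne'
          rw [sigmaProd_succ, gapRatio]
          field_simp
  -- Write `w = (w - p) + p`: the first summand is short, and the second lies in the repelling plane
  -- of `B`, where `B` stretches by at most `σ_{k+1}` instead of `σ_k`.
  have hsplit : |Φ (Function.update z j₀ w)| ≤
      D * (e₁ + e₂ + gapRatio (n + 1) B) * sigmaProd (n + 1) B := by
    have e1 : Φ (Function.update z j₀ w)
        = Φ (Function.update z j₀ (w - p)) + Φ (Function.update z j₀ p) := by
      rw [← AlternatingMap.map_update_add, sub_add_cancel]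
    rw [e1]
    have h1 := (hupd j₀ (w - p)).trans (mul_le_mul_of_nonneg_left hwp (by positivity))
    refine (abs_add_le _ _).trans ((add_le_add h1 hBp).trans (le_of_eq (by ring)))
  rw [hrepl, abs_mul] at hsplit
  have h1 : |Φ z| ≤ 2 * (‖w‖ * |Φ z|) := by nlinarith [abs_nonneg (Φ z)]
  have h2 : ‖w‖ * |Φ z| ≤ (n + 1) * (|inner ℝ (z j₀) w| * |Φ z|) := by
    rw [← mul_assoc]
    exact mul_le_mul_of_nonneg_right hj₀ (abs_nonneg _)
  have h3 := mul_le_mul_of_nonneg_left hsplit (by positivity : (0 : ℝ) ≤ n + 1)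
  calc |Φ z| ≤ 2 * ((n + 1) * (D * (e₁ + e₂ + gapRatio (n + 1) B) * sigmaProd (n + 1) B)) := by
        linarith
    _ = _ := by ring

/-- The product of singular values drops if the attracting plane of `A` and the repelling plane of
`B` nearly meet. -/
theorem exists_sigmaProd_mul_le (hk : 1 ≤ k) (hkd : k < d) :
    ∃ K : ℝ, 0 < K ∧ ∀ (A B : GL (Fin d) ℝ) (v : EuclideanSpace ℝ (Fin d)) (e₁ e₂ : ℝ), ‖v‖ = 1 →
      ‖v - (topPlane k A).starProjection v‖ ≤ e₁ →
      ‖v - (topPlane (d - k) B⁻¹).starProjection v‖ ≤ e₂ →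
      sigmaProd k (B * A) ≤
        K * (e₁ + e₂ + gapRatio k A + gapRatio k B) * (sigmaProd k A * sigmaProd k B) := by
  obtain ⟨n, rfl⟩ : ∃ n, k = n + 1 := ⟨k - 1, by omega⟩
  obtain ⟨C, hCdef⟩ : ∃ C : ℝ, C = ((n + 1).factorial : ℝ) := ⟨_, rfl⟩
  have hC0 : 0 < C := hCdef ▸ by positivity
  set D : ℝ := (d : ℝ) ^ (n + 1) * C with hD
  have hd0 : 0 < (d : ℝ) := by exact_mod_cast (by omega : 0 < d)
  have hD0 : 0 < D := by positivity
  refine ⟨d ^ (n + 1) * (2 * (n + 1) * D), by positivity, fun A B v e₁ e₂ hv h₁ h₂ => ?_⟩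
  have h₁' := (norm_nonneg _).trans h₁
  have h₂' := (norm_nonneg _).trans h₂
  have hPA := sigmaProd_nonneg (n + 1) A
  have hPB := sigmaProd_nonneg (n + 1) B
  have hrA := gapRatio_nonneg (n + 1) A
  have hrB := gapRatio_nonneg (n + 1) B
  set Ψ := gramDet fun i => leftBasis (B * A) (Fin.castLE hkd.le i)
  have hΨ : ∀ w, |Ψ w| ≤ C * ∏ j, ‖w j‖ :=
    hCdef ▸ abs_gramDet_le fun i => ((leftBasis (B * A)).norm_eq_one _).le
  have e1 := sigmaProd_eq_gramDet hkd.le (B * A)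
  set x : Fin (n + 1) → EuclideanSpace ℝ (Fin d) :=
    fun j => rightBasis (B * A) (Fin.castLE hkd.le j)
  have e2 : sigmaProd (n + 1) (B * A)
      = (Ψ.compLinearMap (euclideanMap B)) fun j => euclideanMap A (x j) := by
    rw [← e1, AlternatingMap.compLinearMap_apply]
    congr 1
    funext j
    exact euclideanMap_mul B A _
  rw [e2]
  refine (le_abs_self _).trans ((abs_alternatingMap_le _ (leftBasis A) _ (R := 2 * (n + 1) * D *
    (e₁ + e₂ + gapRatio (n + 1) A + gapRatio (n + 1) B) *
      (sigmaProd (n + 1) A * sigmaProd (n + 1) B)) (mul_nonneg (mul_nonneg (by positivity)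
        (add_nonneg (add_nonneg (add_nonneg h₁' h₂') hrA) hrB)) (mul_nonneg hPA hPB))
    fun f hf => ?_).trans (le_of_eq (by ring)))
  have hcoef : ∀ j, |inner ℝ (leftBasis A (f j)) (euclideanMap A (x j))| ≤
      sigma ((f j).1 + 1) A := by
    intro j
    rw [inner_leftBasis, abs_mul, abs_of_nonneg (sigma_nonneg _ _)]
    refine mul_le_of_le_one_right (sigma_nonneg _ _) ?_
    have h1 := abs_inner_le_of_norm_eq_one (rightBasis A) (f j) (x j)
    rwa [(rightBasis (B * A)).norm_eq_one] at h1
  have hn0 : (1 : ℝ) ≤ n + 1 := by linarith [Nat.cast_nonneg (α := ℝ) n]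
  rw [AlternatingMap.compLinearMap_apply]
  -- If `f` stays among the first indices, its parallelepiped spans the attracting plane of `A`,
  -- which nearly meets the repelling plane of `B`. Otherwise the coefficients already lose the
  -- factor `gapRatio (n + 1) A`.
  by_cases hfn : ∀ j, (f j).1 < n + 1
  · have h1 : ∏ j, |inner ℝ (leftBasis A (f j)) (euclideanMap A (x j))| ≤ sigmaProd (n + 1) A :=
      (Finset.prod_le_prod (fun _ _ => abs_nonneg _) fun j _ => hcoef j).trans
        (prod_sigma_le A hf (t := Finset.univ) (by simp))
    have h2 := abs_alternatingMap_comp_le_of_near hkd hΨ hC0.le A B hf hfn hv h₁ h₂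
    refine (mul_le_mul h1 h2 (abs_nonneg _) hPA).trans ?_
    have h3 : 0 ≤ 2 * (n + 1) * D * (sigmaProd (n + 1) A * sigmaProd (n + 1) B) *
        gapRatio (n + 1) A :=
      mul_nonneg (mul_nonneg (by positivity) (mul_nonneg hPA hPB)) hrA
    exact le_of_sub_nonneg (h3.trans_eq (by ring))
  · push Not at hfn
    obtain ⟨j₀, hj₀⟩ := hfn
    have h1 : ∏ j, |inner ℝ (leftBasis A (f j)) (euclideanMap A (x j))| ≤
        gapRatio (n + 1) A * sigmaProd (n + 1) A := by
      have e3 : gapRatio (n + 1) A * sigmaProd (n + 1) A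
          = sigma (n + 1 + 1) A * sigmaProd n A := by
        have := (sigma_pos A (i := n) (by omega)).ne'
        rw [sigmaProd_succ, gapRatio]
        field_simp
      rw [e3, ← Finset.mul_prod_erase _ _ (Finset.mem_univ j₀)]
      refine mul_le_mul ((hcoef j₀).trans (sigma_antitone A (by omega))) ?_
        (Finset.prod_nonneg fun _ _ => abs_nonneg _) (sigma_nonneg _ _)
      exact (Finset.prod_le_prod (fun _ _ => abs_nonneg _) fun j _ => hcoef j).trans
        (prod_sigma_le A hf (t := Finset.univ.erase j₀) (by simp))
    have h2 : |Ψ fun j => euclideanMap B (leftBasis A (f j))| ≤ D * sigmaProd (n + 1) B := by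
      simpa using abs_alternatingMap_comp_le hΨ hC0.le B fun j => leftBasis A (f j)
    refine (mul_le_mul h1 h2 (abs_nonneg _) (mul_nonneg hrA hPA)).trans ?_
    have h3 : gapRatio (n + 1) A ≤
        2 * (n + 1) * (e₁ + e₂ + gapRatio (n + 1) A + gapRatio (n + 1) B) := by nlinarith
    calc _ = gapRatio (n + 1) A * (D * (sigmaProd (n + 1) A * sigmaProd (n + 1) B)) := by ring
      _ ≤ (2 * (n + 1) * (e₁ + e₂ + gapRatio (n + 1) A + gapRatio (n + 1) B)) *
          (D * (sigmaProd (n + 1) A * sigmaProd (n + 1) B)) :=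
        mul_le_mul_of_nonneg_right h3 (mul_nonneg hD0.le (mul_nonneg hPA hPB))
      _ = _ := by ring

theorem inv_sigma_inv_le (hk : 1 ≤ k) (hkd : k ≤ d) (A : GL (Fin d) ℝ) :
    (sigma 1 A⁻¹)⁻¹ ≤ sigma k A := by
  have h := sigma_inv A (j := d - 1) (by omega)
  rw [show d - (d - 1) = 1 by omega, show d - 1 + 1 = d by omega] at h
  rw [h, inv_inv]
  exact sigma_antitone A hkd

theorem sigmaProd_ge (hkd : k ≤ d) (A : GL (Fin d) ℝ) : (sigma 1 A⁻¹)⁻¹ ^ k ≤ sigmaProd k A := by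
  have h := Finset.prod_le_prod (s := Finset.range k) (f := fun _ => (sigma 1 A⁻¹)⁻¹)
    (g := fun i => sigma (i + 1) A) (fun _ _ => inv_nonneg.2 (sigma_nonneg _ _))
    (fun i hi => inv_sigma_inv_le (by omega) (by have := Finset.mem_range.1 hi; omega) A)
  simpa [sigmaProd] using h

end Volume

/-! ### Limits of top singular planes along geodesic rays -/

section GapRays

open Module Cay

variable {Γ : Type*} [Group Γ] {S : FinSymmGenSet Γ} {d k : ℕ}

theorem gapRatio_mul_left (hk : 1 ≤ k) (hkd : k < d) (B A : GL (Fin d) ℝ) :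
    gapRatio k (B * A) ≤ condNum B * gapRatio k A := by
  have h1 := sigma_mul_le_left A B hkd
  have h2 := sigma_mul_le_left (B * A) B⁻¹ (j := k - 1) (by omega)
  rw [inv_mul_cancel_left, Nat.sub_add_cancel hk] at h2
  have h3 := sigma_pos' hk hkd.le A
  have h4 := sigma_pos' hk hkd.le (B * A)
  have h5 := sigma_nonneg B 1
  have h6 := sigma_nonneg A (k + 1)
  unfold gapRatio condNum
  rw [div_le_iff₀ h4]
  refine h1.trans ?_
  rw [mul_assoc, mul_assoc]
  refine mul_le_mul_of_nonneg_left ?_ h5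
  rw [← mul_assoc, mul_comm (sigma 1 B⁻¹), mul_assoc, div_mul_eq_mul_div, le_div_iff₀ h3]
  exact mul_le_mul_of_nonneg_left h2 h6

theorem gapRatio_mul_right (hk : 1 ≤ k) (hkd : k < d) (A B : GL (Fin d) ℝ) :
    gapRatio k (A * B) ≤ condNum B * gapRatio k A := by
  have h1 := sigma_mul_le_right A B hkd
  have h2 := sigma_mul_le_right (A * B) B⁻¹ (j := k - 1) (by omega)
  rw [mul_inv_cancel_right, Nat.sub_add_cancel hk] at h2
  have h3 := sigma_pos' hk hkd.le A
  have h4 := sigma_pos' hk hkd.le (A * B)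
  have h5 := sigma_nonneg B 1
  have h6 := sigma_nonneg A (k + 1)
  unfold gapRatio condNum
  rw [div_le_iff₀ h4, mul_assoc, mul_assoc]
  refine h1.trans ?_
  rw [mul_comm]
  refine mul_le_mul_of_nonneg_left ?_ h5
  rw [← mul_assoc, mul_comm (sigma 1 B⁻¹), mul_assoc, div_mul_eq_mul_div, le_div_iff₀ h3]
  refine mul_le_mul_of_nonneg_left ?_ h6
  rwa [mul_comm]

/-- `h` runs along the vertices of a geodesic ray that ends at `x`. -/
def IsVertexRay (S : FinSymmGenSet Γ) (h : ℕ → Γ) (x : GroupBoundary S) : Prop :=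
  ∃ r : GeodesicRay (Cay S), (∀ n : ℕ, r.1 n = vertex S (h n)) ∧ r.endpoint = x

/-- `h` runs along a geodesic ray, and its increments are in `M`. -/
def GapRay (M : Set Γ) (h : ℕ → Γ) (x : GroupBoundary S) : Prop :=
  IsVertexRay S h x ∧ ∀ i j, i ≤ j → (h i)⁻¹ * h j ∈ M

/-- Domination in terms of the singular value quotients. -/
def Dominates (S : FinSymmGenSet Γ) (k : ℕ) (ρ : Γ →* GL (Fin d) ℝ) (M : Set Γ) (C c : ℝ) : Prop :=
  0 < C ∧ 0 < c ∧ ∀ γ ∈ M, gapRatio k (ρ γ) ≤ C * Real.exp (-c * wordLength S γ)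

variable {ρ : Γ →* GL (Fin d) ℝ} {M : Set Γ} {C c : ℝ} {h : ℕ → Γ} {x : GroupBoundary S}

theorem IsVertexRay.dist (hh : IsVertexRay S h x) (i j : ℕ) :
    dist (vertex S (h i)) (vertex S (h j)) = |(i : ℝ) - j| := by
  obtain ⟨r, hr, -⟩ := hh
  rw [← hr, ← hr, r.2.dist_eq]
  rfl

theorem IsVertexRay.wordLength (hh : IsVertexRay S h x) {i j : ℕ} (hij : i ≤ j) :
    wordLength S ((h i)⁻¹ * h j) = j - i := by
  rw [← dist_vertex, hh.dist, abs_sub_comm, abs_of_nonneg]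
  exact sub_nonneg.2 (Nat.cast_le.2 hij)

theorem exists_le_of_wordLength_le [ProperSpace (Cay S)] (F : Γ → ℝ) (b : ℝ) :
    ∃ K, 1 ≤ K ∧ ∀ g : Γ, wordLength S g ≤ b → F g ≤ K := by
  obtain ⟨K, hK⟩ := ((finite_wordLength_le (S := S) b).image F).bddAbove
  exact ⟨max 1 K, le_max_left _ _, fun g hg => (hK ⟨g, hg, rfl⟩).trans (le_max_right _ _)⟩

/-- The increment from `h 0` to `h n` is dominated and `h 0` is one of finitely many elements, which
bounds the gap at `h n`. Passing to `γ` is right multiplication by one of finitely many elements. -/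
theorem Dominates.exists_compare [ProperSpace (Cay S)] (hk : 1 ≤ k) (hkd : k < d)
    (hM : Dominates S k ρ M C c) (b D : ℝ) :
    ∃ K, 0 < K ∧ ∀ (h : ℕ → Γ) (x : GroupBoundary S) (γ : Γ) (n : ℕ), GapRay M h x →
      wordLength S (h 0) ≤ b → dist (vertex S (h n)) (vertex S γ) ≤ D →
      gapRatio k (ρ γ) ≤ K * Real.exp (-c * n) ∧
      projDist (topPlane k (ρ γ)) (topPlane k (ρ (h n))) ≤ K * Real.exp (-c * n) := by
  obtain ⟨hC, -, hdom⟩ := hM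
  obtain ⟨K₁, hK₁, hb⟩ := exists_le_of_wordLength_le (S := S) (fun g => condNum (ρ g)) b
  obtain ⟨K₂, hK₂, hD⟩ := exists_le_of_wordLength_le (S := S) (fun g => condNum (ρ g)) D
  refine ⟨3 * (K₂ * (K₁ * C)), by positivity, fun h x γ n hh h0 hγ => ?_⟩
  have e := Real.exp_pos (-c * n)
  have h1 : gapRatio k (ρ (h n)) ≤ K₁ * (C * Real.exp (-c * n)) := by
    have h2 := gapRatio_mul_left hk hkd (ρ (h 0)) (ρ ((h 0)⁻¹ * h n))
    rw [← map_mul, mul_inv_cancel_left] at h2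
    have h3 := hdom _ (hh.2 0 n n.zero_le)
    rw [hh.1.wordLength n.zero_le, Nat.cast_zero, sub_zero] at h3
    exact h2.trans (mul_le_mul (hb _ h0) h3 (gapRatio_nonneg _ _) (by positivity))
  have h4 : ρ γ = ρ (h n) * ρ ((h n)⁻¹ * γ) := by rw [← map_mul, mul_inv_cancel_left]
  have h5 := hD ((h n)⁻¹ * γ) (by rwa [← dist_vertex])
  have h6 : condNum (ρ ((h n)⁻¹ * γ)) * gapRatio k (ρ (h n))
      ≤ K₂ * (K₁ * (C * Real.exp (-c * n))) :=
    mul_le_mul h5 h1 (gapRatio_nonneg _ _) (by positivity)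
  have h7 : 0 ≤ K₂ * (K₁ * (C * Real.exp (-c * n))) := by positivity
  have h8 := gapRatio_mul_right hk hkd (ρ (h n)) (ρ ((h n)⁻¹ * γ))
  have h9 := projDist_topPlane_mul hk hkd (ρ (h n)) (ρ ((h n)⁻¹ * γ))
  rw [← h4] at h8 h9
  constructor <;> linarith

theorem Dominates.exists_limit [ProperSpace (Cay S)] (hk : 1 ≤ k) (hkd : k < d)
    (hM : Dominates S k ρ M C c) (b : ℝ) :
    ∃ K, 0 < K ∧ ∀ (h : ℕ → Γ) (x : GroupBoundary S), GapRay M h x → wordLength S (h 0) ≤ b →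
      ∃ W : Submodule ℝ (EuclideanSpace ℝ (Fin d)), finrank ℝ W = k ∧
        ∀ n, projDist (topPlane k (ρ (h n))) W ≤ K * Real.exp (-c * n) := by
  obtain ⟨K, hK, hcmp⟩ := hM.exists_compare hk hkd b 1
  have hc : 0 < c := hM.2.1
  have hr1 : Real.exp (-c) < 1 := by
    rw [← Real.exp_zero]
    exact Real.exp_lt_exp.2 (by linarith)
  refine ⟨K / (1 - Real.exp (-c)), div_pos hK (by linarith), fun h x hh h0 => ?_⟩
  have hexp : ∀ n : ℕ, Real.exp (-c * n) = Real.exp (-c) ^ n := fun n => by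
    rw [← Real.exp_nat_mul, mul_comm]
  set f : ℕ → EuclideanSpace ℝ (Fin d) →L[ℝ] EuclideanSpace ℝ (Fin d) :=
    fun n => (topPlane k (ρ (h n))).starProjection with hf
  have hstep : ∀ n, dist (f n) (f (n + 1)) ≤ K * Real.exp (-c) ^ n := by
    intro n
    have := (hcmp h x (h (n + 1)) n hh h0 (by rw [hh.1.dist]; simp)).2
    rw [projDist_comm, hexp] at this
    rw [dist_eq_norm]
    exact this
  obtain ⟨W, hW, hlim⟩ := exists_tendsto_of_cauchySeq
    (fun n => finrank_topPlane hkd.le (ρ (h n))) (cauchySeq_of_le_geometric _ _ hr1 hstep)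
  refine ⟨W, hW, fun n => ?_⟩
  have := dist_le_of_le_geometric_of_tendsto _ _ hr1 hstep
    (tendsto_iff_norm_sub_tendsto_zero.2 hlim) n
  rw [dist_eq_norm] at this
  rw [hexp, div_mul_eq_mul_div]
  exact this

/-- `ξ x` is the limit of the top singular planes along all rays that end at `x`. -/
def IsRayLimit (ρ : Γ →* GL (Fin d) ℝ) (M : Set Γ) (c : ℝ) {Y : Set (GroupBoundary S)}
    (ξ : Y → Gr d k) : Prop :=
  ∀ b : ℝ, ∃ K, 0 < K ∧ ∀ (x : Y) (h : ℕ → Γ), GapRay M h (x : GroupBoundary S) →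
    wordLength S (h 0) ≤ b → ∀ n, projDist (topPlane k (ρ (h n))) (ξ x).1 ≤ K * Real.exp (-c * n)

theorem eq_of_forall_projDist_le {V W : Submodule ℝ (EuclideanSpace ℝ (Fin d))} {K : ℝ} (hc : 0 < c)
    (h : ∀ n : ℕ, projDist V W ≤ K * Real.exp (-c * n)) : V = W := by
  refine eq_of_projDist_le_zero (ge_of_tendsto' (x := atTop) ?_ h)
  rw [← mul_zero K]
  refine Tendsto.const_mul _ (Real.tendsto_exp_atBot.comp ?_)
  exact (tendsto_const_mul_atBot_of_neg (neg_lt_zero.2 hc)).2 tendsto_natCast_atTop_atTop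

/-- The value at `x` is defined by one chosen ray. Another ray with the same end stays at bounded
distance from it, so the limits agree; that distance only enters the identification of the limits,
and the final constant depends on `b` alone. -/
theorem Dominates.exists_isRayLimit [ProperSpace (Cay S)] (hk : 1 ≤ k) (hkd : k < d)
    (hM : Dominates S k ρ M C c) {Y : Set (GroupBoundary S)}
    (hY : ∀ x ∈ Y, ∃ h : ℕ → Γ, GapRay M h x) : ∃ ξ : Y → Gr d k, IsRayLimit ρ M c ξ := by
  choose! e he using hY
  have hex : ∀ x : Y, ∃ W : Gr d k, ∃ K, 0 < K ∧
      ∀ n, projDist (topPlane k (ρ (e x n))) W.1 ≤ K * Real.exp (-c * n) := by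
    intro x
    obtain ⟨K, hK, hlim⟩ := hM.exists_limit hk hkd (wordLength S (e x 0))
    obtain ⟨W, hW, hle⟩ := hlim (e x) x (he x x.2) le_rfl
    exact ⟨⟨W, hW⟩, K, hK, hle⟩
  choose ξ hξ using hex
  refine ⟨ξ, fun b => ?_⟩
  obtain ⟨K, hK, hlim⟩ := hM.exists_limit hk hkd b
  refine ⟨K, hK, fun x h hh h0 => ?_⟩
  obtain ⟨W, hW, hle⟩ := hlim h x hh h0
  suffices W = (ξ x).1 by rwa [← this]
  obtain ⟨K', hK', hle'⟩ := hξ x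
  obtain ⟨r, hr, hrx⟩ := hh.1
  obtain ⟨r', hr', hrx'⟩ := (he x x.2).1
  obtain ⟨D, hD⟩ := GeodesicRay.endpoint_eq_iff.1 (hrx.trans hrx'.symm)
  obtain ⟨K'', -, hcmp⟩ := hM.exists_compare hk hkd b D
  refine eq_of_forall_projDist_le (c := c) (K := K + K'' + K') hM.2.1 fun n => ?_
  have h1 := (hcmp h x (e x n) n hh h0 (by rw [← hr, ← hr']; exact hD n)).2
  have h2 := hle n
  have h3 := hle' n
  have h4 := projDist_triangle W (topPlane k (ρ (h n))) (ξ x).1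
  have h5 := projDist_triangle (topPlane k (ρ (h n))) (topPlane k (ρ (e x n))) (ξ x).1
  rw [projDist_comm W (topPlane k (ρ (h n)))] at h4
  rw [projDist_comm] at h1
  linarith

theorem IsVertexRay.smul (hh : IsVertexRay S h x) (γ : Γ) :
    IsVertexRay S (fun n => γ * h n) (γ • x) := by
  obtain ⟨r, hr, rfl⟩ := hh
  exact ⟨⟨fun t => γ • r.1 t, (isometry_smul _ γ).comp r.2⟩,
    fun n => by change γ • r.1 n = _; rw [hr, smul_vertex], rfl⟩

theorem GapRay.smul (hh : GapRay M h x) (γ : Γ) : GapRay M (fun n => γ * h n) (γ • x) :=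
  ⟨hh.1.smul γ, fun i j hij => by
    rw [show (γ * h i)⁻¹ * (γ * h j) = (h i)⁻¹ * h j by group]
    exact hh.2 i j hij⟩

/-- Left translation keeps the increments of a gap ray, so `γ * h n` is a gap ray to `γ • x`. Its
top planes differ from the images of those of `h n` by a multiple of the vanishing gap. -/
theorem IsRayLimit.equivariant [ProperSpace (Cay S)] (hk : 1 ≤ k) (hkd : k < d)
    (hM : Dominates S k ρ M C c) {Y : Set (GroupBoundary S)} {ξ : Y → Gr d k}
    (hξ : IsRayLimit ρ M c ξ) (hY : ∀ x ∈ Y, ∃ h : ℕ → Γ, GapRay M h x) (γ : Γ) (x x' : Y)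
    (hx : (x' : GroupBoundary S) = γ • (x : GroupBoundary S)) :
    (ξ x').1 = (ξ x).1.map (euclideanMap (ρ γ)) := by
  obtain ⟨h, hh⟩ := hY x x.2
  obtain ⟨K₁, -, h1⟩ := hξ (wordLength S (h 0))
  obtain ⟨K₂, -, h2⟩ := hξ (wordLength S (γ * h 0))
  obtain ⟨K₃, -, h3⟩ := hM.exists_compare hk hkd (wordLength S (h 0)) 0
  have hc := condNum_nonneg (ρ γ)
  refine eq_of_forall_projDist_le (c := c)
    (K := K₂ + 3 * (condNum (ρ γ) * K₃) + 2 * (condNum (ρ γ) * K₁)) hM.2.1 fun n => ?_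
  have k1 := h1 x h hh le_rfl n
  have k2 := h2 x' (fun n => γ * h n) (hx ▸ hh.smul γ) le_rfl n
  have k3 := (h3 h x (h n) n hh le_rfl (by rw [dist_self])).1
  have k4 := projDist_map_topPlane hk hkd (ρ γ) (ρ (h n))
  have k5 := projDist_map_le (topPlane k (ρ (h n))) (ξ x).1 (ρ γ)
  rw [← map_mul] at k4
  have k6 := mul_le_mul_of_nonneg_left k1 hc
  have k7 := mul_le_mul_of_nonneg_left k3 hc
  have t1 := projDist_triangle (ξ x').1 (topPlane k (ρ (γ * h n))) ((ξ x).1.map (euclideanMap (ρ γ)))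
  have t2 := projDist_triangle (topPlane k (ρ (γ * h n)))
    ((topPlane k (ρ (h n))).map (euclideanMap (ρ γ))) ((ξ x).1.map (euclideanMap (ρ γ)))
  rw [projDist_comm] at k2 k4
  linarith

/-- Limit planes are close if the rays stay close for a long time. -/
theorem IsRayLimit.exists_projDist_le [ProperSpace (Cay S)] (hk : 1 ≤ k) (hkd : k < d)
    (hM : Dominates S k ρ M C c) {Y : Set (GroupBoundary S)} {ξ : Y → Gr d k}
    (hξ : IsRayLimit ρ M c ξ) (b D : ℝ) :
    ∃ K, 0 < K ∧ ∀ (x x' : Y) (h h' : ℕ → Γ) (n : ℕ), GapRay M h (x : GroupBoundary S) →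
      GapRay M h' (x' : GroupBoundary S) → wordLength S (h 0) ≤ b → wordLength S (h' 0) ≤ b →
      dist (vertex S (h n)) (vertex S (h' n)) ≤ D →
      projDist (ξ x).1 (ξ x').1 ≤ K * Real.exp (-c * n) := by
  obtain ⟨K₁, hK₁, h1⟩ := hξ b
  obtain ⟨K₂, hK₂, h2⟩ := hM.exists_compare hk hkd b D
  refine ⟨K₁ + K₂ + K₁, by positivity, fun x x' h h' n hh hh' h0 h0' hD => ?_⟩
  have k1 := h1 x h hh h0 n
  have k2 := h1 x' h' hh' h0' n
  have k3 := (h2 h x (h' n) n hh h0 hD).2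
  have t1 := projDist_triangle (ξ x).1 (topPlane k (ρ (h n))) (ξ x').1
  have t2 := projDist_triangle (topPlane k (ρ (h n))) (topPlane k (ρ (h' n))) (ξ x').1
  rw [projDist_comm] at k1 k3
  linarith

/-! ### Fellow-travelling rays: Hölder bounds and the Cartan property -/

variable {δ : ℝ}

theorem IsVertexRay.dist_ray_le (hX : IsDeltaHyperbolic (Cay S) δ) (hδ : 0 ≤ δ)
    (hh : IsVertexRay S h x) {b : ℝ} (h0 : _root_.wordLength S (h 0) ≤ b) {r : GeodesicRay (Cay S)}
    (hr0 : r.1 0 = vertex S 1) (hr : r.endpoint = x) (n : ℕ) :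
    Dist.dist (vertex S (h n)) (r.1 n) ≤ 4 * b + 4 * (3 * δ + 2) := by
  obtain ⟨r', hr', hrx'⟩ := hh
  obtain ⟨D, hD⟩ := GeodesicRay.endpoint_eq_iff.1 (hrx'.trans hr.symm)
  rw [← hr']
  have hb : 0 ≤ b := (wordLength_nonneg _).trans h0
  have e0 : r'.1 0 = vertex S (h 0) := by simpa using hr' 0
  exact (hX.fourPoint hδ).asymptotic_close (by positivity) r'.2 r.2 hD (p := vertex S 1)
    (by rw [e0]; exact h0) (by rw [hr0, dist_self]; exact hb) n

/-- Rays stay close at every time `T` below the Gromov product of their ends, so the limit planes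
differ by a multiple of `exp (-c T)`. Comparing with `exp (-κ T)` gives a power of the visual
distance. -/
theorem IsRayLimit.exists_holder (hX : IsDeltaHyperbolic (Cay S) δ) (hδ : 0 ≤ δ) (hk : 1 ≤ k)
    (hkd : k < d) (hM : Dominates S k ρ M C c) {Y : Set (GroupBoundary S)} {ξ : Y → Gr d k}
    (hξ : IsRayLimit ρ M c ξ) {κ : ℝ} {dv : GroupBoundary S → GroupBoundary S → ℝ}
    (hv : IsVisualMetric (vertex S 1) κ dv) (b : ℝ) :
    ∃ K, 0 < K ∧ ∀ (x x' : Y) (h h' : ℕ → Γ), GapRay M h (x : GroupBoundary S) →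
      GapRay M h' (x' : GroupBoundary S) → wordLength S (h 0) ≤ b → wordLength S (h' 0) ≤ b →
      projDist (ξ x).1 (ξ x').1 ≤ K * dv x x' ^ (min c κ / κ) := by
  have := hX.1
  obtain ⟨c₁, c₂, hc₁, hc₂, hle⟩ := hv.comparable
  obtain ⟨K, hK, hcl⟩ := hξ.exists_projDist_le hk hkd hM b
    (4 * b + 4 * (3 * δ + 2) + (12 * (3 * δ + 2) + 4) + (4 * b + 4 * (3 * δ + 2)))
  have hc : 0 < c := hM.2.1
  have hκ := hv.pos
  -- Lowering the rate from `c` to at most `κ` weakens the bound, since times are nonnegative, and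
  -- makes the Hölder exponent at most one.
  set α := min c κ with hα
  have hα0 : 0 < α := lt_min hc hκ
  have hcα : α ≤ c := min_le_left _ _
  -- The factor `Real.exp c` pays for rounding `T` down to an integer; the lower bound two makes the
  -- normalized distance at most one.
  set K' := max (K * Real.exp c) 2 with hK'
  have hK'0 : 0 < K' := lt_max_of_lt_right two_pos
  refine ⟨K' * Real.exp α * (c₁⁻¹) ^ (α / κ), by positivity, fun x x' h h' hh hh' h0 h0' => ?_⟩
  have hdv : 0 ≤ dv x x' := (mul_nonneg hc₁.le (expGromov_nonneg _ _ _ _)).trans (hle _ _).1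
  by_cases hxx : (x : GroupBoundary S) = x'
  · rw [Subtype.ext hxx, projDist_self]
    have : 0 ≤ dv x' x' := by rwa [hxx] at hdv
    positivity
  have hne : boundaryGromovProduct (vertex S 1) (x : GroupBoundary S) x' ≠ ⊤ :=
    fun h => hxx ((hX.boundaryGromovProduct_eq_top_iff hδ).1 h)
  obtain ⟨r, hr0, hr⟩ := hX.exists_ray hδ (vertex S 1) (x : GroupBoundary S)
  obtain ⟨r', hr0', hr'⟩ := hX.exists_ray hδ (vertex S 1) (x' : GroupBoundary S)
  have key := le_expGromov_rpow hκ hne (A := projDist (ξ x).1 (ξ x').1 / K') (α := α)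
    (fun T hT => by
      set n := ⌊T⌋₊ with hn
      have hnT : (n : ℝ≥0) ≤ T := Nat.floor_le (zero_le)
      have hTn : (T : ℝ) ≤ n + 1 := by exact_mod_cast (Nat.lt_floor_add_one T).le
      have hd : dist (r.1 n) (r'.1 n) ≤ 12 * (3 * δ + 2) + 4 := by
        refine (hX.fourPoint hδ).dist_le_of_lt (by positivity) hr0 hr0' (T := n) ?_
        rw [hr, hr']
        exact lt_of_le_of_lt (ENNReal.coe_le_coe.2 hnT) hT
      have h1 := hh.1.dist_ray_le hX hδ h0 hr0 hr n
      have h2 := hh'.1.dist_ray_le hX hδ h0' hr0' hr' n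
      rw [dist_comm] at h2
      have h3 := hcl x x' h h' n hh hh' h0 h0' ((dist_triangle4 _ _ _ _).trans
        (add_le_add (add_le_add h1 hd) h2))
      rw [div_le_iff₀ hK'0]
      have h4 : Real.exp (-c * n) ≤ Real.exp c * Real.exp (-α * T) := by
        rw [← Real.exp_add]
        refine Real.exp_le_exp.2 ?_
        have : α * T ≤ c * T := mul_le_mul_of_nonneg_right hcα T.2
        nlinarith
      calc _ ≤ K * Real.exp (-c * n) := h3
        _ ≤ K * (Real.exp c * Real.exp (-α * T)) := mul_le_mul_of_nonneg_left h4 hK.le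
        _ = (K * Real.exp c) * Real.exp (-α * T) := by ring
        _ ≤ K' * Real.exp (-α * T) :=
          mul_le_mul_of_nonneg_right (le_max_left _ _) (Real.exp_nonneg _)
        _ = _ := mul_comm _ _)
    (div_le_one_of_le₀ ((projDist_le_two _ _).trans (le_max_right _ _)) hK'0.le) hα0.le
  rw [div_le_iff₀ hK'0] at key
  have h5 : expGromov (vertex S 1) κ (x : GroupBoundary S) x' ≤ c₁⁻¹ * dv x x' := by
    rw [le_inv_mul_iff₀ hc₁]
    exact (hle _ _).1
  have h6 := Real.rpow_le_rpow (expGromov_nonneg _ _ _ _) h5 (div_pos hα0 hκ).le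
  rw [Real.mul_rpow (inv_nonneg.2 hc₁.le) hdv] at h6
  calc _ ≤ Real.exp α * expGromov (vertex S 1) κ (x : GroupBoundary S) x' ^ (α / κ) * K' := key
    _ ≤ Real.exp α * (c₁⁻¹ ^ (α / κ) * dv x x' ^ (α / κ)) * K' := by gcongr
    _ = _ := by ring

/-- The Cartan property for sequences near gap rays. -/
theorem IsRayLimit.tendsto (hX : IsDeltaHyperbolic (Cay S) δ) (hδ : 0 ≤ δ) (hk : 1 ≤ k)
    (hkd : k < d) (hM : Dominates S k ρ M C c) {Y : Set (GroupBoundary S)} {ξ : Y → Gr d k}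
    (hξ : IsRayLimit ρ M c ξ) (hY : ∀ x ∈ Y, ∃ h : ℕ → Γ, GapRay M h x) {D : ℝ} {γ : ℕ → Γ}
    (hγ : ∀ n, ∃ (h : ℕ → Γ) (x : Y) (m : ℕ), GapRay M h (x : GroupBoundary S) ∧
      wordLength S (h 0) ≤ D ∧ dist (vertex S (h m)) (vertex S (γ n)) ≤ D) {x : Y}
    (hx : GroupTendsto γ (x : GroupBoundary S)) :
    Tendsto (fun n => gapRatio k (ρ (γ n))) atTop (𝓝 0) ∧
      Tendsto (fun n => projDist (topPlane k (ρ (γ n))) (ξ x).1) atTop (𝓝 0) := by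
  have := hX.1
  have h4 := hX.fourPoint hδ
  have hc : 0 < c := hM.2.1
  obtain ⟨h', hh'⟩ := hY x x.2
  obtain ⟨r, hr0, hr⟩ := hX.exists_ray hδ (vertex S 1) (x : GroupBoundary S)
  set b := max D (wordLength S (h' 0)) with hb
  have hb0 : 0 ≤ b := (wordLength_nonneg _).trans (le_max_right _ _)
  obtain ⟨K₁, hK₁, hcmp⟩ := hM.exists_compare hk hkd b D
  obtain ⟨K₂, hK₂, hlim⟩ := hξ b
  obtain ⟨K₃, hK₃, hcl⟩ := hξ.exists_projDist_le hk hkd hM b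
    (3 * b + 4 * (3 * δ + 2) + (4 * b + 4 * (3 * δ + 2)))
  have key : ∀ T : ℕ, ∀ᶠ n in atTop, gapRatio k (ρ (γ n)) ≤ K₁ * Real.exp (-c * T) ∧
      projDist (topPlane k (ρ (γ n))) (ξ x).1 ≤ (K₁ + K₂ + K₃) * Real.exp (-c * T) := by
    intro T
    -- The time `T'` exceeds `T` by all losses to come: convergence of `γ n`, its distance from the
    -- ray `h`, and the starting point of `h`. Thus `h` has reached `γ n` only after time `T`, and
    -- at time `T` it still follows the ray to `x`. The planes are compared through `h m` and the
    -- limit at the end of `h`.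
    obtain ⟨T', hT'⟩ := exists_nat_ge (T + (4 * (3 * δ + 2) + 2) + D + b)
    have hev := h4.eventually_gromovProduct (by positivity) hr0 (hr ▸ hx) T'
    filter_upwards [hev] with n hn
    obtain ⟨h, x', m, hh, h0, hm⟩ := hγ n
    have hD0 : 0 ≤ D := (wordLength_nonneg _).trans h0
    have h0b : wordLength S (h 0) ≤ b := h0.trans (le_max_left _ _)
    have g1 : (T : ℝ) + b ≤ gromovProduct (vertex S 1) (vertex S (h m)) (r.1 T') := by
      have e1 := gromovProduct_le_add_dist (vertex S 1) (r.1 T') (vertex S (γ n)) (vertex S (h m))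
      rw [gromovProduct_comm _ (r.1 T'), gromovProduct_comm _ (r.1 T'), dist_comm] at e1
      rw [NNReal.coe_natCast] at hn
      linarith
    obtain ⟨r', hr', -⟩ := hh.1
    have hr0' : dist (r'.1 0) (vertex S 1) ≤ b := by
      rw [show r'.1 0 = vertex S (h 0) by simpa using hr' 0]
      exact h0b
    have g2 : (T : ℝ) ≤ m := by
      have e1 := (g1.trans (gromovProduct_le_left _ _ _))
      rw [← hr'] at e1
      have e2 := _root_.dist_ray_le r'.2 hr0' m
      rw [NNReal.coe_natCast] at e2
      linarith
    have g3 : (T : ℝ) - b ≤ gromovProduct (vertex S 1) (vertex S (h T)) (vertex S (h m)) := by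
      have := gromovProduct_ray r'.2 hr0' (s := T) (t := m) (by exact_mod_cast g2)
      rw [hr', hr'] at this
      exact this
    have hTT' : T ≤ T' := by
      have : (T : ℝ) ≤ T' := by linarith
      exact_mod_cast this
    have g4 : (T : ℝ) ≤ gromovProduct (vertex S 1) (r.1 T') (r.1 T) := by
      rw [gromovProduct_comm, r.gromovProduct_eq hr0 (by exact_mod_cast hTT')]
      simp
    have g5 := h4.three (t := (T : ℝ) - b) g3 (by linarith) (by linarith) (by positivity)
    have g6 : dist (vertex S (h T)) (vertex S 1) ≤ T + b := by
      have := _root_.dist_ray_le r'.2 hr0' T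
      rwa [hr', NNReal.coe_natCast] at this
    have g7 : dist (r.1 T) (vertex S 1) ≤ T + 0 := by
      rw [r.dist_zero hr0]
      simp
    have g8 := dist_le_of_gromovProduct (t := T) (e := b + 2 * (3 * δ + 2)) g6 g7 (by linarith)
    have g9 := hh'.1.dist_ray_le hX hδ (le_max_right _ _ : _ ≤ b) hr0 hr T
    have g10 := hcl x' x h h' T hh hh' h0b (le_max_right _ _) (by
      have := dist_triangle (vertex S (h T)) (r.1 T) (vertex S (h' T))
      rw [dist_comm (r.1 T)] at this
      linarith)
    obtain ⟨g11, g12⟩ := hcmp h x' (γ n) m hh h0b hm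
    have g13 := hlim x' h hh h0b m
    have hexp : Real.exp (-c * m) ≤ Real.exp (-c * T) :=
      Real.exp_le_exp.2 (by nlinarith)
    have t1 := projDist_triangle (topPlane k (ρ (γ n))) (topPlane k (ρ (h m))) (ξ x).1
    have t2 := projDist_triangle (topPlane k (ρ (h m))) (ξ x').1 (ξ x).1
    have m1 := mul_le_mul_of_nonneg_left hexp hK₁.le
    have m2 := mul_le_mul_of_nonneg_left hexp hK₂.le
    exact ⟨by linarith, by linarith⟩
  have hexp : ∀ K : ℝ, Tendsto (fun T : ℕ => K * Real.exp (-c * T)) atTop (𝓝 0) := fun K => by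
    rw [← mul_zero K]
    refine Tendsto.const_mul _ (Real.tendsto_exp_atBot.comp ?_)
    exact (tendsto_const_mul_atBot_of_neg (neg_lt_zero.2 hc)).2 tendsto_natCast_atTop_atTop
  constructor
  · refine tendsto_order.2 ⟨fun a ha => Eventually.of_forall fun n =>
      ha.trans_le (gapRatio_nonneg _ _), fun a ha => ?_⟩
    obtain ⟨T, hT⟩ := ((tendsto_order.1 (hexp K₁)).2 a ha).exists
    exact (key T).mono fun n hn => hn.1.trans_lt hT
  · refine tendsto_order.2 ⟨fun a ha => Eventually.of_forall fun n =>
      ha.trans_le (projDist_nonneg _ _), fun a ha => ?_⟩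
    obtain ⟨T, hT⟩ := ((tendsto_order.1 (hexp (K₁ + K₂ + K₃))).2 a ha).exists
    exact (key T).mono fun n hn => hn.2.trans_lt hT

end GapRays

/-! ### Lines through vertices -/

section VertexLines

open Cay

variable {Γ : Type*} [Group Γ] {S : FinSymmGenSet Γ} {δ : ℝ}

/-- `g` runs along the vertices of a bi-infinite geodesic from `y` to `x`. -/
def IsVertexLine (S : FinSymmGenSet Γ) (g : ℤ → Γ) (x y : GroupBoundary S) : Prop :=
  ∃ l : ℝ → Cay S, IsLine l x y ∧ ∀ n : ℤ, l n = vertex S (g n)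

variable {g : ℤ → Γ} {x y : GroupBoundary S}

/-- Every line runs through vertices, up to a small shift. -/
theorem IsLine.exists_isVertexLine {l : ℝ → Cay S} (h : IsLine l x y) :
    ∃ (g : ℤ → Γ) (τ : ℝ), 0 ≤ τ ∧ τ ≤ 2 ∧ IsVertexLine S g x y ∧
      ∀ n : ℤ, l (τ + n) = vertex S (g n) := by
  obtain ⟨hl, -, -⟩ := id h
  obtain ⟨v, hv⟩ := exists_dist_vertex_le (l 0)
  have hcont : ContinuousOn (fun t => dist (l t) (vertex S v)) (Icc 0 2) :=
    (hl.continuous.dist continuous_const).continuousOn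
  have h2 : 1 ≤ dist (l 2) (vertex S v) := by
    have h3 := dist_triangle_right (l 2) (l 0) (vertex S v)
    have h4 : dist (l 2) (l 0) = 2 := by rw [hl.dist_eq]; norm_num [Real.dist_eq]
    linarith
  -- Where the distance from the vertex `v` equals one, the line is at a vertex; all points at
  -- integer distance from it along the line are then vertices too.
  obtain ⟨τ, ⟨h0, hτ⟩, h1⟩ := intermediate_value_Icc zero_le_two hcont ⟨hv, h2⟩
  obtain ⟨v', hv'⟩ := exists_eq_vertex (m := 1) (by exact_mod_cast h1)
  have hex : ∀ n : ℤ, ∃ w, l (τ + n) = vertex S w := fun n =>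
    exists_eq_vertex (g := v') (m := |n|) (by
      rw [← hv', hl.dist_eq, Real.dist_eq, add_sub_cancel_left, Int.cast_abs])
  choose g hg using hex
  exact ⟨g, τ, h0, hτ, ⟨_, h.shift τ, fun n => by rw [add_comm]; exact hg n⟩, hg⟩

theorem IsVertexLine.smul (h : IsVertexLine S g x y) (γ : Γ) :
    IsVertexLine S (fun n => γ * g n) (γ • x) (γ • y) := by
  obtain ⟨l, hl, hg⟩ := h
  exact ⟨_, hl.smul γ, fun n => by rw [hg, smul_vertex]⟩

theorem IsVertexLine.shift (h : IsVertexLine S g x y) (m : ℤ) :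
    IsVertexLine S (fun n => g (n + m)) x y := by
  obtain ⟨l, hl, hg⟩ := h
  exact ⟨_, hl.shift m, fun n => by rw [← hg]; push_cast; rfl⟩

theorem IsVertexLine.reverse (h : IsVertexLine S g x y) :
    IsVertexLine S (fun n => g (-n)) y x := by
  obtain ⟨l, hl, hg⟩ := h
  exact ⟨_, hl.reverse, fun n => by rw [← hg]; push_cast; rfl⟩

theorem IsVertexLine.isVertexRay (h : IsVertexLine S g x y) :
    IsVertexRay S (fun n : ℕ => g n) x := by
  obtain ⟨l, ⟨hl, hx, -⟩, hg⟩ := h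
  exact ⟨_, fun n => hg n, hx⟩

theorem IsVertexLine.wordLength (h : IsVertexLine S g x y) {i j : ℤ} (hij : i ≤ j) :
    wordLength S ((g i)⁻¹ * g j) = j - i := by
  obtain ⟨l, ⟨hl, -, -⟩, hg⟩ := h
  rw [← dist_vertex, ← hg, ← hg, hl.dist_eq, dist_comm, Real.dist_eq, abs_of_nonneg]
  exact sub_nonneg.2 (Int.cast_le.2 hij)

theorem IsVertexLine.groupTendsto (h : IsVertexLine S g x y) (h0 : g 0 = 1) :
    GroupTendsto (fun n : ℕ => g n) x := by
  obtain ⟨r, hr, rfl⟩ := h.isVertexRay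
  have := convergesTo_ray (c := r) (p := vertex S 1) (by simpa [h0] using hr 0)
  unfold GroupTendsto
  simpa only [hr] using this

/-! ### Lines with ends in `P` -/

variable {P : Set (GroupBoundary S × GroupBoundary S)}

/-- Translation by `(g i)⁻¹` makes the line pass through the identity and keeps its ends in `P` by
invariance. Hence all forward increments are dominated, not only those that start at the identity.
-/
theorem IsVertexLine.inv_mul_mem (h : IsVertexLine S g x y) (hP : IsClosedInvariant P)
    (hxy : (x, y) ∈ P) {i j : ℤ} (hij : i ≤ j) : (g i)⁻¹ * g j ∈ gammaPlus P 1 0 0 := by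
  obtain ⟨l, hl, hg⟩ := (h.shift i).smul (g i)⁻¹
  have hiso : Isometry l := hl.choose
  refine ⟨l, ⟨fun s t => ?_, ?_, _, _, hl.forwardEnd, hl.backwardEnd, hP.invariant _ _ _ hxy⟩,
    (j - i : ℤ), ?_, ?_⟩
  · rw [hiso.dist_eq, Real.dist_eq]
    simp
  · have := hg 0
    rw [Int.cast_zero] at this
    rw [this]
    simp
  · exact_mod_cast sub_nonneg.2 hij
  · rw [hg]
    simp

theorem IsVertexLine.gapRay (h : IsVertexLine S g x y) (hP : IsClosedInvariant P)
    (hxy : (x, y) ∈ P) : GapRay (gammaPlus P 1 0 0) (fun n : ℕ => g n) x :=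
  ⟨h.isVertexRay, fun _ _ hij => h.inv_mul_mem hP hxy (Int.ofNat_le.2 hij)⟩

theorem IsVertexLine.gapRay_reverse (h : IsVertexLine S g x y) (hP : IsClosedInvariant P)
    (hxy : (x, y) ∈ P) : GapRay (gammaPlus P 1 0 0)⁻¹ (fun n : ℕ => g (-n)) y :=
  ⟨h.reverse.isVertexRay, fun i j hij => by
    rw [Set.mem_inv, mul_inv_rev, inv_inv]
    exact h.inv_mul_mem hP hxy (neg_le_neg (Int.ofNat_le.2 hij))⟩

theorem IsDeltaHyperbolic.exists_isLine (hX : IsDeltaHyperbolic (Cay S) δ) (hδ : 0 ≤ δ)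
    (hxy : x ≠ y) : ∃ l : ℝ → Cay S, IsLine l x y := by
  obtain ⟨r, hr, rfl⟩ := hX.exists_ray hδ (vertex S 1) x
  obtain ⟨r', hr', rfl⟩ := hX.exists_ray hδ (vertex S 1) y
  obtain ⟨T, hT⟩ := (hX.fourPoint hδ).exists_gromovProduct_le (by positivity) hr hr' hxy
  exact ⟨_, (hX.exists_line hδ hr hr' hT).choose_spec.1⟩

theorem IsDeltaHyperbolic.exists_isVertexLine (hX : IsDeltaHyperbolic (Cay S) δ) (hδ : 0 ≤ δ)
    (hxy : x ≠ y) : ∃ g : ℤ → Γ, IsVertexLine S g x y := by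
  obtain ⟨l, hl⟩ := hX.exists_isLine hδ hxy
  obtain ⟨g, -, -, -, hg, -⟩ := hl.exists_isVertexLine
  exact ⟨g, hg⟩

/-- Quasi-geodesics that pass near the identity are close to lines that pass near the identity. -/
theorem IsDeltaHyperbolic.exists_isVertexLine_near (hX : IsDeltaHyperbolic (Cay S) δ) (hδ : 0 ≤ δ)
    {lam ε : ℝ} (hlam : 1 ≤ lam) (hε : 0 ≤ ε) (b : ℝ) :
    ∃ D, ∀ (l : ℝ → Cay S) (x y : GroupBoundary S), IsQuasiGeodesic lam ε l → ForwardEnd l x →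
      BackwardEnd l y → x ≠ y → dist (l 0) (vertex S 1) ≤ b →
      ∃ g : ℤ → Γ, IsVertexLine S g x y ∧ _root_.wordLength S (g 0) ≤ D ∧
        ∀ t, 0 ≤ t → ∃ m : ℕ, dist (vertex S (g m)) (l t) ≤ D := by
  obtain ⟨D, hD0, hD⟩ := hX.exists_quasiGeodesic_near_line hδ hlam hε
  refine ⟨max b 0 + D + 2, fun l x y hl hx hy hxy hb => ?_⟩
  have hb0 : 0 ≤ max b 0 := le_max_right _ _
  have hbb : b ≤ max b 0 := le_max_left _ _
  obtain ⟨l', hl'⟩ := hX.exists_isLine hδ hxy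
  obtain ⟨s₀, hs₀, hnear⟩ := hD l l' x y hl hx hy hl'
  obtain ⟨g, τ, h0, h2, hg, hgl⟩ := (hl'.shift s₀).exists_isVertexLine
  have hiso : Isometry l' := hl'.choose
  refine ⟨g, hg, ?_, fun t ht => ?_⟩
  · change dist (vertex S (g 0)) (vertex S 1) ≤ _
    rw [← hgl 0]
    have h3 := dist_triangle4 (l' (τ + (0 : ℤ) + s₀)) (l' s₀) (l 0) (vertex S 1)
    have h4 : dist (l' (τ + (0 : ℤ) + s₀)) (l' s₀) = τ := by
      rw [hiso.dist_eq, Real.dist_eq, Int.cast_zero, add_zero, add_sub_cancel_right, abs_of_nonneg h0]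
    rw [dist_comm (l' s₀)] at h3
    linarith
  · obtain ⟨s, hs, hst⟩ := hnear t ht
    -- Rounding down costs less than one. If the natural floor truncates a negative number, `s₀ ≤ s`
    -- and `τ ≤ 2` limit the loss to two.
    refine ⟨⌊s - s₀ - τ⌋₊, ?_⟩
    rw [← hgl, dist_comm]
    have h3 := dist_triangle (l t) (l' s) (l' (τ + ((⌊s - s₀ - τ⌋₊ : ℕ) : ℤ) + s₀))
    have h4 : dist (l' s) (l' (τ + ((⌊s - s₀ - τ⌋₊ : ℕ) : ℤ) + s₀)) ≤ 2 := by
      rw [hiso.dist_eq, Real.dist_eq, Int.cast_natCast, abs_le]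
      rcases le_total 0 (s - s₀ - τ) with hpos | hneg
      · have h5 := Nat.floor_le hpos
        have h6 := Nat.lt_floor_add_one (s - s₀ - τ)
        constructor <;> linarith
      · rw [Nat.floor_of_nonpos hneg, Nat.cast_zero]
        constructor <;> linarith
    linarith

theorem exists_near_of_mem_gammaPlus (hX : IsDeltaHyperbolic (Cay S) δ) (hδ : 0 ≤ δ)
    (hP : IsClosedInvariant P) {lam ε : ℝ} (hlam : 1 ≤ lam) (hε : 0 ≤ ε) (b : ℝ) :
    ∃ D, ∀ γ ∈ gammaPlus P lam ε b, ∃ (g : ℤ → Γ) (x y : GroupBoundary S) (m : ℕ), (x, y) ∈ P ∧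
      IsVertexLine S g x y ∧ wordLength S (g 0) ≤ D ∧
        dist (vertex S (g m)) (vertex S γ) ≤ D := by
  obtain ⟨D, hD⟩ := hX.exists_isVertexLine_near hδ hlam hε b
  refine ⟨D, ?_⟩
  rintro γ ⟨l, ⟨hl, hl0, x, y, hx, hy, hxy⟩, t, ht, hlt⟩
  obtain ⟨g, hg, hg0, hnear⟩ := hD l x y hl hx hy (hP.ne _ hxy) hl0
  obtain ⟨m, hm⟩ := hnear t ht
  exact ⟨g, x, y, m, hxy, hg, hg0, hlt ▸ hm⟩

theorem exists_near_of_mem_forwardEnds (hX : IsDeltaHyperbolic (Cay S) δ) (hδ : 0 ≤ δ)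
    (hP : IsClosedInvariant P) {lam ε : ℝ} (hlam : 1 ≤ lam) (hε : 0 ≤ ε) (b : ℝ) :
    ∃ D, ∀ x ∈ forwardEnds P lam ε b, ∃ (g : ℤ → Γ) (y : GroupBoundary S), (x, y) ∈ P ∧
      IsVertexLine S g x y ∧ wordLength S (g 0) ≤ D := by
  obtain ⟨D, hD⟩ := hX.exists_isVertexLine_near hδ hlam hε b
  refine ⟨D, ?_⟩
  rintro x ⟨l, ⟨hl, hl0, x', y, hx', hy, hxy⟩, hx⟩
  obtain rfl := hx.unique hx'
  obtain ⟨g, hg, hg0, -⟩ := hD l x y hl hx hy (hP.ne _ hxy) hl0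
  exact ⟨g, y, hxy, hg, hg0⟩

/-- Pairs of points that are not too close are joined by a line that passes near the identity. -/
theorem IsDeltaHyperbolic.exists_isVertexLine_of_le (hX : IsDeltaHyperbolic (Cay S) δ)
    (hδ : 0 ≤ δ) {κ : ℝ} {dv : GroupBoundary S → GroupBoundary S → ℝ}
    (hv : IsVisualMetric (vertex S 1) κ dv) {m : ℝ} (hm : 0 < m) :
    ∃ b, ∀ x y : GroupBoundary S, m ≤ dv x y →
      ∃ g : ℤ → Γ, IsVertexLine S g x y ∧ _root_.wordLength S (g 0) ≤ b := by
  obtain ⟨c₁, c₂, hc₁, hc₂, hle⟩ := hv.comparable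
  have h4 := hX.fourPoint hδ
  -- Beyond this value of the Gromov product the upper comparison bound for `dv` would fall below
  -- `m`.
  set T := -Real.log (m / c₂) / κ + 2 * (3 * δ + 2) with hT
  refine ⟨max T 0 + 2 * δ + 2 + 2, fun x y hxy => ?_⟩
  obtain ⟨r, hr, rfl⟩ := hX.exists_ray hδ (vertex S 1) x
  obtain ⟨r', hr', rfl⟩ := hX.exists_ray hδ (vertex S 1) y
  have hgp : ∀ s t, gromovProduct (vertex S 1) (r.1 s) (r'.1 t) ≤ max T 0 := by
    intro s t
    by_contra! hcon
    have hτ0 : 0 ≤ gromovProduct (vertex S 1) (r.1 s) (r'.1 t) :=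
      (le_max_right T 0).trans hcon.le
    set τ : ℝ≥0 := ⟨gromovProduct (vertex S 1) (r.1 s) (r'.1 t), hτ0⟩
    have h1 := h4.dist_ray_le (by positivity) hr hr' (s := s) (t := t) (τ := τ) le_rfl
    have h2 := expGromov_le hv.pos.le (ofReal_le_boundaryGromovProduct hr hr' h1)
    have h3 : m / c₂ ≤ Real.exp (-κ * (τ - 4 * (3 * δ + 2) / 2)) := by
      rw [div_le_iff₀' hc₂]
      exact (hxy.trans (hle _ _).2).trans (mul_le_mul_of_nonneg_left h2 hc₂.le)
    rw [← Real.log_le_iff_le_exp (by positivity)] at h3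
    have h5 : T < τ := (le_max_left T 0).trans_lt hcon
    have h6 : κ * (T - 2 * (3 * δ + 2)) = -Real.log (m / c₂) := by
      rw [hT, add_sub_cancel_right, mul_div_cancel₀ _ hv.pos.ne']
    nlinarith [mul_lt_mul_of_pos_left h5 hv.pos]
  obtain ⟨l, hl, hl0⟩ := hX.exists_line hδ hr hr' hgp
  obtain ⟨g, τ, h0, h2, hg, hgl⟩ := hl.exists_isVertexLine
  refine ⟨g, hg, ?_⟩
  change dist (vertex S (g 0)) (vertex S 1) ≤ _
  rw [← hgl 0]
  have hiso : Isometry l := hl.choose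
  have h3 := dist_triangle (l (τ + (0 : ℤ))) (l 0) (vertex S 1)
  have h5 : dist (l (τ + (0 : ℤ))) (l 0) = τ := by
    rw [hiso.dist_eq, Real.dist_eq, Int.cast_zero, add_zero, sub_zero, abs_of_nonneg h0]
  linarith

theorem IsClosedInvariant.mem_of_tendsto (hP : IsClosedInvariant P)
    {q : ℕ → GroupBoundary S × GroupBoundary S} (hq : ∀ n, q n ∈ P) (hxy : x ≠ y)
    (hlim : Tendsto q atTop (𝓝 (x, y))) : (x, y) ∈ P := by
  have : Tendsto (fun n => (⟨q n, hP.ne _ (hq n)⟩ :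
      {q : GroupBoundary S × GroupBoundary S // q.1 ≠ q.2})) atTop (𝓝 ⟨(x, y), hxy⟩) :=
    tendsto_subtype_rng.2 hlim
  exact hP.closed.mem_of_tendsto this (Eventually.of_forall hq)

/-- Lines through the identity subconverge. -/
theorem exists_subseq_isVertexLine [ProperSpace (Cay S)] (hP : IsClosedInvariant P)
    {g : ℕ → ℤ → Γ} {x y : ℕ → GroupBoundary S} (hg : ∀ n, IsVertexLine S (g n) (x n) (y n))
    (hxy : ∀ n, (x n, y n) ∈ P) (h0 : ∀ n, g n 0 = 1) :
    ∃ (φ : ℕ → ℕ) (x' y' : GroupBoundary S), StrictMono φ ∧ (x', y') ∈ P ∧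
      Tendsto (fun n => (x (φ n), y (φ n))) atTop (𝓝 (x', y')) ∧
      GroupTendsto (fun n => g (φ n) (φ n)) x' ∧ GroupTendsto (fun n => g (φ n) (-(φ n))) y' := by
  choose l hl hlg using hg
  have hiso : ∀ n, Isometry (l n) := fun n => (hl n).choose
  have hl0 : ∀ n, l n 0 = vertex S 1 := fun n => by
    have := hlg n 0
    rwa [h0, Int.cast_zero] at this
  obtain ⟨φ, L, hφ, hpt, hunif⟩ := exists_subseq_tendsto_of_dist_le l
    (fun n a b => ((hiso n).dist_eq a b).le) 0 (vertex S 1) 0 (fun n => by rw [hl0, dist_self])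
  have hL : Isometry L := Isometry.of_dist_eq fun s t =>
    tendsto_nhds_unique ((hpt s).dist (hpt t))
      (tendsto_const_nhds.congr fun n => ((hiso (φ n)).dist_eq s t).symm)
  have hL0 : L 0 = vertex S 1 :=
    tendsto_nhds_unique (hpt 0) (tendsto_const_nhds.congr fun n => (hl0 _).symm)
  have huf : ∀ K : Set ℝ≥0, IsCompact K → TendstoUniformlyOn
      (fun n => (fwdRay (l (φ n)) (hiso _)).1) (fwdRay L hL).1 atTop K := by
    intro K hK u hu
    filter_upwards [hunif _ (hK.image NNReal.continuous_coe) u hu] with n hn t ht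
    exact hn t (mem_image_of_mem _ ht)
  have hub : ∀ K : Set ℝ≥0, IsCompact K → TendstoUniformlyOn
      (fun n => (bwdRay (l (φ n)) (hiso _)).1) (bwdRay L hL).1 atTop K := by
    intro K hK u hu
    filter_upwards [hunif _ (hK.image NNReal.continuous_coe.neg) u hu] with n hn t ht
    exact hn (-t) (mem_image_of_mem (fun t : ℝ≥0 => -(t : ℝ)) ht)
  have hf0 : ∀ n, (fwdRay (l (φ n)) (hiso _)).1 0 = vertex S 1 := fun n => hl0 _
  have hb0 : ∀ n, (bwdRay (l (φ n)) (hiso _)).1 0 = vertex S 1 := fun n => by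
    change l (φ n) (-((0 : ℝ≥0) : ℝ)) = _
    rw [NNReal.coe_zero, neg_zero, hl0]
  have hF0 : (fwdRay L hL).1 0 = vertex S 1 := hL0
  have hB0 : (bwdRay L hL).1 0 = vertex S 1 := by
    change L (-((0 : ℝ≥0) : ℝ)) = _
    rw [NNReal.coe_zero, neg_zero, hL0]
  -- `P` is closed only among pairs of distinct points. The limit is again a line, so its ends are
  -- distinct and the pair stays in `P`.
  have hline : IsLine L (fwdRay L hL).endpoint (bwdRay L hL).endpoint := ⟨hL, rfl, rfl⟩
  have hx : ∀ n, (fwdRay (l n) (hiso n)).endpoint = x n := fun n => (hl n).choose_spec.1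
  have hy : ∀ n, (bwdRay (l n) (hiso n)).endpoint = y n := fun n => (hl n).choose_spec.2
  have hlim : Tendsto (fun n => (x (φ n), y (φ n))) atTop
      (𝓝 ((fwdRay L hL).endpoint, (bwdRay L hL).endpoint)) := by
    have h1 := (convergesTo_ends_of_rays hf0 hF0 huf).tendsto
    have h2 := (convergesTo_ends_of_rays hb0 hB0 hub).tendsto
    simp only [hx, hy] at h1 h2
    exact h1.prodMk_nhds h2
  refine ⟨φ, _, _, hφ, hP.mem_of_tendsto (fun n => hxy (φ n)) hline.ne hlim, hlim, ?_, ?_⟩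
  · have := convergesTo_of_rays hf0 hF0 huf (R := fun n : ℕ => (φ n : ℝ≥0))
      (tendsto_natCast_atTop_atTop.comp hφ.tendsto_atTop)
    unfold GroupTendsto
    have e : ∀ n, (fwdRay (l (φ n)) (hiso _)).1 (φ n) = vertex S (g (φ n) (φ n)) :=
      fun n => hlg (φ n) (φ n)
    simpa only [e] using this
  · have := convergesTo_of_rays hb0 hB0 hub (R := fun n : ℕ => (φ n : ℝ≥0))
      (tendsto_natCast_atTop_atTop.comp hφ.tendsto_atTop)
    unfold GroupTendsto
    have e : ∀ n, (bwdRay (l (φ n)) (hiso _)).1 (φ n) = vertex S (g (φ n) (-(φ n))) := fun n => by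
      rw [← hlg]
      push_cast
      rfl
    simpa only [e] using this

end VertexLines

/-! ### Transversality -/

section Transversality

open Module Cay

variable {d k : ℕ}

/-- Doubling argument: positive numbers that decay under doubling beat every exponential bound. -/
theorem false_of_doubling {f : ℤ → ℕ → ℝ} {K c a B : ℝ} (hc : 0 < c) (hK : 0 < K)
    (hf : ∀ j n, 0 < f j n) (h1 : ∀ j, f j 1 ≤ Real.exp B)
    (hlow : ∀ j (n : ℕ), Real.exp (-a * n) ≤ f j n)
    (hdbl : ∀ j (n : ℕ), f j (2 * n) ≤ K * Real.exp (-c * n) * (f (j + n) n * f j n)) : False := by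
  set A := Real.log K with hA
  -- After division by the length `2 ^ i`, each doubling lowers the exponent by `c / 2`. It
  -- therefore tends to `-∞` and crosses the fixed lower rate `-a`.
  have key : ∀ (i : ℕ) j, f j (2 ^ i) ≤ Real.exp (2 ^ i * (B + A - c * i / 2) - A) := by
    intro i
    induction i with
    | zero =>
      intro j
      refine (h1 j).trans (Real.exp_le_exp.2 ?_)
      norm_num
    | succ i ih =>
      intro j
      rw [pow_succ']
      refine (hdbl j _).trans ?_
      rw [← Real.exp_log hK, ← hA, ← Real.exp_add]
      refine (mul_le_mul_of_nonneg_left (mul_le_mul (ih _) (ih j) (hf _ _).le (Real.exp_nonneg _))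
        (Real.exp_nonneg _)).trans ?_
      rw [← Real.exp_add, ← Real.exp_add]
      refine Real.exp_le_exp.2 (le_of_eq ?_)
      push_cast
      ring
  obtain ⟨i, hi⟩ := exists_nat_gt (2 * (a + |A| + |A| + B) / c)
  rw [div_lt_iff₀ hc] at hi
  have h2 := Real.exp_le_exp.1 ((hlow 0 (2 ^ i)).trans (key i 0))
  push_cast at h2
  have h3 : (1 : ℝ) ≤ 2 ^ i := one_le_pow₀ one_le_two
  have h4 := le_abs_self A
  have h5 := neg_abs_le A
  nlinarith [abs_nonneg A]

theorem sigma_one_mul_le (hd : 0 < d) (A B : GL (Fin d) ℝ) :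
    sigma 1 (A * B) ≤ sigma 1 A * sigma 1 B := sigma_mul_le_left B A hd

variable {Γ : Type*} [Group Γ] {S : FinSymmGenSet Γ} {ρ : Γ →* GL (Fin d) ℝ} {δ C c : ℝ}
  {P : Set (GroupBoundary S × GroupBoundary S)}

theorem Dominates.inv (hk : 1 ≤ k) (hkd : k < d) {M : Set Γ} (hM : Dominates S k ρ M C c) :
    Dominates S (d - k) ρ M⁻¹ C c :=
  ⟨hM.1, hM.2.1, fun γ hγ => by
    have := hM.2.2 _ hγ
    rwa [wordLength_inv, map_inv, ← gapRatio_inv hk hkd, inv_inv] at this⟩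

theorem IsVertexLine.sigma_le {g : ℤ → Γ} {x y : GroupBoundary S} (hg : IsVertexLine S g x y)
    (hd : 0 < d) {L : ℝ} (hL : 1 ≤ L) (hρ : ∀ s, _root_.wordLength S s ≤ 1 → sigma 1 (ρ s) ≤ L)
    (j : ℤ) (n : ℕ) : sigma 1 (ρ ((g (j + n))⁻¹ * g j)) ≤ L ^ n := by
  induction n with
  | zero =>
    refine sigma_le_of_forall (j := 0) hd (W := ⊤) (by simp) fun v _ => ?_
    simp [euclideanMap_one]
  | succ n ih =>
    have e : (g (j + (n + 1 : ℕ)))⁻¹ * g j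
        = ((g (j + (n + 1 : ℕ)))⁻¹ * g (j + n)) * ((g (j + n))⁻¹ * g j) := by group
    rw [e, map_mul, pow_succ']
    refine (sigma_one_mul_le hd _ _).trans (mul_le_mul (hρ _ ?_) ih (sigma_nonneg _ _) (by linarith))
    have := hg.wordLength (i := j + n) (j := j + (n + 1 : ℕ)) (by push_cast; omega)
    rw [← wordLength_inv, mul_inv_rev, inv_inv, this]
    push_cast
    linarith

theorem exists_gapRay_fst (hX : IsDeltaHyperbolic (Cay S) δ) (hδ : 0 ≤ δ)
    (hP : IsClosedInvariant P) : ∀ x ∈ Pi₁ P, ∃ h : ℕ → Γ, GapRay (gammaPlus P 1 0 0) h x := by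
  rintro x ⟨y, hxy⟩
  obtain ⟨g, hg⟩ := hX.exists_isVertexLine hδ (hP.ne _ hxy)
  exact ⟨_, hg.gapRay hP hxy⟩

theorem exists_gapRay_snd (hX : IsDeltaHyperbolic (Cay S) δ) (hδ : 0 ≤ δ)
    (hP : IsClosedInvariant P) : ∀ y ∈ Pi₂ P, ∃ h : ℕ → Γ, GapRay (gammaPlus P 1 0 0)⁻¹ h y := by
  rintro y ⟨x, hxy⟩
  obtain ⟨g, hg⟩ := hX.exists_isVertexLine hδ (hP.ne _ hxy)
  exact ⟨_, hg.gapRay_reverse hP hxy⟩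

/-- A common vector makes the product of the top `k` singular values over a segment of the line drop
exponentially at every midpoint. Doubling then gives super-exponential decay, whereas each letter
changes this product by a bounded factor. -/
theorem disjoint_of_isRayLimit (hX : IsDeltaHyperbolic (Cay S) δ) (hδ : 0 ≤ δ) (hk : 1 ≤ k)
    (hkd : k < d) (hP : IsClosedInvariant P) (hM : Dominates S k ρ (gammaPlus P 1 0 0) C c)
    {ξ : Pi₁ P → Gr d k} {η : Pi₂ P → Gr d (d - k)} (hξ : IsRayLimit ρ (gammaPlus P 1 0 0) c ξ)
    (hη : IsRayLimit ρ (gammaPlus P 1 0 0)⁻¹ c η) {x : Pi₁ P} {y : Pi₂ P}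
    (hxy : ((x : GroupBoundary S), (y : GroupBoundary S)) ∈ P) : Disjoint (ξ x).1 (η y).1 := by
  have := hX.1
  obtain ⟨hC, hc, hdom⟩ := id hM
  have hM' := hM.inv hk hkd
  obtain ⟨g, hg⟩ := hX.exists_isVertexLine hδ (hP.ne _ hxy)
  obtain ⟨K₁, hK₁, h1⟩ := hξ 0
  obtain ⟨K₂, hK₂, h2⟩ := hη 0
  obtain ⟨K, hK, hvol⟩ := exists_sigmaProd_mul_le hk hkd
  obtain ⟨L, hL, hLb⟩ := exists_le_of_wordLength_le (S := S) (fun s => sigma 1 (ρ s)) 1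
  obtain ⟨B, hB, hBb⟩ := exists_le_of_wordLength_le (S := S) (fun s => sigmaProd k (ρ s)) 1
  rw [Submodule.disjoint_def]
  intro v hv hv'
  by_contra hne
  refine false_of_doubling (f := fun j n => sigmaProd k (ρ ((g j)⁻¹ * g (j + n)))) (c := c)
    (K := K * (K₁ + K₂ + C + C)) (a := k * Real.log L) (B := Real.log B) hc (by positivity)
    (fun j n => sigmaProd_pos hkd.le _) (fun j => ?_) (fun j n => ?_) (fun j n => ?_)
  · rw [Real.exp_log (by linarith)]
    refine hBb _ ?_
    rw [hg.wordLength (by push_cast; omega)]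
    push_cast
    linarith
  · refine le_trans ?_ (sigmaProd_ge hkd.le _)
    have h3 := hg.sigma_le (by omega) hL hLb j n
    have h4 : ρ ((g (j + n))⁻¹ * g j) = (ρ ((g j)⁻¹ * g (j + n)))⁻¹ := by
      rw [← map_inv, mul_inv_rev, inv_inv]
    rw [h4] at h3
    have hL0 : 0 < L := by linarith
    have h5 : Real.exp (-(k * Real.log L) * n) = (L ^ n)⁻¹ ^ k := by
      rw [← Real.exp_log hL0, ← Real.exp_nat_mul, ← Real.exp_neg, ← Real.exp_nat_mul, Real.log_exp]
      congr 1
      ring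
    rw [h5]
    have h6 : 0 < sigma 1 (ρ ((g j)⁻¹ * g (j + n)))⁻¹ := sigma_pos _ (i := 0) (by omega)
    exact pow_le_pow_left₀ (by positivity) (inv_anti₀ h6 h3) k
  -- The segment of length `2 * n` is cut at its midpoint `m`, and the line is translated so that `g
  -- m` becomes the identity. By equivariance the transported vector `w` lies in both limit planes
  -- of the translated line. It is thus close to the attracting plane of the second half and to the
  -- repelling plane of the first.
  · set m : ℤ := j + n with hm
    have hxm : (g m)⁻¹ • (x : GroupBoundary S) ∈ Pi₁ P := ⟨_, hP.invariant _ _ _ hxy⟩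
    have hym : (g m)⁻¹ • (y : GroupBoundary S) ∈ Pi₂ P := ⟨_, hP.invariant _ _ _ hxy⟩
    have eξ := hξ.equivariant hk hkd hM (exists_gapRay_fst hX hδ hP) (g m)⁻¹ x ⟨_, hxm⟩ rfl
    have eη := hη.equivariant (by omega) (by omega) hM' (exists_gapRay_snd hX hδ hP) (g m)⁻¹ y
      ⟨_, hym⟩ rfl
    set w := euclideanMap (ρ (g m)⁻¹) v
    have hw0 : w ≠ 0 := fun h => hne (euclideanMap_injective _ (by rw [map_zero]; exact h))
    have hw1 : w ∈ (ξ ⟨_, hxm⟩).1 := by rw [eξ]; exact Submodule.mem_map_of_mem hv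
    have hw2 : w ∈ (η ⟨_, hym⟩).1 := by rw [eη]; exact Submodule.mem_map_of_mem hv'
    have hl : IsVertexLine S (fun i => (g m)⁻¹ * g (i + m)) ((g m)⁻¹ • (x : GroupBoundary S))
      ((g m)⁻¹ • (y : GroupBoundary S)) := (hg.shift m).smul _
    have hP' := hP.invariant (g m)⁻¹ _ _ hxy
    have k1 := h1 ⟨_, hxm⟩ _ (hl.gapRay hP hP') (by simp [wordLength_one]) n
    have k2 := h2 ⟨_, hym⟩ _ (hl.gapRay_reverse hP hP') (by simp [wordLength_one]) n
    rw [projDist_comm] at k1 k2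
    have hu1 : ‖‖w‖⁻¹ • w‖ = 1 := norm_smul_inv_norm hw0
    have n1 := ((nearPlane_projDist _ _).mono k1) _ (Submodule.smul_mem _ ‖w‖⁻¹ hw1)
    have n2 := ((nearPlane_projDist _ _).mono k2) _ (Submodule.smul_mem _ ‖w‖⁻¹ hw2)
    rw [hu1, mul_one] at n1 n2
    have e1 : (g m)⁻¹ * g (n + m) = (g m)⁻¹ * g (m + n) := by rw [add_comm]
    have e2 : ρ ((g m)⁻¹ * g (-n + m)) = (ρ ((g j)⁻¹ * g m))⁻¹ := by
      rw [← map_inv, mul_inv_rev, inv_inv, hm, show (-(n:ℤ) + (j + n)) = j by ring]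
    have e3 : ρ ((g j)⁻¹ * g (j + (2 * n : ℕ))) = ρ ((g j)⁻¹ * g m) * ρ ((g m)⁻¹ * g (m + n)) := by
      rw [← map_mul, hm]
      congr 1
      rw [show j + ((2 * n : ℕ) : ℤ) = j + n + n by push_cast; ring]
      group
    rw [e1] at n1
    rw [e2] at n2
    have r1 := hdom _ (hg.inv_mul_mem hP hxy (i := m) (j := m + n) (by omega))
    have r2 := hdom _ (hg.inv_mul_mem hP hxy (i := j) (j := m) (by omega))
    rw [hg.wordLength (by omega)] at r1 r2
    have e4 : ((m + n : ℤ) : ℝ) - (m : ℤ) = n := by push_cast; ring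
    have e5 : ((m : ℤ) : ℝ) - (j : ℤ) = n := by rw [hm]; push_cast; ring
    rw [e4] at r1
    rw [e5] at r2
    rw [e3]
    refine (hvol _ _ _ _ _ hu1 n1 n2).trans (mul_le_mul_of_nonneg_right ?_
      (mul_nonneg (sigmaProd_nonneg _ _) (sigmaProd_nonneg _ _)))
    rw [mul_assoc]
    refine mul_le_mul_of_nonneg_left ?_ hK.le
    linarith

/-! ### Dynamics -/

theorem exists_le_norm_sub_starProjection {V W : Submodule ℝ (EuclideanSpace ℝ (Fin d))}
    (h : Disjoint V W) : ∃ a : ℝ, 0 < a ∧ ∀ v ∈ V, a * ‖v‖ ≤ ‖v - W.starProjection v‖ := by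
  let f : V →ₗ[ℝ] EuclideanSpace ℝ (Fin d) :=
    (LinearMap.id - (W.starProjection : EuclideanSpace ℝ (Fin d) →ₗ[ℝ] _)) ∘ₗ V.subtype
  have hf : ∀ v : V, f v = v - W.starProjection v := fun v => rfl
  obtain ⟨K, hK, hanti⟩ := f.exists_antilipschitzWith (LinearMap.ker_eq_bot'.2 fun v hv => by
    rw [hf, sub_eq_zero] at hv
    exact Subtype.ext (Submodule.disjoint_def.1 h v v.2
      (Submodule.starProjection_eq_self_iff.1 hv.symm)))
  refine ⟨(K : ℝ)⁻¹, inv_pos.2 hK, fun v hv => ?_⟩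
  have := hanti.le_mul_dist ⟨v, hv⟩ 0
  rw [dist_zero_right, map_zero, dist_zero_right, hf] at this
  rw [inv_mul_le_iff₀ (by exact_mod_cast hK)]
  exact this

theorem le_norm_sub_starProjection_of_projDist_le {V W W' : Submodule ℝ (EuclideanSpace ℝ (Fin d))}
    {a : ℝ} (h : ∀ v ∈ V, a * ‖v‖ ≤ ‖v - W.starProjection v‖) (hW : projDist W' W ≤ a / 2)
    {v : EuclideanSpace ℝ (Fin d)} (hv : v ∈ V) : a / 2 * ‖v‖ ≤ ‖v - W'.starProjection v‖ := by
  have h1 := h v hv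
  have h2 := (W'.starProjection - W.starProjection).le_of_opNorm_le hW v
  have h3 := norm_sub_le_norm_sub_add_norm_sub v (W'.starProjection v) (W.starProjection v)
  rw [sub_apply] at h2
  linarith

/-- Subspaces transverse to the repelling plane are attracted. -/
theorem exists_nearPlane_map (hk : 1 ≤ k) (hkd : k < d) {A : ℕ → GL (Fin d) ℝ}
    {U V W : Submodule ℝ (EuclideanSpace ℝ (Fin d))} (hVW : Disjoint V W)
    (hU : Tendsto (fun n => projDist (topPlane k (A n)) U) atTop (𝓝 0))
    (hW : Tendsto (fun n => projDist (topPlane (d - k) (A n)⁻¹) W) atTop (𝓝 0))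
    (hr : Tendsto (fun n => gapRatio k (A n)) atTop (𝓝 0)) :
    ∃ ε : ℕ → ℝ, (∀ n, 0 ≤ ε n) ∧ Tendsto ε atTop (𝓝 0) ∧
      ∀ᶠ n in atTop, NearPlane (ε n) (V.map (euclideanMap (A n))) U := by
  obtain ⟨a, ha, hV⟩ := exists_le_norm_sub_starProjection hVW
  refine ⟨fun n => (a / 2)⁻¹ * gapRatio k (A n) + projDist (topPlane k (A n)) U, fun n =>
    add_nonneg (mul_nonneg (by positivity) (gapRatio_nonneg _ _)) (projDist_nonneg _ _), ?_, ?_⟩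
  · simpa using (hr.const_mul (a / 2)⁻¹).add hU
  · filter_upwards [(tendsto_order.1 hW).2 (a / 2) (by positivity)] with n hn
    rintro _ ⟨v, hv, rfl⟩
    have h1 := le_norm_sub_starProjection_of_projDist_le hV hn.le hv
    have h2 := norm_sub_topPlane_le_of_far hk hkd (half_pos ha) h1
    have h3 := ((topPlane k (A n)).starProjection - U.starProjection).le_opNorm
      (euclideanMap (A n) v)
    have h4 := norm_sub_le_norm_sub_add_norm_sub (euclideanMap (A n) v)
      ((topPlane k (A n)).starProjection (euclideanMap (A n) v))
      (U.starProjection (euclideanMap (A n) v))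
    rw [sub_apply] at h3
    rw [add_mul]
    exact h4.trans (add_le_add h2 h3)

theorem tendsto_projDist_map (hk : 1 ≤ k) (hkd : k < d) {A : ℕ → GL (Fin d) ℝ}
    {U V W : Submodule ℝ (EuclideanSpace ℝ (Fin d))} (hVW : Disjoint V W)
    (hUV : finrank ℝ V = finrank ℝ U)
    (hU : Tendsto (fun n => projDist (topPlane k (A n)) U) atTop (𝓝 0))
    (hW : Tendsto (fun n => projDist (topPlane (d - k) (A n)⁻¹) W) atTop (𝓝 0))
    (hr : Tendsto (fun n => gapRatio k (A n)) atTop (𝓝 0)) :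
    Tendsto (fun n => projDist (V.map (euclideanMap (A n))) U) atTop (𝓝 0) := by
  obtain ⟨ε, h0, hε, hnear⟩ := exists_nearPlane_map hk hkd hVW hU hW hr
  refine tendsto_of_tendsto_of_tendsto_of_le_of_le' tendsto_const_nhds
    (by simpa using hε.const_mul 3) (Eventually.of_forall fun n => projDist_nonneg _ _) ?_
  filter_upwards [hnear] with n hn
  exact hn.projDist_le_of_finrank_eq (h0 n) (by rw [finrank_map_euclideanMap, hUV])

theorem tendsto_grDist_of_projDist {V : ℕ → Submodule ℝ (EuclideanSpace ℝ (Fin d))}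
    {W : Submodule ℝ (EuclideanSpace ℝ (Fin d))} (hV : ∀ n, V n ≠ ⊥) (hW : W ≠ ⊥)
    (h : Tendsto (fun n => projDist (V n) W) atTop (𝓝 0)) :
    Tendsto (fun n => grDist (V n) W) atTop (𝓝 0) :=
  squeeze_zero (fun _ => grDist_nonneg _ _) (fun n => grDist_le_projDist (hV n) hW) h

theorem tendsto_projDist_of_grDist {V : ℕ → Submodule ℝ (EuclideanSpace ℝ (Fin d))}
    {W : Submodule ℝ (EuclideanSpace ℝ (Fin d))} (hV : ∀ n, V n ≠ ⊥) (hW : W ≠ ⊥)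
    (h : Tendsto (fun n => grDist (V n) W) atTop (𝓝 0)) :
    Tendsto (fun n => projDist (V n) W) atTop (𝓝 0) :=
  squeeze_zero (fun _ => projDist_nonneg _ _) (fun n => projDist_le_grDist (hV n) hW)
    (by simpa using h.const_mul 2)

/-- A nonzero vector cannot be close to two transverse subspaces. -/
theorem exists_le_norm_sub_add_norm_sub {V W : Submodule ℝ (EuclideanSpace ℝ (Fin d))}
    (h : Disjoint V W) : ∃ a : ℝ, 0 < a ∧ ∀ v, a * ‖v‖ ≤
      ‖v - V.starProjection v‖ + ‖v - W.starProjection v‖ := by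
  obtain ⟨a, ha, hV⟩ := exists_le_norm_sub_starProjection h
  refine ⟨a / (1 + a), by positivity, fun v => ?_⟩
  have h1 := hV _ (V.starProjection_apply_mem v)
  have h2 := norm_sub_starProjection_le W (V.starProjection v) (W.starProjection_apply_mem v)
  have h3 := norm_sub_le_norm_sub_add_norm_sub (V.starProjection v) v (W.starProjection v)
  rw [norm_sub_rev _ v] at h3
  have h4 := norm_sub_norm_le v (V.starProjection v)
  rw [div_mul_eq_mul_div, div_le_iff₀ (by positivity)]
  nlinarith [norm_nonneg (v - W.starProjection v)]

end Transversality

/-! ### The pair of limit maps -/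

section LimitPair

open Module Cay

variable {Γ : Type*} [Group Γ] {S : FinSymmGenSet Γ} {d k : ℕ} {ρ : Γ →* GL (Fin d) ℝ}
  {δ C c : ℝ} {P : Set (GroupBoundary S × GroupBoundary S)} {ξ : Pi₁ P → Gr d k}
  {η : Pi₂ P → Gr d (d - k)}

theorem tendsto_topPlane_of_mem_gammaPlus (hX : IsDeltaHyperbolic (Cay S) δ) (hδ : 0 ≤ δ)
    (hk : 1 ≤ k) (hkd : k < d) (hP : IsClosedInvariant P)
    (hM : Dominates S k ρ (gammaPlus P 1 0 0) C c) (hξ : IsRayLimit ρ (gammaPlus P 1 0 0) c ξ)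
    {lam ε b : ℝ} (hlam : 1 ≤ lam) (hε : 0 ≤ ε) {γ : ℕ → Γ} (hγ : ∀ n, γ n ∈ gammaPlus P lam ε b)
    {x : Pi₁ P} (hx : GroupTendsto γ (x : GroupBoundary S)) :
    Tendsto (fun n => gapRatio k (ρ (γ n))) atTop (𝓝 0) ∧
      Tendsto (fun n => projDist (topPlane k (ρ (γ n))) (ξ x).1) atTop (𝓝 0) := by
  obtain ⟨D, hD⟩ := exists_near_of_mem_gammaPlus hX hδ hP hlam hε b
  refine hξ.tendsto hX hδ hk hkd hM (exists_gapRay_fst hX hδ hP) (D := D) (fun n => ?_) hx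
  obtain ⟨g, x', y', m, hxy, hg, h0, hm⟩ := hD _ (hγ n)
  exact ⟨_, ⟨x', y', hxy⟩, m, hg.gapRay hP hxy, by simpa using h0, hm⟩

/-- A line that starts near the identity and passes near `γ n`, translated by `(γ n)⁻¹` and
reversed, starts near the identity and passes near `(γ n)⁻¹`. So the inverses lie near gap rays for
the inverse set. -/
theorem tendsto_topPlane_inv_of_mem_gammaPlus (hX : IsDeltaHyperbolic (Cay S) δ) (hδ : 0 ≤ δ)
    (hk : 1 ≤ k) (hkd : k < d) (hP : IsClosedInvariant P)
    (hM : Dominates S k ρ (gammaPlus P 1 0 0) C c) (hη : IsRayLimit ρ (gammaPlus P 1 0 0)⁻¹ c η)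
    {lam ε b : ℝ} (hlam : 1 ≤ lam) (hε : 0 ≤ ε) {γ : ℕ → Γ} (hγ : ∀ n, γ n ∈ gammaPlus P lam ε b)
    {y : Pi₂ P} (hy : GroupTendsto (fun n => (γ n)⁻¹) (y : GroupBoundary S)) :
    Tendsto (fun n => projDist (topPlane (d - k) (ρ (γ n))⁻¹) (η y).1) atTop (𝓝 0) := by
  obtain ⟨D, hD⟩ := exists_near_of_mem_gammaPlus hX hδ hP hlam hε b
  have := (hη.tendsto hX hδ (by omega) (by omega) (hM.inv hk hkd) (exists_gapRay_snd hX hδ hP)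
    (D := D) (γ := fun n => (γ n)⁻¹) (fun n => ?_) hy).2
  · simpa only [map_inv] using this
  obtain ⟨g, x', y', m, hxy, hg, h0, hm⟩ := hD _ (hγ n)
  have hi := hP.invariant (γ n)⁻¹ _ _ hxy
  refine ⟨_, ⟨_, _, hi⟩, m, ((hg.shift m).smul (γ n)⁻¹).gapRay_reverse hP hi, ?_, ?_⟩
  · simp only [Nat.cast_zero, neg_zero, zero_add]
    rw [← dist_vertex, dist_comm (vertex S (γ n))]
    exact hm
  · simp only [neg_add_cancel]
    rw [← smul_vertex, ← mul_one (γ n)⁻¹, ← smul_vertex (γ n)⁻¹ 1, mul_one, dist_smul]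
    exact h0

theorem isCompl_of_disjoint (hkd : k ≤ d) {V W : Submodule ℝ (EuclideanSpace ℝ (Fin d))}
    (hV : finrank ℝ V = k) (hW : finrank ℝ W = d - k) (h : Disjoint V W) : IsCompl V W := by
  refine ⟨h, codisjoint_iff.2 (Submodule.eq_top_of_finrank_eq ?_)⟩
  have := Submodule.finrank_sup_add_finrank_inf_eq V W
  rw [h.eq_bot, finrank_bot, hV, hW, add_zero] at this
  rw [this, finrank_euclideanSpace_fin]
  omega

/-- On pairs of boundary points that are far apart, the limits over gap rays depend Hölder
continuously on the endpoints. -/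
theorem exists_holder_of_le (hX : IsDeltaHyperbolic (Cay S) δ) (hδ : 0 ≤ δ)
    (hk : 1 ≤ k) (hkd : k < d) (hP : IsClosedInvariant P)
    (hM : Dominates S k ρ (gammaPlus P 1 0 0) C c) (hξ : IsRayLimit ρ (gammaPlus P 1 0 0) c ξ)
    (hη : IsRayLimit ρ (gammaPlus P 1 0 0)⁻¹ c η) {κ : ℝ}
    {dv : GroupBoundary S → GroupBoundary S → ℝ} (hv : IsVisualMetric (vertex S 1) κ dv) {m : ℝ}
    (hm : 0 < m) :
    ∃ K, 0 < K ∧ ∀ (x x' : Pi₁ P) (y y' : Pi₂ P),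
      ((x : GroupBoundary S), (y : GroupBoundary S)) ∈ P →
      ((x' : GroupBoundary S), (y' : GroupBoundary S)) ∈ P → m ≤ dv x y → m ≤ dv x' y' →
      grDist (ξ x).1 (ξ x').1 ≤ K * dv x x' ^ (min c κ / κ) ∧
      grDist (η y).1 (η y').1 ≤ K * dv y y' ^ (min c κ / κ) := by
  obtain ⟨b, hb⟩ := hX.exists_isVertexLine_of_le hδ hv hm
  obtain ⟨K₁, hK₁, h1⟩ := hξ.exists_holder hX hδ hk hkd hM hv b
  obtain ⟨K₂, hK₂, h2⟩ := hη.exists_holder hX hδ (by omega) (by omega) (hM.inv hk hkd) hv b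
  have hdv : ∀ a b, 0 ≤ dv a b := fun a b => by
    linarith [hv.triangle a b a, hv.symm a b, (hv.eq_zero_iff a a).2 rfl]
  refine ⟨max K₁ K₂, lt_max_of_lt_left hK₁, fun x x' y y' hxy hxy' hle hle' => ?_⟩
  obtain ⟨g, hg, hg0⟩ := hb _ _ hle
  obtain ⟨g', hg', hg0'⟩ := hb _ _ hle'
  constructor
  · refine (grDist_le_projDist (ne_bot_of_finrank hk (ξ x).2) (ne_bot_of_finrank hk (ξ x').2)).trans
      ((h1 x x' _ _ (hg.gapRay hP hxy) (hg'.gapRay hP hxy') (by simpa) (by simpa)).trans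
        (mul_le_mul_of_nonneg_right (le_max_left _ _) (Real.rpow_nonneg (hdv _ _) _)))
  · refine (grDist_le_projDist (ne_bot_of_finrank (by omega) (η y).2)
      (ne_bot_of_finrank (by omega) (η y').2)).trans
      ((h2 y y' _ _ (hg.gapRay_reverse hP hxy) (hg'.gapRay_reverse hP hxy') (by simpa)
        (by simpa)).trans
        (mul_le_mul_of_nonneg_right (le_max_right _ _) (Real.rpow_nonneg (hdv _ _) _)))

theorem isLimitPair_of_isRayLimit (hX : IsDeltaHyperbolic (Cay S) δ) (hδ : 0 ≤ δ)
    (hk : 1 ≤ k) (hkd : k < d) (hP : IsClosedInvariant P)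
    (hM : Dominates S k ρ (gammaPlus P 1 0 0) C c) (hξ : IsRayLimit ρ (gammaPlus P 1 0 0) c ξ)
    (hη : IsRayLimit ρ (gammaPlus P 1 0 0)⁻¹ c η) : IsLimitPair ρ P ξ η := by
  have := hX.1
  refine ⟨fun γ x x' hx => hξ.equivariant hk hkd hM (exists_gapRay_fst hX hδ hP) γ x x' hx,
    fun γ y y' hy => hη.equivariant (by omega) (by omega) (hM.inv hk hkd)
      (exists_gapRay_snd hX hδ hP) γ y y' hy, fun q => ?_, fun x y hxy => ?_, ?_⟩
  · obtain ⟨κ₀, hκ₀, hvis⟩ := hX.exists_isVisualMetric hδ (vertex S (1 : Γ))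
    have hv := hvis κ₀ hκ₀ le_rfl
    set dv := chainDist (vertex S (1 : Γ)) κ₀
    have hcont : Continuous fun q : GroupBoundary S × GroupBoundary S => dv q.1 q.2 :=
      hX.continuous_visual hδ hv
    have hdv : ∀ a b, 0 ≤ dv a b := fun a b => by
      linarith [hv.triangle a b a, hv.symm a b, (hv.eq_zero_iff a a).2 rfl]
    have hq : 0 < dv q.1.1 q.1.2 := lt_of_le_of_ne (hdv _ _) fun h =>
      hP.ne _ q.2 ((hv.eq_zero_iff _ _).1 h.symm)
    -- Pairs near `q` keep at least half of its visual separation, so one Hölder constant serves a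
    -- whole neighbourhood of `q`.
    obtain ⟨K, hK, hH⟩ := exists_holder_of_le hX hδ hk hkd hP hM hξ hη hv (half_pos hq)
    have hα : 0 < min c κ₀ / κ₀ := div_pos (lt_min hM.2.1 hv.pos) hv.pos
    have hev : ∀ᶠ q' : P in 𝓝 q, dv q.1.1 q.1.2 / 2 ≤ dv q'.1.1 q'.1.2 :=
      ((hcont.comp continuous_subtype_val).tendsto q).eventually (eventually_ge_nhds (half_lt_self hq))
    have lim : ∀ (f : P → GroupBoundary S), Continuous f →
        Tendsto (fun q' : P => K * dv (f q') (f q) ^ (min c κ₀ / κ₀)) (𝓝 q) (𝓝 0) := by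
      intro f hf
      have h1 : Tendsto (fun q' : P => dv (f q') (f q)) (𝓝 q) (𝓝 0) := by
        have := (hcont.comp (hf.prodMk (continuous_const (y := f q)))).tendsto q
        rwa [Function.comp_apply, (hv.eq_zero_iff (f q) (f q)).2 rfl] at this
      have h2 := (h1.rpow_const (p := min c κ₀ / κ₀) (Or.inr hα.le)).const_mul K
      rwa [Real.zero_rpow hα.ne', mul_zero] at h2
    have h1 := lim (fun q => q.1.1) (continuous_fst.comp continuous_subtype_val)
    have h2 := lim (fun q => q.1.2) (continuous_snd.comp continuous_subtype_val)
    have h3 := h1.max h2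
    rw [max_self] at h3
    refine squeeze_zero' (Eventually.of_forall fun q' => (grDist_nonneg _ _).trans (le_max_left _ _))
      (hev.mono fun q' hq' => ?_) h3
    obtain ⟨e1, e2⟩ := hH ⟨q'.1.1, q'.1.2, q'.2⟩ ⟨q.1.1, q.1.2, q.2⟩ ⟨q'.1.2, q'.1.1, q'.2⟩
      ⟨q.1.2, q.1.1, q.2⟩ q'.2 q.2 hq' (half_le_self hq.le)
    exact max_le_max e1 e2
  · exact isCompl_of_disjoint hkd.le (ξ x).2 (η y).2
      (disjoint_of_isRayLimit hX hδ hk hkd hP hM hξ hη hxy)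
  · intro lam ε b hlam hε _ γ x y hγ hx hy V hV
    obtain ⟨hr, hU⟩ := tendsto_topPlane_of_mem_gammaPlus hX hδ hk hkd hP hM hξ hlam hε hγ hx
    have hW := tendsto_topPlane_inv_of_mem_gammaPlus hX hδ hk hkd hP hM hη hlam hε hγ hy
    refine tendsto_grDist_of_projDist (fun n => ne_bot_of_finrank hk ?_)
      (ne_bot_of_finrank hk (ξ x).2)
      (tendsto_projDist_map hk hkd hV.disjoint (V.2.trans (ξ x).2.symm) hU hW hr)
    rw [finrank_map_euclideanMap, V.2]

/-- The first map of a pair of limit maps is determined by its dynamics. -/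
theorem IsLimitPair.fst_eq_of_isVertexLine [ProperSpace (Cay S)] (hk : 1 ≤ k) (hkd : k < d)
    (hP : IsClosedInvariant P) {ξ' : Pi₁ P → Gr d k} {η' : Pi₂ P → Gr d (d - k)}
    (h : IsLimitPair ρ P ξ η) (h' : IsLimitPair ρ P ξ' η') {g : ℤ → Γ} {x y : GroupBoundary S}
    (hg : IsVertexLine S g x y) (h0 : g 0 = 1) (hxy : (x, y) ∈ P) :
    ξ' ⟨x, y, hxy⟩ = ξ ⟨x, y, hxy⟩ := by
  -- The line recentred at its `n`-th vertex passes through `(g n)⁻¹` at time `-n`. A limit of the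
  -- recentred lines provides the point `y₁` to which the inverses converge.
  obtain ⟨φ, x₁, y₁, hφ, hxy₁, -, -, hy₁⟩ := exists_subseq_isVertexLine hP
    (g := fun n j => (g n)⁻¹ * g (j + n)) (fun n => (hg.shift n).smul (g n)⁻¹)
    (fun n => hP.invariant _ _ _ hxy) (fun n => by simp)
  simp only [neg_add_cancel, h0, mul_one] at hy₁
  have hmem : ∀ n, g (φ n : ℕ) ∈ gammaPlus P 1 0 0 := fun n => by
    simpa [h0] using hg.inv_mul_mem hP hxy (i := 0) (j := (φ n : ℕ)) (by positivity)
  have hx := (hg.groupTendsto h0).subseq hφ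
  -- With `V` transverse to both repelling planes, the images of one and the same plane converge to
  -- both values.
  obtain ⟨V, hV, hV'⟩ := exists_common_isCompl (η ⟨y₁, x₁, hxy₁⟩).1 (η' ⟨y₁, x₁, hxy₁⟩).1
    ((η _).2.trans (η' _).2.symm)
  have hVk : finrank ℝ V = k := by
    have := Submodule.finrank_add_eq_of_isCompl hV
    rw [(η _).2, finrank_euclideanSpace_fin] at this
    omega
  have hne : ∀ n, V.map (euclideanMap (ρ (g (φ n : ℕ)))) ≠ ⊥ := fun n =>
    ne_bot_of_finrank hk (by rw [finrank_map_euclideanMap, hVk])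
  have t1 := tendsto_projDist_of_grDist hne (ne_bot_of_finrank hk (ξ _).2)
    (h.dynamics 1 0 0 le_rfl le_rfl le_rfl _ ⟨x, y, hxy⟩ ⟨y₁, x₁, hxy₁⟩ hmem hx hy₁ ⟨V, hVk⟩ hV)
  have t2 := tendsto_projDist_of_grDist hne (ne_bot_of_finrank hk (ξ' _).2)
    (h'.dynamics 1 0 0 le_rfl le_rfl le_rfl _ ⟨x, y, hxy⟩ ⟨y₁, x₁, hxy₁⟩ hmem hx hy₁ ⟨V, hVk⟩ hV')
  have t := t2.add t1
  rw [add_zero] at t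
  refine Subtype.ext (eq_of_projDist_le_zero (ge_of_tendsto t (Eventually.of_forall fun n => ?_)))
  rw [projDist_comm _ (ξ' _).1]
  exact projDist_triangle _ _ _

/-- Push a vector of `η' y` outside `η y` forward by the inverses of the vertices `g (-n)`. It is
attracted to `ξ x₁`. It also stays in the translates of `η' y`, which converge to `η' y₁` by
continuity on `P`, contrary to transversality. -/
theorem IsLimitPair.snd_le_of_isVertexLine (hX : IsDeltaHyperbolic (Cay S) δ) (hδ : 0 ≤ δ)
    (hk : 1 ≤ k) (hkd : k < d) (hP : IsClosedInvariant P)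
    (hM : Dominates S k ρ (gammaPlus P 1 0 0) C c) (hξ : IsRayLimit ρ (gammaPlus P 1 0 0) c ξ)
    (hη : IsRayLimit ρ (gammaPlus P 1 0 0)⁻¹ c η) {η' : Pi₂ P → Gr d (d - k)}
    (h' : IsLimitPair ρ P ξ η') {g : ℤ → Γ} {x y : GroupBoundary S}
    (hg : IsVertexLine S g x y) (h0 : g 0 = 1) (hxy : (x, y) ∈ P) :
    (η' ⟨y, x, hxy⟩).1 ≤ (η ⟨y, x, hxy⟩).1 := by
  have := hX.1
  obtain ⟨φ, x₁, y₁, hφ, hxy₁, hlim, hx₁, -⟩ := exists_subseq_isVertexLine hP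
    (g := fun n j => (g (-n))⁻¹ * g (j + -n)) (fun n => (hg.shift (-n)).smul (g (-n))⁻¹)
    (fun n => hP.invariant _ _ _ hxy) (fun n => by simp)
  simp only [add_neg_cancel, h0, mul_one] at hx₁
  have hmem : ∀ n, (g (-(φ n : ℕ)))⁻¹ ∈ gammaPlus P 1 0 0 := fun n => by
    simpa [h0] using hg.inv_mul_mem hP hxy (i := -(φ n : ℕ)) (j := 0) (by simp)
  have hy : GroupTendsto (fun n => ((g (-(φ n : ℕ)))⁻¹)⁻¹) y := by
    simp only [inv_inv]
    exact (hg.reverse.groupTendsto (by simpa using h0)).subseq hφ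
  obtain ⟨hr, hU⟩ := tendsto_topPlane_of_mem_gammaPlus hX hδ hk hkd hP hM hξ le_rfl le_rfl hmem
    (x := ⟨x₁, y₁, hxy₁⟩) hx₁
  have hW := tendsto_topPlane_inv_of_mem_gammaPlus hX hδ hk hkd hP hM hη le_rfl le_rfl hmem
    (y := ⟨y, x, hxy⟩) hy
  intro v hv
  by_contra hvη
  have hv0 : v ≠ 0 := fun h => hvη (h ▸ Submodule.zero_mem _)
  obtain ⟨ε, -, hε, hnear⟩ := exists_nearPlane_map hk hkd (V := ℝ ∙ v)
    ((Submodule.disjoint_span_singleton' hv0).2 hvη).symm hU hW hr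
  have hq : Tendsto (fun n => (⟨_, hP.invariant (g (-(φ n : ℕ)))⁻¹ _ _ hxy⟩ : P)) atTop
      (𝓝 ⟨(x₁, y₁), hxy₁⟩) := tendsto_subtype_rng.2 hlim
  have hcont := squeeze_zero (fun _ => grDist_nonneg _ _) (fun _ => le_max_right _ _)
    ((h'.continuous _).comp hq)
  have hcont' := tendsto_projDist_of_grDist
    (fun n => ne_bot_of_finrank (show 1 ≤ d - k by omega) (η' _).2)
    (ne_bot_of_finrank (show 1 ≤ d - k by omega) (η' _).2) hcont
  obtain ⟨a, ha, hsum⟩ := exists_le_norm_sub_add_norm_sub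
    (h'.transverse ⟨x₁, y₁, hxy₁⟩ ⟨y₁, x₁, hxy₁⟩ hxy₁).disjoint
  have hsmall := (hε.add hcont').eventually (gt_mem_nhds (show (0 : ℝ) + 0 < a by simpa))
  obtain ⟨n, hn1, hn2⟩ := (hnear.and hsmall).exists
  set w := euclideanMap (ρ (g (-(φ n : ℕ)))⁻¹) v with hw
  have hw0 : w ≠ 0 := fun h => hv0 (euclideanMap_injective _ (by rw [map_zero]; exact h))
  have k1 := hn1 w (Submodule.mem_map_of_mem (Submodule.mem_span_singleton_self v))
  have hmap := h'.equivariant_snd (g (-(φ n : ℕ)))⁻¹ ⟨y, x, hxy⟩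
    ⟨_, _, hP.invariant (g (-(φ n : ℕ)))⁻¹ _ _ hxy⟩ rfl
  have k2 := nearPlane_projDist _ (η' ⟨y₁, x₁, hxy₁⟩).1 w
    (hmap.symm ▸ Submodule.mem_map_of_mem hv)
  have k3 := hsum w
  have hpos := norm_pos_iff.2 hw0
  have := mul_lt_mul_of_pos_right hn2 hpos
  rw [add_mul] at this
  linarith

/-- The limits over gap rays are the only pair of limit maps. -/
theorem IsLimitPair.eq_of_isRayLimit (hX : IsDeltaHyperbolic (Cay S) δ) (hδ : 0 ≤ δ)
    (hk : 1 ≤ k) (hkd : k < d) (hP : IsClosedInvariant P)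
    (hM : Dominates S k ρ (gammaPlus P 1 0 0) C c) (hξ : IsRayLimit ρ (gammaPlus P 1 0 0) c ξ)
    (hη : IsRayLimit ρ (gammaPlus P 1 0 0)⁻¹ c η) {ξ' : Pi₁ P → Gr d k}
    {η' : Pi₂ P → Gr d (d - k)} (h' : IsLimitPair ρ P ξ' η') : ξ' = ξ ∧ η' = η := by
  have := hX.1
  have h := isLimitPair_of_isRayLimit hX hδ hk hkd hP hM hξ hη
  have hfst : ξ' = ξ := by
    funext ⟨x, y, hxy⟩
    obtain ⟨g, hg⟩ := hX.exists_isVertexLine hδ (hP.ne _ hxy)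
    -- Equivariance reduces the comparison to lines through the identity.
    have hi := hP.invariant (g 0)⁻¹ _ _ hxy
    have e := h.fst_eq_of_isVertexLine hk hkd hP h' (hg.smul (g 0)⁻¹) (inv_mul_cancel _) hi
    refine Subtype.ext ?_
    rw [h.equivariant_fst (g 0) ⟨_, _, hi⟩ ⟨x, y, hxy⟩ (smul_inv_smul _ _).symm,
      h'.equivariant_fst (g 0) ⟨_, _, hi⟩ ⟨x, y, hxy⟩ (smul_inv_smul _ _).symm, e]
  subst hfst
  refine ⟨rfl, ?_⟩
  funext ⟨y, x, hxy⟩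
  obtain ⟨g, hg⟩ := hX.exists_isVertexLine hδ (hP.ne _ hxy)
  have hi := hP.invariant (g 0)⁻¹ _ _ hxy
  have hle := h'.snd_le_of_isVertexLine hX hδ hk hkd hP hM hξ hη (hg.smul (g 0)⁻¹)
    (inv_mul_cancel _) hi
  have e := Submodule.eq_of_le_of_finrank_eq hle ((η' _).2.trans (η _).2.symm)
  refine Subtype.ext ?_
  rw [h.equivariant_snd (g 0) ⟨_, _, hi⟩ ⟨y, x, hxy⟩ (smul_inv_smul _ _).symm,
    h'.equivariant_snd (g 0) ⟨_, _, hi⟩ ⟨y, x, hxy⟩ (smul_inv_smul _ _).symm, e]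

theorem tendsto_topSpace_of_tendsto_topPlane (hk : 1 ≤ k) (hkd : k < d) {A : ℕ → GL (Fin d) ℝ}
    {U : Submodule ℝ (EuclideanSpace ℝ (Fin d))} (hU0 : U ≠ ⊥)
    (hr : Tendsto (fun n => gapRatio k (A n)) atTop (𝓝 0))
    (hU : Tendsto (fun n => projDist (topPlane k (A n)) U) atTop (𝓝 0)) :
    (∀ᶠ n in atTop, sigma (k + 1) (A n) < sigma k (A n)) ∧
      Tendsto (fun n => grDist (topSpace k (A n)) U) atTop (𝓝 0) := by
  have hgap : ∀ᶠ n in atTop, sigma (k + 1) (A n) < sigma k (A n) :=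
    (hr.eventually (gt_mem_nhds one_pos)).mono fun n hn =>
      (div_lt_one (sigma_pos' hk hkd.le _)).1 hn
  refine ⟨hgap, (tendsto_grDist_of_projDist
    (fun n => ne_bot_of_finrank hk (finrank_topPlane hkd.le _)) hU0 hU).congr' ?_⟩
  exact hgap.mono fun n hn => by beta_reduce; rw [topSpace_eq_topPlane hn]

theorem exists_holder_forwardEnds (hX : IsDeltaHyperbolic (Cay S) δ) (hδ : 0 ≤ δ)
    (hk : 1 ≤ k) (hkd : k < d) (hP : IsClosedInvariant P)
    (hM : Dominates S k ρ (gammaPlus P 1 0 0) C c) (hξ : IsRayLimit ρ (gammaPlus P 1 0 0) c ξ)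
    {κ : ℝ} {dv : GroupBoundary S → GroupBoundary S → ℝ}
    (hv : IsVisualMetric (vertex S 1) κ dv) {lam ε : ℝ} (hlam : 1 ≤ lam) (hε : 0 ≤ ε) (b : ℝ) :
    ∃ K, 0 < K ∧ ∀ x x' : Pi₁ P, (x : GroupBoundary S) ∈ forwardEnds P lam ε b →
      (x' : GroupBoundary S) ∈ forwardEnds P lam ε b →
      grDist (ξ x).1 (ξ x').1 ≤ K * dv x x' ^ (min c κ / κ) := by
  obtain ⟨D, hD⟩ := exists_near_of_mem_forwardEnds hX hδ hP hlam hε b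
  obtain ⟨K, hK, hH⟩ := hξ.exists_holder hX hδ hk hkd hM hv D
  refine ⟨K, hK, fun x x' hx hx' => ?_⟩
  obtain ⟨g, y, hxy, hg, h0⟩ := hD _ hx
  obtain ⟨g', y', hxy', hg', h0'⟩ := hD _ hx'
  exact (grDist_le_projDist (ne_bot_of_finrank hk (ξ x).2) (ne_bot_of_finrank hk (ξ x').2)).trans
    (hH x x' _ _ (hg.gapRay hP hxy) (hg'.gapRay hP hxy') (by simpa) (by simpa))

theorem exists_pos_le_visual_of_isCompact (hX : IsDeltaHyperbolic (Cay S) δ) (hδ : 0 ≤ δ)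
    {κ : ℝ} {dv : GroupBoundary S → GroupBoundary S → ℝ}
    (hv : IsVisualMetric (vertex S 1) κ dv) {K : Set (GroupBoundary S × GroupBoundary S)}
    (hK : IsCompact K) (hne : ∀ q ∈ K, q.1 ≠ q.2) : ∃ m, 0 < m ∧ ∀ q ∈ K, m ≤ dv q.1 q.2 := by
  have hcont : Continuous fun q : GroupBoundary S × GroupBoundary S => dv q.1 q.2 :=
    hX.continuous_visual hδ hv
  rcases K.eq_empty_or_nonempty with rfl | hK0
  · exact ⟨1, one_pos, fun q hq => hq.elim⟩
  obtain ⟨q₀, hq₀, hmin⟩ := hK.exists_isMinOn hK0 hcont.continuousOn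
  refine ⟨_, lt_of_le_of_ne ?_ fun h => hne q₀ hq₀ ((hv.eq_zero_iff _ _).1 h.symm), hmin⟩
  linarith [hv.triangle q₀.1 q₀.2 q₀.1, hv.symm q₀.1 q₀.2, (hv.eq_zero_iff q₀.1 q₀.1).2 rfl]

theorem exists_holder_of_isCompact (hX : IsDeltaHyperbolic (Cay S) δ) (hδ : 0 ≤ δ)
    (hk : 1 ≤ k) (hkd : k < d) (hP : IsClosedInvariant P)
    (hM : Dominates S k ρ (gammaPlus P 1 0 0) C c) (hξ : IsRayLimit ρ (gammaPlus P 1 0 0) c ξ)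
    (hη : IsRayLimit ρ (gammaPlus P 1 0 0)⁻¹ c η) {κ : ℝ}
    {dv : GroupBoundary S → GroupBoundary S → ℝ} (hv : IsVisualMetric (vertex S 1) κ dv)
    {K : Set (GroupBoundary S × GroupBoundary S)} (hK : IsCompact K) (hKP : K ⊆ P) :
    ∃ L, 0 < L ∧ ∀ (x x' : Pi₁ P) (y y' : Pi₂ P),
      ((x : GroupBoundary S), (y : GroupBoundary S)) ∈ K →
      ((x' : GroupBoundary S), (y' : GroupBoundary S)) ∈ K →
      max (grDist (ξ x).1 (ξ x').1) (grDist (η y).1 (η y').1)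
        ≤ L * max (dv x x') (dv y y') ^ (min c κ / κ) := by
  obtain ⟨m, hm, hmin⟩ := exists_pos_le_visual_of_isCompact hX hδ hv hK fun q hq => hP.ne q (hKP hq)
  obtain ⟨L, hL, hH⟩ := exists_holder_of_le hX hδ hk hkd hP hM hξ hη hv hm
  have hdv : ∀ a b, 0 ≤ dv a b := fun a b => by
    linarith [hv.triangle a b a, hv.symm a b, (hv.eq_zero_iff a a).2 rfl]
  have hα : 0 ≤ min c κ / κ := div_nonneg (le_min hM.2.1.le hv.pos.le) hv.pos.le
  refine ⟨L, hL, fun x x' y y' hxy hxy' => ?_⟩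
  obtain ⟨e1, e2⟩ := hH x x' y y' (hKP hxy) (hKP hxy') (hmin _ hxy) (hmin _ hxy')
  exact max_le
    (e1.trans (mul_le_mul_of_nonneg_left
      (Real.rpow_le_rpow (hdv _ _) (le_max_left _ _) hα) hL.le))
    (e2.trans (mul_le_mul_of_nonneg_left
      (Real.rpow_le_rpow (hdv _ _) (le_max_right _ _) hα) hL.le))

end LimitPair

end

theorem theorem1p2 {Γ : Type*} [Group Γ] (S : FinSymmGenSet Γ) (hΓ : IsHyperbolicSpace (Cay S))
    (P : Set (GroupBoundary S × GroupBoundary S)) (hP : IsClosedInvariant P)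
    {d k : ℕ} (hk : 1 ≤ k) (hkd : k < d) (ρ : Γ →* GL (Fin d) ℝ)
    (hρ : IsDominatedOn S k ρ (gammaPlus P 1 0 0)) :
    ∃ (ξ : Pi₁ P → Gr d k) (η : Pi₂ P → Gr d (d - k)),
      -- `(ξ, η)` is the pair of limit maps of `ρ`
      IsLimitPair ρ P ξ η ∧
      (∀ (ξ' : Pi₁ P → Gr d k) (η' : Pi₂ P → Gr d (d - k)),
        IsLimitPair ρ P ξ' η' → ξ' = ξ ∧ η' = η) ∧
      -- the weak Cartan property
      (∀ (γ : ℕ → Γ) (x : Pi₁ P), GroupTendsto γ (x : GroupBoundary S) →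
        ∀ lam ε b : ℝ, 1 ≤ lam → 0 ≤ ε → 0 ≤ b → (∀ n, γ n ∈ gammaPlus P lam ε b) →
          (∀ᶠ n in atTop, sigma (k + 1) (ρ (γ n)) < sigma k (ρ (γ n))) ∧
          Tendsto (fun n => grDist (topSpace k (ρ (γ n))) (ξ x).1) atTop (𝓝 0)) ∧
      -- visual metrics exist
      (∃ κ₀ : ℝ, 0 < κ₀ ∧ ∀ κ : ℝ, 0 < κ → κ ≤ κ₀ →
        IsVisualMetric (Cay.vertex S 1) κ (chainDist (Cay.vertex S 1) κ)) ∧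
      -- Hölder continuity with respect to any visual metric
      (∀ (κ : ℝ) (dv : GroupBoundary S → GroupBoundary S → ℝ),
        IsVisualMetric (Cay.vertex S 1) κ dv →
        (∀ lam ε b : ℝ, 1 ≤ lam → 0 ≤ ε → 0 ≤ b →
          forwardEnds P lam ε b ⊆ Pi₁ P ∧
          ∃ C α : ℝ, 0 < C ∧ 0 < α ∧ α ≤ 1 ∧ ∀ x x' : Pi₁ P,
            (x : GroupBoundary S) ∈ forwardEnds P lam ε b →
            (x' : GroupBoundary S) ∈ forwardEnds P lam ε b →
            grDist (ξ x).1 (ξ x').1 ≤ C * dv x x' ^ α) ∧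
        (∀ K : Set (GroupBoundary S × GroupBoundary S), IsCompact K → K ⊆ P →
          ∃ C α : ℝ, 0 < C ∧ 0 < α ∧ α ≤ 1 ∧
            ∀ (x x' : Pi₁ P) (y y' : Pi₂ P),
              ((x : GroupBoundary S), (y : GroupBoundary S)) ∈ K →
              ((x' : GroupBoundary S), (y' : GroupBoundary S)) ∈ K →
              max (grDist (ξ x).1 (ξ x').1) (grDist (η y).1 (η y').1)
                ≤ C * max (dv x x') (dv y y') ^ α)) := by
  obtain ⟨δ, hδ, hX⟩ := hΓ
  obtain ⟨C, c, hM⟩ : ∃ C c, Dominates S k ρ (gammaPlus P 1 0 0) C c := hρ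
  have := hX.1
  obtain ⟨ξ, hξ⟩ := hM.exists_isRayLimit hk hkd (exists_gapRay_fst hX hδ hP)
  -- The second map is the first construction applied to the inverse set with index `d - k`, along
  -- backward halves of lines.
  obtain ⟨η, hη⟩ := (hM.inv hk hkd).exists_isRayLimit (by omega) (by omega)
    (exists_gapRay_snd hX hδ hP)
  refine ⟨ξ, η, isLimitPair_of_isRayLimit hX hδ hk hkd hP hM hξ hη,
    fun ξ' η' h' => h'.eq_of_isRayLimit hX hδ hk hkd hP hM hξ hη,
    fun γ x hγx lam ε b hlam hε _ hγ => ?_, hX.exists_isVisualMetric hδ _, fun κ dv hv => ?_⟩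
  · obtain ⟨hr, hU⟩ := tendsto_topPlane_of_mem_gammaPlus hX hδ hk hkd hP hM hξ hlam hε hγ hγx
    exact tendsto_topSpace_of_tendsto_topPlane hk hkd (ne_bot_of_finrank hk (ξ x).2) hr hU
  have hα : 0 < min c κ / κ := div_pos (lt_min hM.2.1 hv.pos) hv.pos
  have hα1 : min c κ / κ ≤ 1 := (div_le_one hv.pos).2 (min_le_right _ _)
  refine ⟨fun lam ε b hlam hε _ => ⟨fun x hx => ?_, ?_⟩, fun K hK hKP => ?_⟩
  · obtain ⟨D, hD⟩ := exists_near_of_mem_forwardEnds hX hδ hP hlam hε b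
    obtain ⟨g, y, hxy, -⟩ := hD x hx
    exact ⟨y, hxy⟩
  · obtain ⟨L, hL, h⟩ := exists_holder_forwardEnds hX hδ hk hkd hP hM hξ hv hlam hε b
    exact ⟨L, _, hL, hα, hα1, h⟩
  · obtain ⟨L, hL, h⟩ := exists_holder_of_isCompact hX hδ hk hkd hP hM hξ hη hv hK hKP
    exact ⟨L, _, hL, hα, hα1, h⟩
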